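/- **Proposition 2.5 (Duality).** Let $d\ge 1$, $s\in\mathbb R$, and let $\varphi:\mathbb R^d\to[0,1]$ be a smooth radial bump function with $\varphi=1$ on $B(0,1)$ and $\varphi=0$ outside $B(0,2)$. Write $\langle k\rangle=(1+|k|^2)^{1/2}$. *Decompositions.* For $0\le\alpha<1$ let $C>0$ be so large that the balls $B(\langle k\rangle^{\alpha/(1-\alpha)}k,\;C\langle k\rangle^{\alpha/(1-\alpha)})$, $k\in\mathbb Z^d$, cover $\mathbb R^d$. Put $\varphi_k^\alpha(\xi)=\varphi\big((\xi-\langle k\rangle^{\alpha/(1-\alpha)}k)/(C\langle k\rangle^{\alpha/(1-\alpha)})\big)$, $\eta_k^\alpha=\varphi_k^\alpha\big(\sum_{l}\varphi_l^\alpha\big)^{-1}$, and $\square_k^\alpha=\mathcal F^{-1}\eta_k^\alpha\mathcal F$ with weight $w_k^s=\langle k\rangle^{s/(1-\alpha)}$, $k\in\mathbb Z^d$. For $\alpha=1$ put $\varphi_0=\varphi$, $\varphi_j=\varphi(2^{-j}\cdot)-\varphi(2^{-j+1}\cdot)$ $(j\ge1)$ and use $\Delta_j=\mathcal F^{-1}\varphi_j\mathcal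 F$ with weight $w_j^s=2^{js}$, $j\in\{0,1,2,\dots\}$. In either case the operators are denoted $\square_k$ below. *Spaces.* A partition is a finite sequence $-\infty=t_0<t_1<\dots<t_K=\infty$. A $U^2$-atom is $a=\sum_{k=1}^K\chi_{[t_{k-1},t_k)}\phi_{k-1}$ with $\phi_k\in L^2(\mathbb R^d)$, $\phi_0=0$, $\sum_k\|\phi_k\|_2^2=1$. The space $U^2$ consists of the sums $u=\sum_j c_ja_j$ with atoms $a_j$ and $\sum_j|c_j|<\infty$, and $\|u\|_{U^2}=\inf\sum_j|c_j|$. The space $V^2$ consists of the functions $v:\mathbb R\to L^2(\mathbb R^d)$ (defined at every point of time) having limits at $\pm\infty$ and for which $\|v\|_{V^2}=\sup\big(\sum_{k=1}^K\|v(t_k)-v(t_{k-1})\|_2^2\big)^{1/2}<\infty$, the supremum being over all partitions, where $v(-\infty):=\lim_{t\to-\infty}v(t)$ and $v(\infty):=0$. Let $X^{s,\alpha}$ (resp. $Y^{s,\alpha}$) be the space of all $u:\mathbb R\to\mathcal S'(\mathbb R^d)$ such that every $\square_ku$ is in $U^2$ (resp. $V^2$) and $$\|u\|_{X^{s,\alpha}}=\sum_k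 w_k^s\|\square_ku\|_{U^2}<\infty,\qquad\text{resp.}\qquad \|u\|_{Y^{s,\alpha}}=\sup_k w_k^s\|\square_ku\|_{V^2}<\infty .$$ *The form $B$.* Let $\langle f,g\rangle=\sum_{k,l}\langle\square_kf,\square_lg\rangle_{L^2}$ be the extension of the $L^2$ inner product (conjugate linear in $g$), and for a partition $\mathfrak t$ put $B_{\mathfrak t}(u,v)=\sum_{k=1}^K\langle u(t_{k-1}),v(t_k)-v(t_{k-1})\rangle$, again with $u(-\infty)$, $v(-\infty)$ the limits at $-\infty$ (in $\mathcal S'(\mathbb R^d)$) and $v(\infty)=0$. *Claim.* Let $\alpha\in[0,1]$. For all $u\in X^{s,\alpha}$ and $v\in Y^{-s,\alpha}$ the series $\sum_{k,l}\langle\square_ku(\tau),\square_lv(\sigma)\rangle$ converges absolutely for all $\tau,\sigma\in[-\infty,\infty]$ (at $\infty$ both functions are set to $0$), and there is a unique number $B(u,v)$ such that for every $\varepsilon>0$ there is a partition $\mathfrak t$ with $|B(u,v)-B_{\mathfrak t'}(u,v)|<\varepsilon$ for all partitions $\mathfrak t'\supset\mathfrak t$. The map $T(v)=B(\cdot,v)$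 is a conjugate linear bijection of $Y^{-s,\alpha}$ onto the space $(X^{s,\alpha})^*$ of bounded linear functionals, and an isomorphism of normed spaces: there is a constant $c>0$, independent of $u$ and $v$, with $$c^{-1}\|v\|_{Y^{-s,\alpha}}\le\|T(v)\|_{(X^{s,\alpha})^*}\le c\,\|v\|_{Y^{-s,\alpha}},\qquad |B(u,v)|\le c\,\|u\|_{X^{s,\alpha}}\|v\|_{Y^{-s,\alpha}} .$$ In this sense $(X^{s,\alpha})^*=Y^{-s,\alpha}$, including $(X^{s,1})^*=Y^{-s,1}$. -/

import Mathlib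

open scoped SchwartzMap ContDiff InnerProductSpace
open Filter Topology MeasureTheory

noncomputable section

namespace FreqDuality

/-! ### Time partitions and the spaces `U²` and `V²` of functions `ℝ → H` -/

/-- A finite partition `-∞ = t₀ < t₁ < ⋯ < t_K = ∞` of the extended real line. -/
structure TimePartition where
  K : ℕ
  pt : Fin (K + 1) → EReal
  strictMono : StrictMono pt
  first : pt 0 = ⊥
  last : pt (Fin.last K) = ⊤

/-- `t' ⊃ t`: every point of `t` is a point of `t'`. -/
def TimePartition.Refines (t' t : TimePartition) : Prop :=
  Set.range t.pt ⊆ Set.range t'.pt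

/-- Extension of a function of time to `[-∞, ∞]`, with the convention
`v(-∞) = lim_{t → -∞} v(t)` and `v(∞) = 0`. -/
def extend {M : Type*} [TopologicalSpace M] [Zero M] (v : ℝ → M) (τ : EReal) : M :=
  if τ = ⊤ then 0 else if τ = ⊥ then limUnder atBot v else v τ.toReal

section UV

set_option linter.unusedSectionVars false

variable {H : Type*} [NormedAddCommGroup H] [NormedSpace ℂ H]

/-- A `U²`-atom: `a = ∑ₖ χ_[t_{k-1}, t_k) φ_{k-1}` for a partition `t` and `φ_0, …, φ_{K-1}`
with `φ_0 = 0` and `∑ₖ ‖φ_k‖² = 1`. -/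
def IsU2Atom (a : ℝ → H) : Prop :=
  ∃ (t : TimePartition) (φ : Fin t.K → H),
    (∀ k : Fin t.K, (k : ℕ) = 0 → φ k = 0) ∧ ∑ k, ‖φ k‖ ^ 2 = 1 ∧
    ∀ τ : ℝ, a τ = ∑ k : Fin t.K,
      {σ : ℝ | t.pt k.castSucc ≤ (σ : EReal) ∧ (σ : EReal) < t.pt k.succ}.indicator
        (fun _ => φ k) τ

/-- `u = ∑ⱼ cⱼ aⱼ` with atoms `aⱼ` and `∑ⱼ |cⱼ| < ∞` (atoms are bounded by `1`, so such a series
converges uniformly in time). -/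
def IsAtomicSeries (u : ℝ → H) (c : ℕ → ℂ) (a : ℕ → ℝ → H) : Prop :=
  (∀ j, IsU2Atom (a j)) ∧ (Summable fun j => ‖c j‖) ∧ ∀ τ, HasSum (fun j => c j • a j τ) (u τ)

/-- Membership in `U²`. -/
def IsU2 (u : ℝ → H) : Prop := ∃ c a, IsAtomicSeries u c a

/-- The `U²`-norm. -/
def u2Norm (u : ℝ → H) : ℝ := sInf {r | ∃ c a, IsAtomicSeries u c a ∧ r = ∑' j, ‖c j‖}

/-- `(∑ₖ ‖v(t_k) - v(t_{k-1})‖²)^{1/2}` for one partition. -/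
def v2Var (v : ℝ → H) (t : TimePartition) : ℝ :=
  √(∑ k : Fin t.K, ‖extend v (t.pt k.succ) - extend v (t.pt k.castSucc)‖ ^ 2)

/-- Membership in `V²`: both limits at `±∞` exist and the 2-variation is finite. -/
def IsV2 (v : ℝ → H) : Prop :=
  (∃ l, Tendsto v atBot (𝓝 l)) ∧ (∃ l, Tendsto v atTop (𝓝 l)) ∧
    BddAbove (Set.range (v2Var v))

/-- The `V²`-norm. -/
def v2Norm (v : ℝ → H) : ℝ := ⨆ t, v2Var v t

/-! Elementary facts: both are vector spaces and the norms are seminorms. -/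

lemma IsAtomicSeries.smul {u : ℝ → H} {c a} (h : IsAtomicSeries u c a) (z : ℂ) :
    IsAtomicSeries (z • u) (fun j => z * c j) a := by
  refine ⟨h.1, ?_, fun τ => ?_⟩
  · simpa [norm_mul] using h.2.1.mul_left ‖z‖
  · simpa [mul_smul] using (h.2.2 τ).const_smul z

lemma IsAtomicSeries.add {u v : ℝ → H} {c a c' a'} (h : IsAtomicSeries u c a)
    (h' : IsAtomicSeries v c' a') :
    ∃ c'' a'', IsAtomicSeries (u + v) c'' a'' ∧
      ∑' j, ‖c'' j‖ = ∑' j, ‖c j‖ + ∑' j, ‖c' j‖ := by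
  let e : ℕ ≃ ℕ ⊕ ℕ := Equiv.natSumNatEquivNat.symm
  have hs : HasSum (fun x : ℕ ⊕ ℕ => ‖Sum.elim c c' x‖) (∑' j, ‖c j‖ + ∑' j, ‖c' j‖) :=
    HasSum.sum (by simpa [Function.comp_def] using h.2.1.hasSum)
      (by simpa [Function.comp_def] using h'.2.1.hasSum)
  have hs' := (e.hasSum_iff (f := fun x : ℕ ⊕ ℕ => ‖Sum.elim c c' x‖)).2 hs
  refine ⟨fun j => Sum.elim c c' (e j), fun j => Sum.elim a a' (e j), ⟨fun j => ?_, ?_, ?_⟩, ?_⟩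
  · change IsU2Atom (Sum.elim a a' (e j))
    rcases e j with i | i
    · exact h.1 i
    · exact h'.1 i
  · exact hs'.summable
  · intro τ
    refine (e.hasSum_iff
      (f := fun x : ℕ ⊕ ℕ => Sum.elim c c' x • Sum.elim a a' x τ)).2 (HasSum.sum ?_ ?_)
    · simpa [Function.comp_def] using h.2.2 τ
    · simpa [Function.comp_def] using h'.2.2 τ
  · exact hs'.tsum_eq

lemma IsU2.add {u v : ℝ → H} (hu : IsU2 u) (hv : IsU2 v) : IsU2 (u + v) := by
  obtain ⟨c, a, h⟩ := hu
  obtain ⟨c', a', h'⟩ := hv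
  obtain ⟨c'', a'', h'', -⟩ := h.add h'
  exact ⟨c'', a'', h''⟩

lemma IsU2.smul {u : ℝ → H} (hu : IsU2 u) (z : ℂ) : IsU2 (z • u) := by
  obtain ⟨c, a, h⟩ := hu
  exact ⟨_, _, h.smul z⟩

lemma u2Norm_nonneg (u : ℝ → H) : 0 ≤ u2Norm u := by
  refine Real.sInf_nonneg ?_
  rintro _ ⟨c, a, -, rfl⟩
  exact tsum_nonneg fun j => norm_nonneg _

lemma u2Norm_le {u : ℝ → H} {c a} (h : IsAtomicSeries u c a) : u2Norm u ≤ ∑' j, ‖c j‖ := by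
  refine csInf_le ⟨0, ?_⟩ ⟨c, a, h, rfl⟩
  rintro _ ⟨c, a, -, rfl⟩
  exact tsum_nonneg fun j => norm_nonneg _

lemma IsU2.exists_lt {u : ℝ → H} (hu : IsU2 u) {ε : ℝ} (hε : 0 < ε) :
    ∃ c a, IsAtomicSeries u c a ∧ ∑' j, ‖c j‖ < u2Norm u + ε := by
  obtain ⟨c, a, h⟩ := hu
  obtain ⟨r, ⟨c', a', h', rfl⟩, hr⟩ := exists_lt_of_csInf_lt
    (s := {r | ∃ c a, IsAtomicSeries u c a ∧ r = ∑' j, ‖c j‖}) ⟨_, c, a, h, rfl⟩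
    (show u2Norm u < u2Norm u + ε by linarith)
  exact ⟨c', a', h', hr⟩

lemma u2Norm_add_le {u v : ℝ → H} (hu : IsU2 u) (hv : IsU2 v) :
    u2Norm (u + v) ≤ u2Norm u + u2Norm v := by
  refine le_of_forall_pos_le_add fun ε hε => ?_
  obtain ⟨c, a, h, hc⟩ := hu.exists_lt (half_pos hε)
  obtain ⟨c', a', h', hc'⟩ := hv.exists_lt (half_pos hε)
  obtain ⟨c'', a'', h'', e⟩ := h.add h'
  have := u2Norm_le h''
  linarith

lemma u2Norm_smul_le {u : ℝ → H} (hu : IsU2 u) (z : ℂ) :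
    u2Norm (z • u) ≤ ‖z‖ * u2Norm u := by
  refine le_of_forall_pos_le_add fun ε hε => ?_
  have hz : 0 < ‖z‖ + 1 := by positivity
  obtain ⟨c, a, h, hc⟩ := hu.exists_lt (div_pos hε hz)
  have h1 := u2Norm_le (h.smul z)
  simp only [norm_mul, tsum_mul_left] at h1
  have h2 : ‖z‖ * ∑' j, ‖c j‖ ≤ ‖z‖ * (u2Norm u + ε / (‖z‖ + 1)) :=
    mul_le_mul_of_nonneg_left hc.le (norm_nonneg z)
  have h3 : ‖z‖ * (ε / (‖z‖ + 1)) ≤ ε := by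
    rw [mul_div_assoc', div_le_iff₀ hz]
    nlinarith [norm_nonneg z]
  linarith

lemma exists_isU2Atom [Nontrivial H] : ∃ a : ℝ → H, IsU2Atom a := by
  let _ : NormedSpace ℝ H := NormedSpace.restrictScalars ℝ ℂ H
  obtain ⟨e, he⟩ := exists_norm_eq H zero_le_one
  refine ⟨_, ⟨2, ![⊥, 0, ⊤], ?_, rfl, rfl⟩, ![0, e], ?_, ?_, fun τ => rfl⟩
  · rw [Fin.strictMono_iff_lt_succ]
    intro i
    fin_cases i <;> simp
  · intro k hk
    fin_cases k
    · rfl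
    · simp at hk
  · simp [Fin.sum_univ_two, he]

lemma isU2_zero [Nontrivial H] : IsU2 (0 : ℝ → H) := by
  obtain ⟨a, ha⟩ := exists_isU2Atom (H := H)
  exact ⟨0, fun _ => a, fun _ => ha, by simp, fun τ => by simp⟩

lemma extend_add {v w : ℝ → H} (hv : ∃ l, Tendsto v atBot (𝓝 l))
    (hw : ∃ l, Tendsto w atBot (𝓝 l)) (τ : EReal) :
    extend (v + w) τ = extend v τ + extend w τ := by
  obtain ⟨l, hl⟩ := hv
  obtain ⟨m, hm⟩ := hw
  unfold extend
  split_ifs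
  · simp
  · rw [hl.limUnder_eq, hm.limUnder_eq]
    exact (hl.add hm).limUnder_eq
  · rfl

lemma extend_smul {v : ℝ → H} (hv : ∃ l, Tendsto v atBot (𝓝 l)) (z : ℂ) (τ : EReal) :
    extend (z • v) τ = z • extend v τ := by
  obtain ⟨l, hl⟩ := hv
  unfold extend
  split_ifs
  · simp
  · rw [hl.limUnder_eq]
    exact (hl.const_smul z).limUnder_eq
  · rfl

lemma v2Var_nonneg (v : ℝ → H) (t : TimePartition) : 0 ≤ v2Var v t := Real.sqrt_nonneg _

lemma v2Var_add_le {v w : ℝ → H} (hv : IsV2 v) (hw : IsV2 w) (t : TimePartition) :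
    v2Var (v + w) t ≤ v2Var v t + v2Var w t := by
  have key : ∀ f : Fin t.K → H, √(∑ k, ‖f k‖ ^ 2) = ‖WithLp.toLp 2 f‖ := fun f => by
    rw [PiLp.norm_eq_of_L2]
  unfold v2Var
  rw [key, key, key]
  refine le_trans (le_of_eq ?_) (norm_add_le _ _)
  congr 1
  ext k
  simp [extend_add hv.1 hw.1]
  abel

lemma v2Var_smul {v : ℝ → H} (hv : IsV2 v) (z : ℂ) (t : TimePartition) :
    v2Var (z • v) t = ‖z‖ * v2Var v t := by
  unfold v2Var
  simp only [extend_smul hv.1, ← smul_sub, norm_smul, mul_pow, ← Finset.mul_sum]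
  rw [Real.sqrt_mul (by positivity), Real.sqrt_sq (norm_nonneg z)]

lemma v2Norm_nonneg (v : ℝ → H) : 0 ≤ v2Norm v := Real.iSup_nonneg fun t => v2Var_nonneg v t

lemma IsV2.var_le {v : ℝ → H} (hv : IsV2 v) (t : TimePartition) : v2Var v t ≤ v2Norm v :=
  le_ciSup hv.2.2 t

lemma IsV2.add {v w : ℝ → H} (hv : IsV2 v) (hw : IsV2 w) : IsV2 (v + w) := by
  refine ⟨?_, ?_, v2Norm v + v2Norm w, ?_⟩
  · obtain ⟨l, hl⟩ := hv.1
    obtain ⟨m, hm⟩ := hw.1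
    exact ⟨_, hl.add hm⟩
  · obtain ⟨l, hl⟩ := hv.2.1
    obtain ⟨m, hm⟩ := hw.2.1
    exact ⟨_, hl.add hm⟩
  · rintro _ ⟨t, rfl⟩
    exact (v2Var_add_le hv hw t).trans (add_le_add (hv.var_le t) (hw.var_le t))

lemma IsV2.smul {v : ℝ → H} (hv : IsV2 v) (z : ℂ) : IsV2 (z • v) := by
  refine ⟨?_, ?_, ‖z‖ * v2Norm v, ?_⟩
  · obtain ⟨l, hl⟩ := hv.1
    exact ⟨_, hl.const_smul z⟩
  · obtain ⟨l, hl⟩ := hv.2.1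
    exact ⟨_, hl.const_smul z⟩
  · rintro _ ⟨t, rfl⟩
    rw [v2Var_smul hv]
    exact mul_le_mul_of_nonneg_left (hv.var_le t) (norm_nonneg z)

lemma v2Norm_add_le {v w : ℝ → H} (hv : IsV2 v) (hw : IsV2 w) :
    v2Norm (v + w) ≤ v2Norm v + v2Norm w :=
  Real.iSup_le (fun t => (v2Var_add_le hv hw t).trans (add_le_add (hv.var_le t) (hw.var_le t)))
    (add_nonneg (v2Norm_nonneg v) (v2Norm_nonneg w))

lemma v2Norm_smul_le {v : ℝ → H} (hv : IsV2 v) (z : ℂ) : v2Norm (z • v) ≤ ‖z‖ * v2Norm v :=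
  Real.iSup_le (fun t => by
    rw [v2Var_smul hv]
    exact mul_le_mul_of_nonneg_left (hv.var_le t) (norm_nonneg z))
    (mul_nonneg (norm_nonneg z) (v2Norm_nonneg v))

lemma v2Var_zero (t : TimePartition) : v2Var (0 : ℝ → H) t = 0 := by
  have h0 : ∀ τ, extend (0 : ℝ → H) τ = 0 := fun τ => by
    have : limUnder atBot (0 : ℝ → H) = 0 := Tendsto.limUnder_eq tendsto_const_nhds
    unfold extend
    split_ifs <;> simp [this]
  simp [v2Var, h0]

lemma isV2_zero : IsV2 (0 : ℝ → H) := by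
  refine ⟨⟨0, tendsto_const_nhds⟩, ⟨0, tendsto_const_nhds⟩, 0, ?_⟩
  rintro _ ⟨t, rfl⟩
  exact (v2Var_zero t).le

end UV

/-! ### Frequency decompositions -/

/-- `ℝ^d` with the Euclidean norm. -/
abbrev Space (d : ℕ) := EuclideanSpace ℝ (Fin d)

/-- The complex Hilbert space `L²(ℝ^d)`. -/
abbrev L2 (d : ℕ) := Lp ℂ 2 (volume : Measure (Space d))

instance (d : ℕ) : Nontrivial (L2 d) := by
  refine ⟨⟨indicatorConstLp 2 (measurableSet_ball (x := (0 : Space d)) (ε := 1))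
    measure_ball_lt_top.ne (1 : ℂ), 0, fun h => ?_⟩⟩
  have h1 := congrArg norm h
  rw [norm_indicatorConstLp (by norm_num) (by norm_num), norm_zero] at h1
  have h2 : 0 < volume.real (Metric.ball (0 : Space d) 1) :=
    ENNReal.toReal_pos (Metric.measure_ball_pos volume 0 one_pos).ne' measure_ball_lt_top.ne
  have h3 := Real.rpow_pos_of_pos h2 (1 / (2 : ENNReal).toReal)
  simp at h1 h3
  linarith

/-- A tempered distribution is (represented by) an `L²` function. -/
def IsL2 {d : ℕ} (f : 𝓢'(Space d, ℂ)) : Prop := ∃ g : L2 d, (g : 𝓢'(Space d, ℂ)) = f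

open Classical in
/-- The `L²` function representing a tempered distribution (which is unique), if there is one. -/
def l2Rep {d : ℕ} (f : 𝓢'(Space d, ℂ)) : L2 d := if h : IsL2 f then h.choose else 0

lemma l2Rep_coe {d : ℕ} (g : L2 d) : l2Rep (g : 𝓢'(Space d, ℂ)) = g := by
  have h : IsL2 (g : 𝓢'(Space d, ℂ)) := ⟨g, rfl⟩
  rw [l2Rep, dif_pos h]
  have hk := MeasureTheory.Lp.ker_toTemperedDistributionCLM_eq_bot
    (E := Space d) (F := ℂ) (μ := volume) (p := 2)
  exact LinearMap.ker_eq_bot.1 hk h.choose_spec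

/-- Data of a frequency decomposition of `ℝ^d`: the symbols `η_k` of the operators
`□_k = 𝓕⁻¹ η_k 𝓕`, and the weights `w_k^s` that measure the size of the `k`-th frequency. -/
structure FreqDecomp (d : ℕ) (ι : Type) where
  symbol : ι → Space d → ℝ
  weight : ℝ → ι → ℝ
  weight_pos : ∀ s k, 0 < weight s k

namespace FreqDecomp

variable {d : ℕ} {ι : Type} (D : FreqDecomp d ι)

/-- `□_k = 𝓕⁻¹ η_k 𝓕` on tempered distributions. -/
def op (k : ι) : 𝓢'(Space d, ℂ) →L[ℂ] 𝓢'(Space d, ℂ) :=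
  TemperedDistribution.fourierMultiplierCLM ℂ fun ξ => (D.symbol k ξ : ℂ)

/-- `□_k u`, as a function of time with values in `L²(ℝ^d)` (meaningful when every `□_k u(t)` is
in `L²`, which is part of the definition of the spaces below). -/
def block (k : ι) (u : ℝ → 𝓢'(Space d, ℂ)) (τ : ℝ) : L2 d := l2Rep (D.op k (u τ))

/-- Every `□_k u(t)` is in `L²`. -/
def HasL2Blocks (u : ℝ → 𝓢'(Space d, ℂ)) : Prop := ∀ k τ, IsL2 (D.op k (u τ))

/-- Membership in `X`: every `□_k u` is in `U²` and `∑ₖ w_k^s ‖□_k u‖_{U²} < ∞`. -/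
def MemX (s : ℝ) (u : ℝ → 𝓢'(Space d, ℂ)) : Prop :=
  D.HasL2Blocks u ∧ (∀ k, IsU2 (D.block k u)) ∧
    Summable fun k => D.weight s k * u2Norm (D.block k u)

/-- Membership in `Y`: every `□_k v` is in `V²` and `sup_k w_k^s ‖□_k v‖_{V²} < ∞`. -/
def MemY (s : ℝ) (v : ℝ → 𝓢'(Space d, ℂ)) : Prop :=
  D.HasL2Blocks v ∧ (∀ k, IsV2 (D.block k v)) ∧
    BddAbove (Set.range fun k => D.weight s k * v2Norm (D.block k v))

variable {D}

lemma HasL2Blocks.block_add {u v : ℝ → 𝓢'(Space d, ℂ)} (hu : D.HasL2Blocks u)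
    (hv : D.HasL2Blocks v) (k : ι) :
    (∀ τ, IsL2 (D.op k ((u + v) τ))) ∧ D.block k (u + v) = D.block k u + D.block k v := by
  have key : ∀ τ, IsL2 (D.op k ((u + v) τ)) ∧
      D.block k (u + v) τ = D.block k u τ + D.block k v τ := fun τ => by
    obtain ⟨f, hf⟩ := hu k τ
    obtain ⟨g, hg⟩ := hv k τ
    have e : ((f + g : L2 d) : 𝓢'(Space d, ℂ)) = D.op k ((u + v) τ) := by
      rw [Pi.add_apply, map_add, ← hf, ← hg]
      exact map_add (Lp.toTemperedDistributionCLM ℂ volume 2) f g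
    refine ⟨⟨f + g, e⟩, ?_⟩
    simp only [block]
    rw [← e, ← hf, ← hg, l2Rep_coe, l2Rep_coe, l2Rep_coe]
  exact ⟨fun τ => (key τ).1, funext fun τ => (key τ).2⟩

lemma HasL2Blocks.block_smul {u : ℝ → 𝓢'(Space d, ℂ)} (hu : D.HasL2Blocks u) (z : ℂ) (k : ι) :
    (∀ τ, IsL2 (D.op k ((z • u) τ))) ∧ D.block k (z • u) = z • D.block k u := by
  have key : ∀ τ, IsL2 (D.op k ((z • u) τ)) ∧
      D.block k (z • u) τ = z • D.block k u τ := fun τ => by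
    obtain ⟨f, hf⟩ := hu k τ
    have e : ((z • f : L2 d) : 𝓢'(Space d, ℂ)) = D.op k ((z • u) τ) := by
      rw [Pi.smul_apply, map_smul, ← hf]
      exact map_smul (Lp.toTemperedDistributionCLM ℂ volume 2) z f
    refine ⟨⟨z • f, e⟩, ?_⟩
    simp only [block]
    rw [← e, ← hf, l2Rep_coe, l2Rep_coe]
  exact ⟨fun τ => (key τ).1, funext fun τ => (key τ).2⟩

lemma block_zero (D : FreqDecomp d ι) (k : ι) :
    (∀ τ, IsL2 (D.op k ((0 : ℝ → 𝓢'(Space d, ℂ)) τ))) ∧ D.block k 0 = 0 := by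
  have e : ∀ τ, ((0 : L2 d) : 𝓢'(Space d, ℂ)) = D.op k ((0 : ℝ → 𝓢'(Space d, ℂ)) τ) := fun τ => by
    rw [Pi.zero_apply, map_zero]
    exact map_zero (Lp.toTemperedDistributionCLM ℂ volume 2)
  refine ⟨fun τ => ⟨0, e τ⟩, funext fun τ => ?_⟩
  simp only [block]
  rw [← e, l2Rep_coe, Pi.zero_apply]

lemma MemX.add_le {s : ℝ} {u v : ℝ → 𝓢'(Space d, ℂ)} (hu : D.MemX s u) (hv : D.MemX s v) (k : ι) :
    D.weight s k * u2Norm (D.block k (u + v)) ≤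
      D.weight s k * u2Norm (D.block k u) + D.weight s k * u2Norm (D.block k v) := by
  rw [(hu.1.block_add hv.1 k).2, ← mul_add]
  exact mul_le_mul_of_nonneg_left (u2Norm_add_le (hu.2.1 k) (hv.2.1 k)) (D.weight_pos s k).le

lemma MemX.smul_le {s : ℝ} {u : ℝ → 𝓢'(Space d, ℂ)} (hu : D.MemX s u) (z : ℂ) (k : ι) :
    D.weight s k * u2Norm (D.block k (z • u)) ≤ ‖z‖ * (D.weight s k * u2Norm (D.block k u)) := by
  rw [(hu.1.block_smul z k).2, mul_left_comm]
  exact mul_le_mul_of_nonneg_left (u2Norm_smul_le (hu.2.1 k) z) (D.weight_pos s k).le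

lemma MemY.add_le {s : ℝ} {u v : ℝ → 𝓢'(Space d, ℂ)} (hu : D.MemY s u) (hv : D.MemY s v) (k : ι) :
    D.weight s k * v2Norm (D.block k (u + v)) ≤
      D.weight s k * v2Norm (D.block k u) + D.weight s k * v2Norm (D.block k v) := by
  rw [(hu.1.block_add hv.1 k).2, ← mul_add]
  exact mul_le_mul_of_nonneg_left (v2Norm_add_le (hu.2.1 k) (hv.2.1 k)) (D.weight_pos s k).le

lemma MemY.smul_le {s : ℝ} {u : ℝ → 𝓢'(Space d, ℂ)} (hu : D.MemY s u) (z : ℂ) (k : ι) :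
    D.weight s k * v2Norm (D.block k (z • u)) ≤ ‖z‖ * (D.weight s k * v2Norm (D.block k u)) := by
  rw [(hu.1.block_smul z k).2, mul_left_comm]
  exact mul_le_mul_of_nonneg_left (v2Norm_smul_le (hu.2.1 k) z) (D.weight_pos s k).le

lemma u2Term_nonneg (D : FreqDecomp d ι) (s : ℝ) (u : ℝ → 𝓢'(Space d, ℂ)) (k : ι) :
    0 ≤ D.weight s k * u2Norm (D.block k u) :=
  mul_nonneg (D.weight_pos s k).le (u2Norm_nonneg _)

lemma v2Term_nonneg (D : FreqDecomp d ι) (s : ℝ) (u : ℝ → 𝓢'(Space d, ℂ)) (k : ι) :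
    0 ≤ D.weight s k * v2Norm (D.block k u) :=
  mul_nonneg (D.weight_pos s k).le (v2Norm_nonneg _)

lemma u2Norm_zero {H : Type*} [NormedAddCommGroup H] [NormedSpace ℂ H] [Nontrivial H] :
    u2Norm (0 : ℝ → H) = 0 := by
  refine le_antisymm ?_ (u2Norm_nonneg _)
  have := u2Norm_smul_le (isU2_zero (H := H)) 0
  simpa using this

variable (D) in
/-- `X` as a linear space of functions `ℝ → 𝓢'(ℝ^d)`. -/
def xSubmodule (s : ℝ) : Submodule ℂ (ℝ → 𝓢'(Space d, ℂ)) where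
  carrier := {u | D.MemX s u}
  zero_mem' := by
    refine ⟨fun k => (D.block_zero k).1, fun k => ?_, ?_⟩
    · rw [(D.block_zero k).2]
      exact isU2_zero
    · simp [fun k => (D.block_zero k).2, u2Norm_zero]
  add_mem' := fun {u v} hu hv => by
    refine ⟨fun k => (hu.1.block_add hv.1 k).1, fun k => ?_, ?_⟩
    · rw [(hu.1.block_add hv.1 k).2]
      exact (hu.2.1 k).add (hv.2.1 k)
    · exact Summable.of_nonneg_of_le (D.u2Term_nonneg s _) (hu.add_le hv) (hu.2.2.add hv.2.2)
  smul_mem' := fun z u hu => by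
    refine ⟨fun k => (hu.1.block_smul z k).1, fun k => ?_, ?_⟩
    · rw [(hu.1.block_smul z k).2]
      exact (hu.2.1 k).smul z
    · exact Summable.of_nonneg_of_le (D.u2Term_nonneg s _) (hu.smul_le z) (hu.2.2.mul_left ‖z‖)

variable (D) in
/-- `Y` as a linear space of functions `ℝ → 𝓢'(ℝ^d)`. -/
def ySubmodule (s : ℝ) : Submodule ℂ (ℝ → 𝓢'(Space d, ℂ)) where
  carrier := {v | D.MemY s v}
  zero_mem' := by
    refine ⟨fun k => (D.block_zero k).1, fun k => ?_, 0, ?_⟩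
    · rw [(D.block_zero k).2]
      exact isV2_zero
    · rintro _ ⟨k, rfl⟩
      simp [(D.block_zero k).2, v2Norm, v2Var_zero]
  add_mem' := fun {u v} hu hv => by
    refine ⟨fun k => (hu.1.block_add hv.1 k).1, fun k => ?_, ?_⟩
    · rw [(hu.1.block_add hv.1 k).2]
      exact (hu.2.1 k).add (hv.2.1 k)
    · obtain ⟨A, hA⟩ := hu.2.2
      obtain ⟨B, hB⟩ := hv.2.2
      refine ⟨A + B, ?_⟩
      rintro _ ⟨k, rfl⟩
      exact (hu.add_le hv k).trans (add_le_add (hA ⟨k, rfl⟩) (hB ⟨k, rfl⟩))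
  smul_mem' := fun z u hu => by
    refine ⟨fun k => (hu.1.block_smul z k).1, fun k => ?_, ?_⟩
    · rw [(hu.1.block_smul z k).2]
      exact (hu.2.1 k).smul z
    · obtain ⟨A, hA⟩ := hu.2.2
      refine ⟨‖z‖ * A, ?_⟩
      rintro _ ⟨k, rfl⟩
      exact (hu.smul_le z k).trans (mul_le_mul_of_nonneg_left (hA ⟨k, rfl⟩) (norm_nonneg z))

variable (D) in
/-- The space `X`. -/
def X (s : ℝ) : Type := ↥(D.xSubmodule s)

variable (D) in
/-- The space `Y`. -/
def Y (s : ℝ) : Type := ↥(D.ySubmodule s)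

instance (s : ℝ) : AddCommGroup (D.X s) := inferInstanceAs (AddCommGroup ↥(D.xSubmodule s))
instance (s : ℝ) : Module ℂ (D.X s) := inferInstanceAs (Module ℂ ↥(D.xSubmodule s))
instance (s : ℝ) : AddCommGroup (D.Y s) := inferInstanceAs (AddCommGroup ↥(D.ySubmodule s))
instance (s : ℝ) : Module ℂ (D.Y s) := inferInstanceAs (Module ℂ ↥(D.ySubmodule s))

/-- The function of time underlying an element of `X`. -/
def X.fn {s : ℝ} (u : D.X s) : ℝ → 𝓢'(Space d, ℂ) := u.1

/-- The function of time underlying an element of `Y`. -/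
def Y.fn {s : ℝ} (v : D.Y s) : ℝ → 𝓢'(Space d, ℂ) := v.1

variable (D) in
/-- `‖u‖_X = ∑ₖ w_k^s ‖□_k u‖_{U²}`. -/
def xNorm (s : ℝ) : Seminorm ℂ (D.X s) :=
  Seminorm.ofSMulLE (fun u => ∑' k, D.weight s k * u2Norm (D.block k u.fn))
    (by
      have h : ∀ k, D.block k (X.fn (0 : D.X s)) = 0 := fun k => (D.block_zero k).2
      simp [h, u2Norm_zero])
    (fun u v => by
      refine le_of_le_of_eq ?_ (u.2.2.2.tsum_add v.2.2.2)
      exact ((u + v : D.X s)).2.2.2.tsum_le_tsum (u.2.add_le v.2) (u.2.2.2.add v.2.2.2))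
    (fun z u => by
      rw [← tsum_mul_left]
      exact ((z • u : D.X s)).2.2.2.tsum_le_tsum (u.2.smul_le z) (u.2.2.2.mul_left ‖z‖))

variable (D) in
/-- `‖v‖_Y = sup_k w_k^s ‖□_k v‖_{V²}`. -/
def yNorm (s : ℝ) : Seminorm ℂ (D.Y s) :=
  Seminorm.ofSMulLE (fun v => ⨆ k, D.weight s k * v2Norm (D.block k v.fn))
    (by
      have h : ∀ k, D.block k (Y.fn (0 : D.Y s)) = 0 := fun k => (D.block_zero k).2
      simp [h, v2Norm, v2Var_zero])
    (fun u v => Real.iSup_le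
      (fun k => (u.2.add_le v.2 k).trans (add_le_add (le_ciSup u.2.2.2 k) (le_ciSup v.2.2.2 k)))
      (add_nonneg (Real.iSup_nonneg (D.v2Term_nonneg s _)) (Real.iSup_nonneg (D.v2Term_nonneg s _))))
    (fun z u => Real.iSup_le
      (fun k => (u.2.smul_le z k).trans
        (mul_le_mul_of_nonneg_left (le_ciSup u.2.2.2 k) (norm_nonneg z)))
      (mul_nonneg (norm_nonneg z) (Real.iSup_nonneg (D.v2Term_nonneg s _))))

instance (s : ℝ) : SeminormedAddCommGroup (D.X s) :=
  (D.xNorm s).toAddGroupSeminorm.toSeminormedAddCommGroup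
instance (s : ℝ) : NormedSpace ℂ (D.X s) where
  norm_smul_le z u := (map_smul_eq_mul (D.xNorm s) z u).le
instance (s : ℝ) : SeminormedAddCommGroup (D.Y s) :=
  (D.yNorm s).toAddGroupSeminorm.toSeminormedAddCommGroup
instance (s : ℝ) : NormedSpace ℂ (D.Y s) where
  norm_smul_le z v := (map_smul_eq_mul (D.yNorm s) z v).le

lemma X.norm_def {s : ℝ} (u : D.X s) : ‖u‖ = ∑' k, D.weight s k * u2Norm (D.block k u.fn) := rfl

lemma Y.norm_def {s : ℝ} (v : D.Y s) : ‖v‖ = ⨆ k, D.weight s k * v2Norm (D.block k v.fn) := rfl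

/-! ### The sesquilinear form `B` -/

variable (D) in
/-- The term `⟨□_k f, □_l g⟩` (inner product of `L²`, linear in `f`, conjugate linear in `g`). -/
def pairTerm (f g : 𝓢'(Space d, ℂ)) (p : ι × ι) : ℂ :=
  ⟪l2Rep (D.op p.2 g), l2Rep (D.op p.1 f)⟫_ℂ

variable (D) in
/-- The extension `⟨f, g⟩ = ∑_{k,l} ⟨□_k f, □_l g⟩` of the inner product of `L²` to tempered
distributions for which this series converges absolutely. -/
def pair (f g : 𝓢'(Space d, ℂ)) : ℂ := ∑' p : ι × ι, D.pairTerm f g p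

variable (D) in
/-- `B_t(u, v) = ∑ₖ ⟨u(t_{k-1}), v(t_k) - v(t_{k-1})⟩`. -/
def formOn (t : TimePartition) (u v : ℝ → 𝓢'(Space d, ℂ)) : ℂ :=
  ∑ k : Fin t.K, D.pair (extend u (t.pt k.castSucc))
    (extend v (t.pt k.succ) - extend v (t.pt k.castSucc))

variable (D) in
/-- `b = B(u, v)`: for every `ε > 0` there is a partition `t` such that `|b - B_{t'}(u, v)| < ε` for
all `t' ⊃ t`. -/
def IsForm (u v : ℝ → 𝓢'(Space d, ℂ)) (b : ℂ) : Prop :=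
  ∀ ε > 0, ∃ t : TimePartition, ∀ t' : TimePartition, t'.Refines t → ‖b - D.formOn t' u v‖ < ε

end FreqDecomp

/-! ### The dyadic and the `α`-decomposition -/

/-- A smooth radial bump function, supported in `B(0,2)` and equal to `1` on `B(0,1)`. -/
structure IsRadialBump {d : ℕ} (φ : Space d → ℝ) : Prop where
  smooth : ContDiff ℝ ∞ φ
  radial : ∀ ξ ζ, ‖ξ‖ = ‖ζ‖ → φ ξ = φ ζ
  nonneg : ∀ ξ, 0 ≤ φ ξ
  le_one : ∀ ξ, φ ξ ≤ 1
  eq_zero : ∀ ξ, 2 ≤ ‖ξ‖ → φ ξ = 0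
  eq_one : ∀ ξ, ‖ξ‖ < 1 → φ ξ = 1

/-- `k ∈ ℤ^d` as a point of `ℝ^d`. -/
def latticePt {d : ℕ} (k : Fin d → ℤ) : Space d := WithLp.toLp 2 fun i => (k i : ℝ)

/-- `⟨k⟩ = (1 + |k|²)^{1/2}`. -/
def bracket {d : ℕ} (k : Fin d → ℤ) : ℝ := √(1 + ‖latticePt k‖ ^ 2)

lemma bracket_pos {d : ℕ} (k : Fin d → ℤ) : 0 < bracket k := Real.sqrt_pos.2 (by positivity)

/-- `φ_k^α(ξ) = φ((ξ - ⟨k⟩^{α/(1-α)} k) / (C ⟨k⟩^{α/(1-α)}))`. -/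
def alphaBump {d : ℕ} (α C : ℝ) (φ : Space d → ℝ) (k : Fin d → ℤ) (ξ : Space d) : ℝ :=
  φ ((C * bracket k ^ (α / (1 - α)))⁻¹ • (ξ - bracket k ^ (α / (1 - α)) • latticePt k))

/-- The `α`-decomposition: `η_k^α = φ_k^α (∑_l φ_l^α)⁻¹`, with weights `⟨k⟩^{s/(1-α)}`. -/
def alphaDecomp {d : ℕ} (α C : ℝ) (φ : Space d → ℝ) : FreqDecomp d (Fin d → ℤ) where
  symbol k ξ := alphaBump α C φ k ξ * (∑' l, alphaBump α C φ l ξ)⁻¹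
  weight s k := bracket k ^ (s / (1 - α))
  weight_pos _ k := Real.rpow_pos_of_pos (bracket_pos k) _

/-- The balls `B(⟨k⟩^{α/(1-α)} k, C ⟨k⟩^{α/(1-α)})`, on which `φ_k^α = 1`, cover `ℝ^d`
(true for all sufficiently large `C`). -/
def Covers (d : ℕ) (α C : ℝ) : Prop :=
  ∀ ξ : Space d, ∃ k : Fin d → ℤ,
    ‖ξ - bracket k ^ (α / (1 - α)) • latticePt k‖ < C * bracket k ^ (α / (1 - α))

/-- The dyadic symbols: `φ_0 = φ` and `φ_j(ξ) = φ(2^{-j} ξ) - φ(2^{-j+1} ξ)` for `j ≥ 1`. -/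
def dyadicSymbol {d : ℕ} (φ : Space d → ℝ) (j : ℕ) (ξ : Space d) : ℝ :=
  if j = 0 then φ ξ else φ ((2 : ℝ) ^ (-(j : ℝ)) • ξ) - φ ((2 : ℝ) ^ (-(j : ℝ) + 1) • ξ)

/-- The dyadic decomposition, with weights `2^{js}`. -/
def dyadicDecomp {d : ℕ} (φ : Space d → ℝ) : FreqDecomp d ℕ where
  symbol j := dyadicSymbol φ j
  weight s j := (2 : ℝ) ^ ((j : ℝ) * s)
  weight_pos _ _ := Real.rpow_pos_of_pos two_pos _

end FreqDuality

end

/-!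
The duality of `X` and `Y` combines the duality of `U²` and `V²` for functions of time with values
in a Hilbert space with a decomposition of the frequencies into blocks that overlap boundedly.

*Time.* Against a step function along a partition `s`, the sum `B_t(u, v)` telescopes to a sum of
increments of `v` between points of `t`, one for each interval of `s` (`hilbertForm_stepFun`). Hence
`|B_t(a, v)| ≤ ‖v‖_{V²}` for every atom `a` by the Cauchy-Schwarz inequality, and `B_t(a, v)` does
not depend on `t` once `t` refines `s`. Summing over atoms, `B_t` converges along refining
partitions to a form `B` on `U² × V²` with `|B(u, v)| ≤ ‖u‖_{U²} ‖v‖_{V²}` (`hilbertB`). Conversely,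
given a bounded functional `ℓ` on `U²`, the Riesz representation theorem yields a function `v` with
`⟨h, v(t)⟩ = -ℓ(χ_[t, ∞) h)`. Testing `ℓ` on the step functions whose values are the increments of
`v` bounds the 2-variation of `v` by `‖ℓ‖`, and the limits of `v` at `±∞` exist since the increments
are dominated by those of a bounded monotone function (`exists_isV2_of_functional`).

*Frequency.* Both decompositions have symbols that form a locally finite partition of unity, with
only boundedly many symbols meeting a given one, and weights that are comparable for symbols that
meet; this is recorded in `IsLocalized`. For the `α`-decomposition it follows from the monotonicity
of `k ↦ ⟨k⟩^{α/(1-α)} k`, by which the supports of the `k`-th and the `l`-th symbol meet only if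
`|k - l| ≤ 4C` (`norm_latticePt_sub_le`). Since interacting blocks are boundedly many and have
comparable weights, the double series of pairings of blocks converges absolutely and is bounded by
`‖u‖_X ‖v‖_Y`, and the forms `B_t` on `X × Y` converge to the sum of the forms of the blocks.

*Duality.* A tempered distribution is determined by its blocks (`IsLocalized.eq_zero_of_op`), and
`B(□_j w, v) = B(w, □_j v)` for `w` in `U²` (`IsLocalized.form_emb`), which gives injectivity.
For surjectivity, a bounded functional `L` on `X` restricts to the functionals `w ↦ L(□_k w)` on
`U²`, which are represented by functions `b_k` in `V²` with `‖b_k‖ ≤ c w_k^s ‖L‖`. They are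
compatible in the way blocks of a distribution are, and as the weights grow polynomially in the frequency they
are the blocks of a function with values in the tempered distributions
(`IsLocalized.exists_synthesis_map`). This function represents `L` since finite sums of blocks are
dense in `X` (`IsLocalized.dual_ext`). The same synthesis gives the limits at `-∞` in the space of
tempered distributions on which the definition of `B_t` relies.
-/

noncomputable section

namespace FreqDuality

/-! ### Partitions of the extended time line -/

namespace TimePartition

/-- The points of a partition as a sequence, continued by `∞` beyond the last point. -/
def seq (t : TimePartition) (i : ℕ) : EReal := if h : i < t.K + 1 then t.pt ⟨i, h⟩ else ⊤

variable (t : TimePartition)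

lemma seq_zero : t.seq 0 = ⊥ := by
  rw [seq, dif_pos (Nat.succ_pos _)]
  exact t.first

lemma seq_K : t.seq t.K = ⊤ := by
  rw [seq, dif_pos (Nat.lt_succ_self _)]
  exact t.last

lemma pt_castSucc (k : Fin t.K) : t.pt k.castSucc = t.seq k := by
  rw [seq, dif_pos (by omega)]
  rfl

lemma pt_succ (k : Fin t.K) : t.pt k.succ = t.seq (k + 1) := by
  rw [seq, dif_pos (by omega)]
  rfl

lemma seq_mono : Monotone t.seq := by
  refine monotone_nat_of_le_succ fun i => ?_
  by_cases h : i + 1 < t.K + 1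
  · rw [seq, seq, dif_pos (by omega), dif_pos h]
    exact t.strictMono.monotone (by simp)
  · rw [seq.eq_1 t (i + 1), dif_neg h]
    exact le_top

lemma K_pos : 0 < t.K := by
  rcases Nat.eq_zero_or_pos t.K with h | h
  · have h0 := t.seq_zero
    have h1 := t.seq_K
    rw [h, h0] at h1
    exact absurd h1 bot_ne_top
  · exact h

lemma pt_succ_ne_bot (k : Fin t.K) : t.pt k.succ ≠ ⊥ :=
  (bot_le.trans_lt (t.strictMono k.castSucc_lt_succ)).ne'

lemma exists_le_seq (x : EReal) : ∃ i, x ≤ t.seq i := ⟨t.K, by rw [t.seq_K]; exact le_top⟩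

open Classical in
/-- The index of the first point of the partition that is not before `x`. -/
def idx (x : EReal) : ℕ := Nat.find (t.exists_le_seq x)

/-- The first point of the partition that is not before `x`. -/
def up (x : EReal) : EReal := t.seq (t.idx x)

lemma seq_lt_iff (x : EReal) (i : ℕ) : t.seq i < x ↔ i < t.idx x := by
  classical
  rw [idx, Nat.lt_find_iff]
  exact ⟨fun h m hm hx => (((hx.trans (t.seq_mono hm)).trans_lt h)).false,
    fun h => not_le.1 (h i le_rfl)⟩

lemma idx_le_K (x : EReal) : t.idx x ≤ t.K :=
  not_lt.1 fun h => not_top_lt ((t.seq_K ▸ (t.seq_lt_iff x t.K).2 h : ⊤ < x))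

lemma le_up (x : EReal) : x ≤ t.up x := by
  classical
  exact Nat.find_spec (t.exists_le_seq x)

lemma up_mono : Monotone t.up := fun x y hxy => t.seq_mono <| by
  by_contra! h
  have := (t.seq_lt_iff x _).2 h
  exact ((t.le_up y).trans_lt (this.trans_le hxy)).false

lemma up_bot : t.up ⊥ = ⊥ := by
  have : t.idx ⊥ = 0 := by
    by_contra h
    exact not_lt_bot ((t.seq_lt_iff ⊥ 0).2 (Nat.pos_of_ne_zero h))
  rw [up, this, t.seq_zero]

lemma up_top : t.up ⊤ = ⊤ := top_le_iff.1 (t.le_up ⊤)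

lemma up_eq_self {x : EReal} (hx : x ∈ Set.range t.pt) : t.up x = x := by
  obtain ⟨i, rfl⟩ := hx
  refine le_antisymm ?_ (t.le_up _)
  have hi : t.pt i = t.seq i := by rw [seq, dif_pos i.2]
  rw [hi]
  refine t.seq_mono (not_lt.1 fun h => ?_)
  exact ((t.seq_lt_iff _ _).2 h).false

/-- The increments over the intervals of the partition that start before `x` telescope. -/
lemma sum_lt {G : Type*} [AddCommGroup G] (V : EReal → G) (x : EReal) :
    ∑ k : Fin t.K, (if t.pt k.castSucc < x then V (t.pt k.succ) - V (t.pt k.castSucc) else 0) =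
      V (t.up x) - V ⊥ := by
  simp only [pt_castSucc, pt_succ, seq_lt_iff]
  rw [Fin.sum_univ_eq_sum_range
    (fun i => if i < t.idx x then V (t.seq (i + 1)) - V (t.seq i) else 0), ← Finset.sum_filter]
  have : (Finset.range t.K).filter (· < t.idx x) = Finset.range (t.idx x) := by
    ext i
    have := t.idx_le_K x
    simp only [Finset.mem_filter, Finset.mem_range]
    omega
  rw [this, Finset.sum_range_sub (fun i => V (t.seq i)), t.seq_zero, up]

/-- The partition with the points `h 0 < ⋯ < h m`. -/
def ofSeq (h : ℕ → EReal) (m : ℕ) (hm : ∀ i < m, h i < h (i + 1)) (h0 : h 0 = ⊥)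
    (h1 : h m = ⊤) : TimePartition where
  K := m
  pt i := h i
  strictMono := Fin.strictMono_iff_lt_succ.2 fun i => by simpa using hm i i.2
  first := h0
  last := h1

open Classical in
/-- The partition whose points are those of a given finite set. -/
def ofFinset (S : Finset EReal) (h0 : ⊥ ∈ S) (h1 : ⊤ ∈ S) : TimePartition where
  K := S.card - 1
  pt := S.orderEmbOfFin (by have := Finset.card_pos.2 ⟨_, h0⟩; omega)
  strictMono := (S.orderEmbOfFin _).strictMono
  first := by
    refine (S.orderEmbOfFin_zero _ (by omega)).trans (le_bot_iff.1 (S.min'_le _ h0))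
  last := by
    refine (S.orderEmbOfFin_last _ (by omega)).trans (top_le_iff.1 (S.le_max' _ h1))

lemma range_ofFinset (S : Finset EReal) (h0 : ⊥ ∈ S) (h1 : ⊤ ∈ S) :
    Set.range (ofFinset S h0 h1).pt = S := Finset.range_orderEmbOfFin _ _

lemma exists_refines (t t' : TimePartition) : ∃ r : TimePartition, r.Refines t ∧ r.Refines t' := by
  classical
  let S : Finset EReal := Finset.univ.image t.pt ∪ Finset.univ.image t'.pt
  have h0 : ⊥ ∈ S := Finset.mem_union_left _ (Finset.mem_image.2 ⟨_, Finset.mem_univ _, t.first⟩)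
  have h1 : ⊤ ∈ S := Finset.mem_union_left _ (Finset.mem_image.2 ⟨_, Finset.mem_univ _, t.last⟩)
  refine ⟨ofFinset S h0 h1, ?_, ?_⟩ <;> rw [Refines, range_ofFinset] <;> rintro _ ⟨i, rfl⟩ <;>
    simp [S]

end TimePartition

/-- The filter of eventually fine partitions: its sets contain all refinements of some partition. -/
def refFilter : Filter TimePartition := ⨅ t : TimePartition, 𝓟 {t' | t'.Refines t}

/-- The partition `-∞ < 0 < ∞`. -/
instance : Nonempty TimePartition :=
  ⟨.ofFinset {⊥, 0, ⊤} (by simp) (by simp)⟩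

lemma refFilter_hasBasis :
    refFilter.HasBasis (fun _ => True) fun t : TimePartition => {t' | t'.Refines t} := by
  refine hasBasis_iInf_principal fun t t' => ?_
  obtain ⟨r, h, h'⟩ := t.exists_refines t'
  exact ⟨r, fun x hx => h.trans hx, fun x hx => h'.trans hx⟩

instance : refFilter.NeBot :=
  refFilter_hasBasis.neBot_iff.2 fun {t} _ => ⟨t, Set.Subset.rfl⟩

lemma eventually_refines (t : TimePartition) : ∀ᶠ t' in refFilter, t'.Refines t :=
  refFilter_hasBasis.mem_of_mem (i := t) trivial

/-- A sum of increments over a weakly increasing sequence is one over a strictly increasing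
sequence with the same end points. -/
lemma exists_strict_seq {F : EReal → EReal → ℝ} (hF : ∀ x, F x x = 0) {g : ℕ → EReal}
    (hg : Monotone g) (n : ℕ) :
    ∃ (m : ℕ) (h : ℕ → EReal), (∀ i < m, h i < h (i + 1)) ∧ h 0 = g 0 ∧ h m = g n ∧
      ∑ i ∈ Finset.range n, F (g i) (g (i + 1)) = ∑ i ∈ Finset.range m, F (h i) (h (i + 1)) := by
  induction n with
  | zero => exact ⟨0, fun _ => g 0, by simp, rfl, rfl, by simp⟩
  | succ n ih =>
    obtain ⟨m, h, hm, h0, h1, hs⟩ := ih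
    rcases (hg n.le_succ).eq_or_lt with he | hl
    · refine ⟨m, h, hm, h0, h1.trans he, ?_⟩
      rw [Finset.sum_range_succ, hs, ← he, hF, add_zero]
    · refine ⟨m + 1, fun i => if i ≤ m then h i else g (n + 1), fun i hi => ?_, by simp [h0],
        by simp, ?_⟩
      · rcases (Nat.lt_succ_iff.1 hi).eq_or_lt with rfl | hi'
        · simpa [h1] using hl
        · have : i ≤ m := hi'.le
          simpa [this, Nat.succ_le_iff.2 hi'] using hm i hi'
      · rw [Finset.sum_range_succ, hs, Finset.sum_range_succ]
        congr 1
        · refine Finset.sum_congr rfl fun i hi => ?_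
          have := Finset.mem_range.1 hi
          beta_reduce
          rw [if_pos this.le, if_pos (Nat.succ_le_iff.2 this)]
        · simp [h1]

section Hilbert

set_option linter.unusedSectionVars false

variable {H : Type*} [NormedAddCommGroup H] [InnerProductSpace ℂ H]

lemma extend_top (v : ℝ → H) : extend v ⊤ = 0 := by simp [extend]

lemma extend_coe {M : Type*} [TopologicalSpace M] [Zero M] (v : ℝ → M) (τ : ℝ) :
    extend v τ = v τ := by simp [extend]

lemma extend_bot {M : Type*} [TopologicalSpace M] [Zero M] [T2Space M] {v : ℝ → M} {l : M}
    (h : Tendsto v atBot (𝓝 l)) : extend v ⊥ = l := by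
  rw [extend, if_neg bot_ne_top, if_pos rfl]
  exact h.limUnder_eq

/-- The quadratic variation along a partition is bounded by the square of the `V²`-norm. -/
lemma IsV2.sum_le {v : ℝ → H} (hv : IsV2 v) (t : TimePartition) :
    ∑ k : Fin t.K, ‖extend v (t.pt k.succ) - extend v (t.pt k.castSucc)‖ ^ 2 ≤ v2Norm v ^ 2 := by
  have h := hv.var_le t
  rw [v2Var, Real.sqrt_le_left (v2Norm_nonneg v)] at h
  exact h

/-- The bound for the quadratic variation persists for weakly increasing sequences. -/
lemma IsV2.sum_le_of_monotone {v : ℝ → H} (hv : IsV2 v) {g : ℕ → EReal} (hg : Monotone g) {n : ℕ}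
    (h0 : g 0 = ⊥) (h1 : g n = ⊤) :
    ∑ i ∈ Finset.range n, ‖extend v (g (i + 1)) - extend v (g i)‖ ^ 2 ≤ v2Norm v ^ 2 := by
  obtain ⟨m, h, hm, e0, e1, hs⟩ := exists_strict_seq
    (F := fun x y => ‖extend v y - extend v x‖ ^ 2) (by simp) hg n
  rw [hs, ← Fin.sum_univ_eq_sum_range (fun i => ‖extend v (h (i + 1)) - extend v (h i)‖ ^ 2)]
  exact hv.sum_le (.ofSeq h m hm (e0.trans h0) (e1.trans h1))

lemma IsV2.norm_extend_le {v : ℝ → H} (hv : IsV2 v) (τ : EReal) : ‖extend v τ‖ ≤ v2Norm v := by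
  have hg : Monotone fun i : ℕ => if i = 0 then ⊥ else if i = 1 then τ else (⊤ : EReal) := by
    refine monotone_nat_of_le_succ fun i => ?_
    rcases i with _ | _ | i <;> simp
  have h := hv.sum_le_of_monotone hg (n := 2) (by simp) (by simp)
  simp only [Finset.sum_range_succ, Finset.sum_range_zero] at h
  simp only [zero_add, one_ne_zero, if_true, if_false, OfNat.ofNat_ne_zero,
    OfNat.ofNat_ne_one, Nat.reduceAdd, extend_top, zero_sub, norm_neg] at h
  refine abs_le_of_sq_le_sq' ?_ (v2Norm_nonneg v) |>.2
  nlinarith [sq_nonneg ‖extend v τ - extend v ⊥‖]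

end Hilbert

/-! ### The pairing of `U²` and `V²` -/

lemma eventually_atBot_coe_lt {x : EReal} (hx : x ≠ ⊥) : ∀ᶠ τ : ℝ in atBot, (τ : EReal) < x := by
  obtain ⟨r, -, hr⟩ := EReal.lt_iff_exists_real_btwn.1 (bot_lt_iff_ne_bot.2 hx)
  filter_upwards [eventually_le_atBot r] with τ hτ
  exact (EReal.coe_le_coe_iff.2 hτ).trans_lt hr

section Hilbert

variable {H : Type*} [NormedAddCommGroup H]

/-- The step function `∑ₖ χ_[t_{k-1}, t_k) φ_{k-1}` on the extended time line. -/
def stepFun (t : TimePartition) (φ : Fin t.K → H) (x : EReal) : H :=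
  ∑ k : Fin t.K, if t.pt k.castSucc ≤ x ∧ x < t.pt k.succ then φ k else 0

lemma stepFun_of_mem (t : TimePartition) (φ : Fin t.K → H) {x : EReal} {k : Fin t.K}
    (h : t.pt k.castSucc ≤ x ∧ x < t.pt k.succ) : stepFun t φ x = φ k := by
  rw [stepFun, Finset.sum_eq_single k, if_pos h]
  · intro j _ hj
    rw [if_neg]
    rintro ⟨h1, h2⟩
    rcases lt_or_gt_of_ne hj with hlt | hlt
    · exact ((h2.trans_le (t.strictMono.monotone (Fin.succ_le_castSucc_iff.2 hlt))).trans_le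
        h.1).false
    · exact ((h.2.trans_le (t.strictMono.monotone (Fin.succ_le_castSucc_iff.2 hlt))).trans_le
        h1).false
  · simp

lemma stepFun_top (t : TimePartition) (φ : Fin t.K → H) : stepFun t φ ⊤ = 0 :=
  Finset.sum_eq_zero fun _ _ => if_neg fun h => not_top_lt h.2

lemma norm_stepFun_sq_le (t : TimePartition) (φ : Fin t.K → H) (x : EReal) :
    ‖stepFun t φ x‖ ^ 2 ≤ ∑ k, ‖φ k‖ ^ 2 := by
  by_cases h : ∃ k : Fin t.K, t.pt k.castSucc ≤ x ∧ x < t.pt k.succ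
  · obtain ⟨k, hk⟩ := h
    rw [stepFun_of_mem t φ hk]
    exact Finset.single_le_sum (f := fun k => ‖φ k‖ ^ 2) (fun i _ => sq_nonneg _)
      (Finset.mem_univ k)
  · rw [stepFun, Finset.sum_eq_zero fun k _ => if_neg fun hk => h ⟨k, hk⟩, norm_zero]
    simpa using Finset.sum_nonneg fun i _ => sq_nonneg _

lemma stepFun_eq_zero_of_lt (t : TimePartition) {φ : Fin t.K → H}
    (h0 : ∀ k : Fin t.K, (k : ℕ) = 0 → φ k = 0) {x : EReal} (hx : x < t.pt ⟨1, by
      have := t.K_pos; omega⟩) : stepFun t φ x = 0 := by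
  refine Finset.sum_eq_zero fun k _ => ?_
  rcases Nat.eq_zero_or_pos k with hk | hk
  · rw [h0 k hk, ite_self]
  · rw [if_neg]
    rintro ⟨h1, -⟩
    refine (hx.trans_le ((t.strictMono.monotone ?_).trans h1)).false
    exact Fin.mk_le_of_le_val hk

lemma tendsto_stepFun_atBot (t : TimePartition) {φ : Fin t.K → H}
    (h0 : ∀ k : Fin t.K, (k : ℕ) = 0 → φ k = 0) :
    Tendsto (fun τ : ℝ => stepFun t φ τ) atBot (𝓝 0) := by
  refine tendsto_const_nhds.congr' ?_
  have h1 : t.pt ⟨1, by have := t.K_pos; omega⟩ ≠ ⊥ := by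
    rw [← t.first]
    refine fun h => ?_
    have := congrArg Fin.val (t.strictMono.injective h)
    simp at this
  filter_upwards [eventually_atBot_coe_lt h1] with τ hτ
  exact (stepFun_eq_zero_of_lt t h0 hτ).symm

lemma isU2Atom_iff [NormedSpace ℂ H] {a : ℝ → H} : IsU2Atom a ↔
    ∃ (t : TimePartition) (φ : Fin t.K → H), (∀ k : Fin t.K, (k : ℕ) = 0 → φ k = 0) ∧
      ∑ k, ‖φ k‖ ^ 2 = 1 ∧ a = fun τ : ℝ => stepFun t φ τ := by
  simp only [IsU2Atom, funext_iff, stepFun, Set.indicator_apply, Set.mem_ofPred_eq]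

lemma extend_stepFun (t : TimePartition) {φ : Fin t.K → H}
    (h0 : ∀ k : Fin t.K, (k : ℕ) = 0 → φ k = 0) (x : EReal) :
    extend (fun τ : ℝ => stepFun t φ τ) x = stepFun t φ x := by
  induction x with
  | bot =>
    rw [extend_bot (tendsto_stepFun_atBot t h0), stepFun_eq_zero_of_lt t h0]
    rw [← t.first]
    exact t.strictMono (by simp [Fin.lt_def])
  | coe τ => rw [extend_coe]
  | top => rw [stepFun_top, extend, if_pos rfl]

variable [NormedSpace ℂ H] [CompleteSpace H]

set_option linter.unusedSectionVars false

lemma IsU2Atom.norm_extend_le {a : ℝ → H} (ha : IsU2Atom a) (x : EReal) : ‖extend a x‖ ≤ 1 := by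
  obtain ⟨t, φ, h0, h1, rfl⟩ := isU2Atom_iff.1 ha
  rw [extend_stepFun t h0]
  have := norm_stepFun_sq_le t φ x
  rw [h1] at this
  exact (sq_le_one_iff₀ (norm_nonneg _)).1 this

lemma IsU2Atom.tendsto_atBot {a : ℝ → H} (ha : IsU2Atom a) : Tendsto a atBot (𝓝 0) := by
  obtain ⟨t, φ, h0, h1, rfl⟩ := isU2Atom_iff.1 ha
  exact tendsto_stepFun_atBot t h0

lemma IsAtomicSeries.norm_term_le {u : ℝ → H} {c a} (h : IsAtomicSeries u c a) (j : ℕ) (x : EReal) :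
    ‖c j • extend (a j) x‖ ≤ ‖c j‖ := by
  rw [norm_smul]
  exact mul_le_of_le_one_right (norm_nonneg _) ((h.1 j).norm_extend_le x)

lemma IsU2.tendsto_atBot {u : ℝ → H} (hu : IsU2 u) : Tendsto u atBot (𝓝 0) := by
  obtain ⟨c, a, h⟩ := hu
  have h1 : Tendsto (fun τ => ∑' j, c j • a j τ) atBot (𝓝 (∑' _ : ℕ, (0 : H))) := by
    refine tendsto_tsum_of_dominated_convergence h.2.1 (fun j => ?_)
      (Eventually.of_forall fun τ j => ?_)
    · simpa using (h.1 j).tendsto_atBot.const_smul (c j)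
    · simpa [extend_coe] using h.norm_term_le j τ
  rw [tsum_zero] at h1
  exact h1.congr fun τ => (h.2.2 τ).tsum_eq

lemma IsU2.extend_bot {u : ℝ → H} (hu : IsU2 u) : extend u ⊥ = 0 :=
  FreqDuality.extend_bot hu.tendsto_atBot

lemma IsU2Atom.extend_bot {a : ℝ → H} (ha : IsU2Atom a) : extend a ⊥ = 0 :=
  FreqDuality.extend_bot ha.tendsto_atBot

lemma IsAtomicSeries.isU2 {u : ℝ → H} {c a} (h : IsAtomicSeries u c a) : IsU2 u := ⟨c, a, h⟩

lemma IsAtomicSeries.hasSum_extend {u : ℝ → H} {c a} (h : IsAtomicSeries u c a) (x : EReal) :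
    HasSum (fun j => c j • extend (a j) x) (extend u x) := by
  induction x with
  | bot => simp [h.isU2.extend_bot, (h.1 _).extend_bot]
  | coe τ => simpa [extend_coe] using h.2.2 τ
  | top => simp [extend]

lemma IsU2.norm_extend_le {u : ℝ → H} (hu : IsU2 u) (x : EReal) : ‖extend u x‖ ≤ u2Norm u := by
  refine le_of_forall_pos_le_add fun ε hε => ?_
  obtain ⟨c, a, h, hc⟩ := hu.exists_lt hε
  refine le_trans ?_ hc.le
  rw [← (h.hasSum_extend x).tsum_eq]
  exact tsum_of_norm_bounded h.2.1.hasSum fun j => h.norm_term_le j x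

end Hilbert

section Form

variable {H : Type*} [NormedAddCommGroup H] [InnerProductSpace ℂ H] [CompleteSpace H]

set_option linter.unusedSectionVars false

/-- `B_t(u, v) = ∑ₖ ⟨u(t_{k-1}), v(t_k) - v(t_{k-1})⟩` for functions of time with values in a
Hilbert space. -/
def hilbertForm (t : TimePartition) (u v : ℝ → H) : ℂ :=
  ∑ k : Fin t.K, ⟪extend v (t.pt k.succ) - extend v (t.pt k.castSucc),
    extend u (t.pt k.castSucc)⟫_ℂ

/-- Summation by parts over the points of `t` that fall into a common interval of `s`: along every
partition `t` a step function sees `v` only at the points of `t` that follow the points of `s`. -/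
lemma hilbertForm_stepFun (t s : TimePartition) {φ : Fin s.K → H}
    (h0 : ∀ k : Fin s.K, (k : ℕ) = 0 → φ k = 0) (v : ℝ → H) :
    hilbertForm t (fun τ : ℝ => stepFun s φ τ) v =
      ∑ j, ⟪extend v (t.up (s.pt j.succ)) - extend v (t.up (s.pt j.castSucc)), φ j⟫_ℂ := by
  simp only [hilbertForm, extend_stepFun s h0]
  simp only [stepFun, inner_sum]
  rw [Finset.sum_comm]
  refine Finset.sum_congr rfl fun j _ => ?_
  rw [← sub_sub_sub_cancel_right _ _ (extend v ⊥), ← t.sum_lt, ← t.sum_lt,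
    ← Finset.sum_sub_distrib, sum_inner]
  refine Finset.sum_congr rfl fun i _ => ?_
  have hlt : s.pt j.castSucc < s.pt j.succ := s.strictMono j.castSucc_lt_succ
  by_cases h1 : t.pt i.castSucc < s.pt j.castSucc
  · simp [h1, h1.trans hlt, h1.not_ge]
  · by_cases h2 : t.pt i.castSucc < s.pt j.succ
    · simp [h1, h2, not_lt.1 h1]
    · simp [h1, h2]

lemma norm_hilbertForm_stepFun_le (t s : TimePartition) {φ : Fin s.K → H}
    (h0 : ∀ k : Fin s.K, (k : ℕ) = 0 → φ k = 0) {v : ℝ → H} (hv : IsV2 v) :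
    ‖hilbertForm t (fun τ : ℝ => stepFun s φ τ) v‖ ≤ √(∑ k, ‖φ k‖ ^ 2) * v2Norm v := by
  rw [hilbertForm_stepFun t s h0]
  refine (norm_sum_le _ _).trans ?_
  calc ∑ j, ‖⟪extend v (t.up (s.pt j.succ)) - extend v (t.up (s.pt j.castSucc)), φ j⟫_ℂ‖
      ≤ ∑ j, ‖φ j‖ * ‖extend v (t.up (s.pt j.succ)) - extend v (t.up (s.pt j.castSucc))‖ :=
        Finset.sum_le_sum fun j _ => (norm_inner_le_norm _ _).trans_eq (mul_comm _ _)
    _ ≤ √(∑ k, ‖φ k‖ ^ 2) *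
        √(∑ j : Fin s.K, ‖extend v (t.up (s.pt j.succ)) - extend v (t.up (s.pt j.castSucc))‖ ^ 2) := by
        have h := Real.sum_mul_le_sqrt_mul_sqrt Finset.univ (fun j => ‖φ j‖) fun j : Fin s.K =>
          ‖extend v (t.up (s.pt j.succ)) - extend v (t.up (s.pt j.castSucc))‖

        exact h
    _ ≤ √(∑ k, ‖φ k‖ ^ 2) * v2Norm v := by
        refine mul_le_mul_of_nonneg_left ?_ (Real.sqrt_nonneg _)
        rw [Real.sqrt_le_left (v2Norm_nonneg v)]
        have := hv.sum_le_of_monotone (g := fun i => t.up (s.seq i)) (n := s.K)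
          (t.up_mono.comp s.seq_mono) (by rw [s.seq_zero, t.up_bot]) (by rw [s.seq_K, t.up_top])
        refine le_trans (le_of_eq ?_) this
        rw [← Fin.sum_univ_eq_sum_range (fun i => ‖extend v (t.up (s.seq (i + 1))) -
          extend v (t.up (s.seq i))‖ ^ 2)]
        simp only [s.pt_succ, s.pt_castSucc]

lemma IsU2Atom.norm_hilbertForm_le {a : ℝ → H} (ha : IsU2Atom a) {v : ℝ → H} (hv : IsV2 v)
    (t : TimePartition) : ‖hilbertForm t a v‖ ≤ v2Norm v := by
  obtain ⟨s, φ, h0, h1, rfl⟩ := isU2Atom_iff.1 ha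
  simpa [h1] using norm_hilbertForm_stepFun_le t s h0 hv

/-- Along refinements of the partition of a step function the form is constant. -/
lemma tendsto_hilbertForm_stepFun (s : TimePartition) {φ : Fin s.K → H}
    (h0 : ∀ k : Fin s.K, (k : ℕ) = 0 → φ k = 0) (v : ℝ → H) :
    Tendsto (fun t => hilbertForm t (fun τ : ℝ => stepFun s φ τ) v) refFilter
      (𝓝 (∑ j, ⟪extend v (s.pt j.succ) - extend v (s.pt j.castSucc), φ j⟫_ℂ)) := by
  refine tendsto_const_nhds.congr' ?_
  filter_upwards [eventually_refines s] with t ht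
  rw [hilbertForm_stepFun t s h0]
  simp only [t.up_eq_self (ht ⟨_, rfl⟩)]

lemma IsAtomicSeries.hasSum_hilbertForm {u : ℝ → H} {c a} (h : IsAtomicSeries u c a)
    (t : TimePartition) (v : ℝ → H) :
    HasSum (fun j => c j * hilbertForm t (a j) v) (hilbertForm t u v) := by
  simp only [hilbertForm, Finset.mul_sum]
  refine hasSum_sum fun k _ => ?_
  simpa [inner_smul_right] using (h.hasSum_extend (t.pt k.castSucc)).mapL
    (innerSL ℂ (extend v (t.pt k.succ) - extend v (t.pt k.castSucc)))

lemma IsU2.norm_hilbertForm_le {u v : ℝ → H} (hu : IsU2 u) (hv : IsV2 v) (t : TimePartition) :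
    ‖hilbertForm t u v‖ ≤ u2Norm u * v2Norm v := by
  have key : ∀ ε > 0, ‖hilbertForm t u v‖ ≤ (u2Norm u + ε) * v2Norm v := fun ε hε => by
    obtain ⟨c, a, h, hc⟩ := hu.exists_lt hε
    refine le_trans ?_ (mul_le_mul_of_nonneg_right hc.le (v2Norm_nonneg v))
    rw [← (h.hasSum_hilbertForm t v).tsum_eq]
    refine tsum_of_norm_bounded (h.2.1.hasSum.mul_right _) fun j => ?_
    rw [norm_mul]
    exact mul_le_mul_of_nonneg_left ((h.1 j).norm_hilbertForm_le hv t) (norm_nonneg _)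
  have hlim : Tendsto (fun ε : ℝ => (u2Norm u + ε) * v2Norm v) (𝓝[>] 0)
      (𝓝 ((u2Norm u + 0) * v2Norm v)) :=
    ((continuous_const.add continuous_id).mul continuous_const).continuousWithinAt
  rw [add_zero] at hlim
  exact ge_of_tendsto hlim (eventually_mem_nhdsWithin.mono fun ε hε => key ε hε)

lemma exists_tendsto_hilbertForm {u v : ℝ → H} (hu : IsU2 u) (hv : IsV2 v) :
    ∃ b, Tendsto (fun t => hilbertForm t u v) refFilter (𝓝 b) := by
  obtain ⟨c, a, h⟩ := hu
  have h1 : ∀ j, ∃ b, Tendsto (fun t => hilbertForm t (a j) v) refFilter (𝓝 b) := fun j => by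
    obtain ⟨s, φ, h0, -, he⟩ := isU2Atom_iff.1 (h.1 j)
    rw [he]
    exact ⟨_, tendsto_hilbertForm_stepFun s h0 v⟩
  choose b hb using h1
  refine ⟨∑' j, c j * b j, ?_⟩
  refine (tendsto_tsum_of_dominated_convergence (h.2.1.mul_right (v2Norm v))
    (fun j => (hb j).const_mul (c j)) (Eventually.of_forall fun t j => ?_)).congr
    fun t => (h.hasSum_hilbertForm t v).tsum_eq
  rw [norm_mul]
  exact mul_le_mul_of_nonneg_left ((h.1 j).norm_hilbertForm_le hv t) (norm_nonneg _)

/-- The form `B(u, v)` on `U² × V²`, as the limit of `B_t(u, v)` over refining partitions. -/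
def hilbertB (u v : ℝ → H) : ℂ := limUnder refFilter fun t => hilbertForm t u v

lemma tendsto_hilbertB {u v : ℝ → H} (hu : IsU2 u) (hv : IsV2 v) :
    Tendsto (fun t => hilbertForm t u v) refFilter (𝓝 (hilbertB u v)) :=
  tendsto_nhds_limUnder (exists_tendsto_hilbertForm hu hv)

lemma norm_hilbertB_le {u v : ℝ → H} (hu : IsU2 u) (hv : IsV2 v) :
    ‖hilbertB u v‖ ≤ u2Norm u * v2Norm v :=
  le_of_tendsto (tendsto_hilbertB hu hv).norm
    (Eventually.of_forall fun t => hu.norm_hilbertForm_le hv t)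

lemma hilbertB_add_left {u u' v : ℝ → H} (hu : IsU2 u) (hu' : IsU2 u') (hv : IsV2 v) :
    hilbertB (u + u') v = hilbertB u v + hilbertB u' v := by
  refine tendsto_nhds_unique (tendsto_hilbertB (hu.add hu') hv)
    (((tendsto_hilbertB hu hv).add (tendsto_hilbertB hu' hv)).congr fun t => ?_)
  simp only [hilbertForm, extend_add ⟨0, hu.tendsto_atBot⟩ ⟨0, hu'.tendsto_atBot⟩, inner_add_right,
    Finset.sum_add_distrib]

lemma hilbertB_smul_left {u v : ℝ → H} (hu : IsU2 u) (hv : IsV2 v) (z : ℂ) :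
    hilbertB (z • u) v = z * hilbertB u v := by
  refine tendsto_nhds_unique (tendsto_hilbertB (hu.smul z) hv)
    (((tendsto_hilbertB hu hv).const_mul z).congr fun t => ?_)
  simp only [hilbertForm, extend_smul ⟨0, hu.tendsto_atBot⟩, inner_smul_right, Finset.mul_sum]

lemma hilbertB_add_right {u v v' : ℝ → H} (hu : IsU2 u) (hv : IsV2 v) (hv' : IsV2 v') :
    hilbertB u (v + v') = hilbertB u v + hilbertB u v' := by
  refine tendsto_nhds_unique (tendsto_hilbertB hu (hv.add hv'))
    (((tendsto_hilbertB hu hv).add (tendsto_hilbertB hu hv')).congr fun t => ?_)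
  simp only [hilbertForm, extend_add hv.1 hv'.1, add_sub_add_comm, inner_add_left,
    Finset.sum_add_distrib]

lemma hilbertB_smul_right {u v : ℝ → H} (hu : IsU2 u) (hv : IsV2 v) (z : ℂ) :
    hilbertB u (z • v) = (starRingEnd ℂ) z * hilbertB u v := by
  refine tendsto_nhds_unique (tendsto_hilbertB hu (hv.smul z))
    (((tendsto_hilbertB hu hv).const_mul _).congr fun t => ?_)
  simp only [hilbertForm, extend_smul hv.1, ← smul_sub, inner_smul_left, Finset.mul_sum]

lemma hilbertB_stepFun (s : TimePartition) {φ : Fin s.K → H}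
    (h0 : ∀ k : Fin s.K, (k : ℕ) = 0 → φ k = 0) (v : ℝ → H) :
    hilbertB (fun τ : ℝ => stepFun s φ τ) v =
      ∑ j, ⟪extend v (s.pt j.succ) - extend v (s.pt j.castSucc), φ j⟫_ℂ :=
  (tendsto_hilbertForm_stepFun s h0 v).limUnder_eq

end Form

/-! ### The dual of `U²` -/

section Normed

variable {H : Type*} [NormedAddCommGroup H] [NormedSpace ℂ H]

set_option linter.unusedSectionVars false

lemma IsU2Atom.isAtomicSeries {a : ℝ → H} (ha : IsU2Atom a) :
    IsAtomicSeries a (Pi.single 0 1) fun _ => a := by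
  refine ⟨fun _ => ha, ?_, fun τ => ?_⟩
  · exact summable_of_ne_finset_zero (s := {0}) fun j hj => by
      simp [Pi.single_eq_of_ne (Finset.notMem_singleton.1 hj)]
  · have := hasSum_single (f := fun j : ℕ => (Pi.single 0 1 : ℕ → ℂ) j • a τ) 0
      fun j hj => by simp [Pi.single_eq_of_ne hj]
    simpa using this

lemma IsU2Atom.isU2 {a : ℝ → H} (ha : IsU2Atom a) : IsU2 a := ⟨_, _, ha.isAtomicSeries⟩

lemma IsU2Atom.u2Norm_le {a : ℝ → H} (ha : IsU2Atom a) : u2Norm a ≤ 1 := by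
  refine (FreqDuality.u2Norm_le ha.isAtomicSeries).trans_eq ?_
  rw [tsum_eq_single 0 fun j hj => by simp [Pi.single_eq_of_ne hj]]
  simp

variable [Nontrivial H]

lemma isU2_stepFun (t : TimePartition) {φ : Fin t.K → H}
    (h0 : ∀ k : Fin t.K, (k : ℕ) = 0 → φ k = 0) :
    IsU2 (fun τ : ℝ => stepFun t φ τ) ∧
      u2Norm (fun τ : ℝ => stepFun t φ τ) ≤ √(∑ k, ‖φ k‖ ^ 2) := by
  set r := √(∑ k, ‖φ k‖ ^ 2) with hr
  have hn : 0 ≤ ∑ k, ‖φ k‖ ^ 2 := Finset.sum_nonneg fun i _ => sq_nonneg _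
  rcases (Real.sqrt_nonneg (∑ k, ‖φ k‖ ^ 2)).eq_or_lt with h | h
  · have hφ : ∀ k, φ k = 0 := fun k => by
      have := (Finset.sum_eq_zero_iff_of_nonneg fun i _ => sq_nonneg _).1
        ((Real.sqrt_eq_zero hn).1 h.symm) k (Finset.mem_univ k)
      simpa using this
    have : (fun τ : ℝ => stepFun t φ τ) = 0 := by
      ext τ
      simp [stepFun, hφ]
    rw [this, hr, ← h]
    exact ⟨isU2_zero, (FreqDecomp.u2Norm_zero (H := H)).le⟩
  · have ha : IsU2Atom fun τ : ℝ => stepFun t (fun k => ((r : ℂ)⁻¹) • φ k) τ := by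
      refine isU2Atom_iff.2 ⟨t, _, fun k hk => by simp [h0 k hk], ?_, rfl⟩
      simp only [norm_smul, norm_inv, Complex.norm_real, mul_pow, ← Finset.mul_sum]
      rw [Real.norm_of_nonneg h.le, inv_pow, Real.sq_sqrt hn]
      exact inv_mul_cancel₀ (Real.sqrt_pos.1 h).ne'
    have he : (fun τ : ℝ => stepFun t φ τ) =
        (r : ℂ) • fun τ : ℝ => stepFun t (fun k => ((r : ℂ)⁻¹) • φ k) τ := by
      ext τ
      have hr0 : (r : ℂ) ≠ 0 := by exact_mod_cast h.ne'
      simp [stepFun, Finset.smul_sum, smul_ite, smul_smul, mul_inv_cancel₀ hr0]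
    rw [he]
    refine ⟨ha.isU2.smul _, (u2Norm_smul_le ha.isU2 _).trans ?_⟩
    rw [Complex.norm_real, Real.norm_of_nonneg h.le]
    exact mul_le_of_le_one_right h.le ha.u2Norm_le

variable (H) in
/-- `U²` as a linear space of functions of time. -/
def u2Space : Submodule ℂ (ℝ → H) where
  carrier := {u | IsU2 u}
  zero_mem' := isU2_zero
  add_mem' hu hv := hu.add hv
  smul_mem' z _ hu := hu.smul z

/-- The function `χ_[x, ∞) h` of time. -/
def step (x : EReal) (h : H) (τ : ℝ) : H := if x ≤ τ then h else 0

lemma step_zero (x : EReal) : step x (0 : H) = 0 := by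
  ext τ
  simp [step]

lemma step_top (h : H) : step ⊤ h = 0 := by
  ext τ
  simp [step]

lemma step_add (x : EReal) (h h' : H) : step x (h + h') = step x h + step x h' := by
  ext τ
  by_cases hx : x ≤ τ <;> simp [step, hx]

lemma step_smul (x : EReal) (z : ℂ) (h : H) : step x (z • h) = z • step x h := by
  ext τ
  by_cases hx : x ≤ τ <;> simp [step, hx]

/-- `χ_[x, ∞) h` is a step function for the partition `-∞ < x < ∞`, with the values `0` and `h`. -/
lemma step_eq_stepFun (x : ℝ) (h : H) : ∃ (t : TimePartition) (φ : Fin t.K → H),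
    (∀ k : Fin t.K, (k : ℕ) = 0 → φ k = 0) ∧ √(∑ k, ‖φ k‖ ^ 2) = ‖h‖ ∧
      step x h = (fun τ : ℝ => stepFun t φ τ) := by
  refine ⟨⟨2, ![⊥, x, ⊤], ?_, rfl, rfl⟩, ![0, h], ?_, ?_, ?_⟩
  · rw [Fin.strictMono_iff_lt_succ]
    intro i
    fin_cases i <;> simp
  · intro k hk
    fin_cases k
    · rfl
    · simp at hk
  · simp [Fin.sum_univ_two]
  · ext τ
    simp [stepFun, step]

lemma isU2_step {x : EReal} {h : H} (hx : x ≠ ⊥ ∨ h = 0) : IsU2 (step x h) := by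
  rcases hx with hx | rfl
  · induction x with
    | bot => exact absurd rfl hx
    | coe x =>
      obtain ⟨t, φ, h0, -, he⟩ := step_eq_stepFun x h
      rw [he]
      exact (isU2_stepFun t h0).1
    | top =>
      rw [step_top]
      exact isU2_zero
  · rw [step_zero]
    exact isU2_zero

lemma u2Norm_step_le (x : ℝ) (h : H) : u2Norm (step x h) ≤ ‖h‖ := by
  obtain ⟨t, φ, h0, h1, he⟩ := step_eq_stepFun x h
  rw [he, ← h1]
  exact (isU2_stepFun t h0).2

lemma stepFun_eq_sum_step (t : TimePartition) (φ : Fin t.K → H) :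
    (fun τ : ℝ => stepFun t φ τ) =
      ∑ k, (step (t.pt k.castSucc) (φ k) - step (t.pt k.succ) (φ k)) := by
  ext τ
  rw [Finset.sum_apply, stepFun]
  refine Finset.sum_congr rfl fun k _ => ?_
  have hlt : t.pt k.castSucc < t.pt k.succ := t.strictMono k.castSucc_lt_succ
  by_cases h1 : t.pt k.castSucc ≤ τ
  · by_cases h2 : t.pt k.succ ≤ τ
    · simp [step, h1, h2, h2.not_gt]
    · simp [step, h1, h2, not_le.1 h2]
  · have h2 : ¬ t.pt k.succ ≤ τ := fun h => h1 (hlt.le.trans h)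
    simp [step, h1, h2]

end Normed

section Duality

variable {H : Type*} [NormedAddCommGroup H] [InnerProductSpace ℂ H] [CompleteSpace H] [Nontrivial H]

set_option linter.unusedSectionVars false

lemma hilbertB_step (x : ℝ) (h : H) (v : ℝ → H) : hilbertB (step x h) v = -⟪v x, h⟫_ℂ := by
  let t : TimePartition := ⟨2, ![⊥, x, ⊤], by
    rw [Fin.strictMono_iff_lt_succ]
    intro i
    fin_cases i <;> simp, rfl, rfl⟩
  let φ : Fin t.K → H := (![0, h] : Fin 2 → H)
  have h0 : ∀ k : Fin t.K, (k : ℕ) = 0 → φ k = 0 := by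
    intro k hk
    have : k = (0 : Fin 2) := Fin.ext hk
    rw [this]
    rfl
  have he : step x h = fun τ : ℝ => stepFun t φ τ := by
    rw [stepFun_eq_sum_step]
    change _ = ∑ k : Fin 2, _
    rw [Fin.sum_univ_two]
    change _ = step ⊥ (0 : H) - step x (0 : H) + (step x h - step ⊤ h)
    rw [step_zero, step_zero, step_top]
    simp
  rw [he, hilbertB_stepFun t h0]
  change ∑ k : Fin 2, _ = _
  rw [Fin.sum_univ_two]
  change ⟪_, (0 : H)⟫_ℂ + ⟪extend v ⊤ - extend v x, h⟫_ℂ = _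
  rw [inner_zero_right, extend_top, extend_coe]
  simp

/-- A function of time is determined by its pairing with `U²`. -/
lemma eq_zero_of_hilbertB {v : ℝ → H} (h : ∀ x g, hilbertB (step (x : ℝ) g) v = 0) : v = 0 := by
  ext x
  have := h x (v x)
  rw [hilbertB_step, neg_eq_zero] at this
  exact inner_self_eq_zero.1 this

/-- The limit of `v` exists along a filter along which the increments of `v` are dominated by those
of a convergent real function. -/
lemma exists_tendsto_of_sq_le {v : ℝ → H} {Q : ℝ → ℝ} {l : Filter ℝ} [l.NeBot] {q : ℝ}
    (hQ : Tendsto Q l (𝓝 q)) (h : ∀ x y, ‖v x - v y‖ ^ 2 ≤ |Q x - Q y|) :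
    ∃ m, Tendsto v l (𝓝 m) := by
  rw [← cauchy_map_iff_exists_tendsto, cauchy_map_iff']
  have h1 := cauchy_map_iff'.1 hQ.cauchy_map
  rw [tendsto_uniformity_iff_dist_tendsto_zero] at h1 ⊢
  have h2 := (Real.continuous_sqrt.tendsto 0).comp h1
  rw [Real.sqrt_zero] at h2
  refine squeeze_zero (fun _ => dist_nonneg) (fun p => ?_) h2
  rw [dist_eq_norm]
  exact Real.le_sqrt_of_sq_le ((h _ _).trans_eq (Real.dist_eq _ _).symm)

/-- The sums of squared increments of `v` over the finite sequences from `x` to `∞`. -/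
def tailSums (v : ℝ → H) (x : EReal) : Set ℝ :=
  {r | ∃ (K : ℕ) (s : Fin (K + 1) → EReal), StrictMono s ∧ s 0 = x ∧ s (Fin.last K) = ⊤ ∧
    r = ∑ k : Fin K, ‖extend v (s k.succ) - extend v (s k.castSucc)‖ ^ 2}

lemma strictMono_cons {K : ℕ} {s : Fin (K + 1) → EReal} (hs : StrictMono s) {x : EReal}
    (hx : x < s 0) : StrictMono (Fin.cons x s : Fin (K + 2) → EReal) := by
  rw [Fin.strictMono_iff_lt_succ]
  intro i
  refine Fin.cases ?_ (fun j => ?_) i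
  · simpa using hx
  · rw [← Fin.succ_castSucc, Fin.cons_succ, Fin.cons_succ]
    exact hs j.castSucc_lt_succ

lemma cons_mem_tailSums {v : ℝ → H} {x y : EReal} (hxy : x < y) {r : ℝ} (hr : r ∈ tailSums v y) :
    ‖extend v y - extend v x‖ ^ 2 + r ∈ tailSums v x := by
  obtain ⟨K, s, hs, rfl, h1, rfl⟩ := hr
  refine ⟨K + 1, Fin.cons x s, strictMono_cons hs hxy, rfl, ?_, ?_⟩
  · rw [← Fin.succ_last, Fin.cons_succ, h1]
  · rw [Fin.sum_univ_succ]
    simp only [← Fin.succ_castSucc, Fin.cons_succ, Fin.castSucc_zero, Fin.cons_zero]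

lemma tailSums_nonempty (v : ℝ → H) {x : EReal} (hx : x ≠ ⊥) : (tailSums v x).Nonempty := by
  have h0 : (0 : ℝ) ∈ tailSums v ⊤ :=
    ⟨0, fun _ => ⊤, fun i j hij => absurd hij (by omega), rfl, rfl, by simp⟩
  rcases eq_or_ne x ⊤ with rfl | hx'
  · exact ⟨0, h0⟩
  · exact ⟨_, cons_mem_tailSums (lt_top_iff_ne_top.2 hx') h0⟩

/-- A function has bounded 2-variation as soon as the squared increments are bounded over finite
sequences of real times, continued by `∞`. -/
lemma isV2_of_tailSums_le {v : ℝ → H} {M : ℝ} (hM : 0 ≤ M)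
    (h : ∀ x : EReal, x ≠ ⊥ → ∀ r ∈ tailSums v x, r ≤ M ^ 2) : IsV2 v ∧ v2Norm v ≤ M := by
  -- the supremum over the tail after `x` is monotone in `x` and controls the increments of `v`
  let Q : ℝ → ℝ := fun x => sSup (tailSums v x)
  have hbdd : ∀ x : ℝ, BddAbove (tailSums v x) := fun x => ⟨M ^ 2, h x (EReal.coe_ne_bot x)⟩
  have hne : ∀ x : ℝ, (tailSums v x).Nonempty := fun x => tailSums_nonempty v (EReal.coe_ne_bot x)
  have hstep : ∀ x y : ℝ, x < y → ‖v y - v x‖ ^ 2 + Q y ≤ Q x := fun x y hxy => by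
    have : Q y ≤ Q x - ‖v y - v x‖ ^ 2 := csSup_le (hne y) fun r hr => by
      have := le_csSup (hbdd x) (cons_mem_tailSums (EReal.coe_lt_coe_iff.2 hxy) hr)
      rw [extend_coe, extend_coe] at this
      linarith
    linarith
  have hanti : Antitone Q := fun x y hxy => by
    rcases hxy.eq_or_lt with rfl | hlt
    · exact le_rfl
    · nlinarith [hstep x y hlt, sq_nonneg ‖v y - v x‖]
  have hsq : ∀ x y, ‖v x - v y‖ ^ 2 ≤ |Q x - Q y| := fun x y => by
    rcases lt_trichotomy x y with hlt | rfl | hlt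
    · rw [norm_sub_rev]
      exact (le_sub_iff_add_le.2 (hstep x y hlt)).trans (le_abs_self _)
    · simp
    · rw [abs_sub_comm]
      exact (le_sub_iff_add_le.2 (hstep y x hlt)).trans (le_abs_self _)
  have hQ0 : ∀ x, 0 ≤ Q x := fun x => by
    refine Real.sSup_nonneg ?_
    rintro _ ⟨K, s, -, -, -, rfl⟩
    exact Finset.sum_nonneg fun i _ => sq_nonneg _
  have hQM : ∀ x, Q x ≤ M ^ 2 := fun x => csSup_le (hne x) (h x (EReal.coe_ne_bot x))
  have hbot : ∃ l, Tendsto v atBot (𝓝 l) := exists_tendsto_of_sq_le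
    (tendsto_atBot_ciSup hanti ⟨M ^ 2, by rintro _ ⟨x, rfl⟩; exact hQM x⟩) hsq
  have htop : ∃ l, Tendsto v atTop (𝓝 l) := exists_tendsto_of_sq_le
    (tendsto_atTop_ciInf hanti ⟨0, by rintro _ ⟨x, rfl⟩; exact hQ0 x⟩) hsq
  have hvar : ∀ t, v2Var v t ≤ M := by
    rintro ⟨K, pt, hmono, hfirst, hlast⟩
    rw [v2Var, Real.sqrt_le_left hM]
    obtain ⟨l, hl⟩ := hbot
    cases K with
    | zero => simpa using sq_nonneg M
    | succ n =>
      dsimp only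
      rw [Fin.sum_univ_succ]
      have h1 : pt (Fin.succ 0) ≠ ⊥ := by
        rw [← hfirst]
        exact (hmono (Fin.succ_pos 0)).ne'
      have hr : ∑ k : Fin n, ‖extend v (pt k.succ.succ) - extend v (pt k.succ.castSucc)‖ ^ 2 ∈
          tailSums v (pt (Fin.succ 0)) :=
        ⟨n, fun i => pt i.succ, hmono.comp (Fin.strictMono_succ), rfl, hlast, rfl⟩
      -- the increment from `-∞` is the limit of the increments from finite times
      rw [Fin.castSucc_zero, hfirst, extend_bot hl]
      refine le_of_tendsto (((tendsto_const_nhds.sub hl).norm.pow 2).add_const _) ?_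
      filter_upwards [eventually_atBot_coe_lt h1] with x hx
      have := h x (EReal.coe_ne_bot x) _ (cons_mem_tailSums hx hr)
      rwa [extend_coe] at this
  exact ⟨⟨hbot, htop, M, by rintro _ ⟨t, rfl⟩; exact hvar t⟩, Real.iSup_le hvar hM⟩

/-- Bounded functionals on `U²` are given by the form `B` and elements of `V²`: the value `v(t)`
represents the functional `h ↦ -ℓ(χ_[t, ∞) h)`. -/
theorem exists_isV2_of_functional (ℓ : u2Space H →ₗ[ℂ] ℂ) {M : ℝ} (hM : 0 ≤ M)
    (hℓ : ∀ u : u2Space H, ‖ℓ u‖ ≤ M * u2Norm u.1) :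
    ∃ v : ℝ → H, IsV2 v ∧ v2Norm v ≤ M ∧ ∀ u : u2Space H, ℓ u = hilbertB u.1 v := by
  have hreal : ∀ x : ℝ, ∃ w : H, ∀ g,
      ⟪w, g⟫_ℂ = -ℓ ⟨step x g, isU2_step (.inl (EReal.coe_ne_bot x))⟩ := by
    intro x
    let L : H →ₗ[ℂ] ℂ :=
      { toFun := fun g => -ℓ ⟨step x g, isU2_step (.inl (EReal.coe_ne_bot x))⟩
        map_add' := fun g g' => by
          rw [← neg_add, ← map_add]
          congr 2
          exact Subtype.ext (step_add _ _ _)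
        map_smul' := fun z g => by
          rw [RingHom.id_apply, smul_neg, ← map_smul]
          congr 2
          exact Subtype.ext (step_smul _ _ _) }
    let L' : StrongDual ℂ H := L.mkContinuous M fun g => by
      change ‖-ℓ _‖ ≤ _
      rw [norm_neg]
      exact (hℓ _).trans (mul_le_mul_of_nonneg_left (u2Norm_step_le x g) hM)
    exact ⟨(InnerProductSpace.toDual ℂ H).symm L', fun g => InnerProductSpace.toDual_symm_apply⟩
  choose v hv using hreal
  -- before `v` is known to have a limit at `-∞`, its extension to `-∞` may only be paired with `0`
  have hext : ∀ (x : EReal) (g : H) (hx : x ≠ ⊥ ∨ g = 0),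
      ⟪extend v x, g⟫_ℂ = -ℓ ⟨step x g, isU2_step hx⟩ := by
    rintro x g hx
    rcases eq_or_ne g 0 with rfl | hg
    · rw [inner_zero_right, (Subtype.ext (step_zero x) :
        (⟨step x (0 : H), isU2_step hx⟩ : u2Space H) = 0), map_zero, neg_zero]
    induction x with
    | bot => exact absurd (hx.resolve_right hg) (by simp)
    | coe x => rw [extend_coe, hv]
    | top =>
      rw [extend_top, inner_zero_left, (Subtype.ext (step_top g) :
        (⟨step ⊤ g, isU2_step hx⟩ : u2Space H) = 0), map_zero, neg_zero]
  have hstep : ∀ (t : TimePartition) (φ : Fin t.K → H)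
      (h0 : ∀ k : Fin t.K, (k : ℕ) = 0 → φ k = 0),
      ℓ ⟨fun τ : ℝ => stepFun t φ τ, (isU2_stepFun t h0).1⟩ =
        ∑ k, ⟪extend v (t.pt k.succ) - extend v (t.pt k.castSucc), φ k⟫_ℂ := fun t φ h0 => by
    have hx : ∀ k : Fin t.K, t.pt k.castSucc ≠ ⊥ ∨ φ k = 0 := fun k => by
      rcases Nat.eq_zero_or_pos k with hk | hk
      · exact .inr (h0 k hk)
      · left
        rw [← t.first]
        exact (t.strictMono (Fin.lt_def.2 hk)).ne'
    have he : (⟨fun τ : ℝ => stepFun t φ τ, (isU2_stepFun t h0).1⟩ : u2Space H) =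
        ∑ k : Fin t.K, (⟨step (t.pt k.castSucc) (φ k), isU2_step (hx k)⟩ -
          ⟨step (t.pt k.succ) (φ k), isU2_step (.inl (t.pt_succ_ne_bot k))⟩ : u2Space H) := by
      refine Subtype.ext ?_
      rw [AddSubmonoidClass.coe_finsetSum]
      exact stepFun_eq_sum_step t φ
    rw [he, map_sum]
    refine Finset.sum_congr rfl fun k _ => ?_
    rw [map_sub, inner_sub_left, hext _ _ (hx k), hext _ _ (.inl (t.pt_succ_ne_bot k))]
    ring
  -- the functional is tested on the step function whose values are the increments of `v`
  have htail : ∀ x : EReal, x ≠ ⊥ → ∀ r ∈ tailSums v x, r ≤ M ^ 2 := by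
    rintro x hx r ⟨K, s, hs, rfl, h1, rfl⟩
    let t : TimePartition := ⟨K + 1, Fin.cons ⊥ s, strictMono_cons hs (bot_lt_iff_ne_bot.2 hx),
      rfl, by rw [← Fin.succ_last, Fin.cons_succ, h1]⟩
    let ψ : Fin K → H := fun k => extend v (s k.succ) - extend v (s k.castSucc)
    let φ : Fin t.K → H := (Fin.cons 0 ψ : Fin (K + 1) → H)
    have h0 : ∀ k : Fin t.K, (k : ℕ) = 0 → φ k = 0 := fun k hk => by
      have : k = (0 : Fin (K + 1)) := Fin.ext hk
      rw [this]
      rfl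
    have e1 : ∑ k, ‖φ k‖ ^ 2 = ∑ k, ‖ψ k‖ ^ 2 := by
      change ∑ k : Fin (K + 1), ‖(Fin.cons 0 ψ : Fin (K + 1) → H) k‖ ^ 2 = _
      rw [Fin.sum_univ_succ]
      simp
    have e2 : ℓ ⟨fun τ : ℝ => stepFun t φ τ, (isU2_stepFun t h0).1⟩ =
        ((∑ k, ‖ψ k‖ ^ 2 : ℝ) : ℂ) := by
      rw [hstep t φ h0]
      change ∑ k : Fin (K + 1), ⟪extend v ((Fin.cons ⊥ s : Fin (K + 2) → EReal) k.succ) -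
        extend v ((Fin.cons ⊥ s : Fin (K + 2) → EReal) k.castSucc),
          (Fin.cons 0 ψ : Fin (K + 1) → H) k⟫_ℂ = _
      rw [Fin.sum_univ_succ]
      simp only [← Fin.succ_castSucc, Fin.cons_succ, Fin.cons_zero, inner_zero_right, zero_add]
      push_cast
      exact Finset.sum_congr rfl fun k _ => inner_self_eq_norm_sq_to_K (ψ k)
    have h2 := (hℓ ⟨fun τ : ℝ => stepFun t φ τ, (isU2_stepFun t h0).1⟩).trans
      (mul_le_mul_of_nonneg_left (isU2_stepFun t h0).2 hM)
    have hS : 0 ≤ ∑ k, ‖ψ k‖ ^ 2 := Finset.sum_nonneg fun i _ => sq_nonneg _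
    rw [e2, e1, Complex.norm_real, Real.norm_of_nonneg hS] at h2
    change ∑ k, ‖ψ k‖ ^ 2 ≤ M ^ 2
    have h3 := Real.sq_sqrt hS
    have h4 := Real.sqrt_nonneg (∑ k, ‖ψ k‖ ^ 2)
    nlinarith [sq_nonneg (√(∑ k, ‖ψ k‖ ^ 2) - M)]
  obtain ⟨hV, hVM⟩ := isV2_of_tailSums_le hM htail
  refine ⟨v, hV, hVM, fun u => ?_⟩
  -- both sides are continuous on `U²` and agree on atoms
  obtain ⟨c, a, h⟩ := u.2
  have hat : ∀ j, ℓ ⟨a j, (h.1 j).isU2⟩ = hilbertB (a j) v := fun j => by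
    obtain ⟨s, φ, h0, -, he⟩ := isU2Atom_iff.1 (h.1 j)
    simp only [he]
    rw [hstep s φ h0, hilbertB_stepFun s h0]
  let D : u2Space H →ₗ[ℂ] ℂ :=
    { toFun := fun w => ℓ w - hilbertB w.1 v
      map_add' := fun w w' => by
        have e : hilbertB (w + w').1 v = _ := hilbertB_add_left w.2 w'.2 hV
        rw [map_add, e]
        ring
      map_smul' := fun z w => by
        have e : hilbertB (z • w).1 v = _ := hilbertB_smul_left w.2 hV z
        rw [map_smul, e]
        simp only [smul_eq_mul, RingHom.id_apply]
        ring }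
  have hD : ∀ w : u2Space H, ‖D w‖ ≤ (M + v2Norm v) * u2Norm w.1 := fun w => by
    refine (norm_sub_le _ _).trans ?_
    have := norm_hilbertB_le w.2 hV
    nlinarith [hℓ w]
  have hrem : ∀ n, ‖D u‖ ≤ (M + v2Norm v) * ∑' j, ‖c (j + n)‖ := fun n => by
    let p : u2Space H := ∑ j ∈ Finset.range n, c j • ⟨a j, (h.1 j).isU2⟩
    have hDp : D p = 0 := by
      rw [map_sum]
      refine Finset.sum_eq_zero fun j _ => ?_
      rw [map_smul]
      change c j • (ℓ ⟨a j, (h.1 j).isU2⟩ - hilbertB (a j) v) = 0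
      rw [hat, sub_self, smul_zero]
    have hs : IsAtomicSeries (u - p).1 (fun j => c (j + n)) fun j => a (j + n) := by
      refine ⟨fun j => h.1 _, (summable_nat_add_iff n).2 h.2.1, fun τ => ?_⟩
      have := (hasSum_nat_add_iff' n).2 (h.2.2 τ)
      convert this using 1
      simp [p, Finset.sum_apply]
    calc ‖D u‖ = ‖D (u - p)‖ := by rw [map_sub, hDp, sub_zero]
      _ ≤ (M + v2Norm v) * u2Norm (u - p).1 := hD _
      _ ≤ _ := mul_le_mul_of_nonneg_left (u2Norm_le hs) (add_nonneg hM (v2Norm_nonneg v))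
  have hlim : Tendsto (fun n => (M + v2Norm v) * ∑' j, ‖c (j + n)‖) atTop (𝓝 0) := by
    simpa using (tendsto_sum_nat_add fun j => ‖c j‖).const_mul (M + v2Norm v)
  have h0 : D u = 0 := norm_le_zero_iff.1 (ge_of_tendsto' hlim hrem)
  exact sub_eq_zero.1 h0

end Duality

section Operators

variable {H : Type*} [NormedAddCommGroup H] [InnerProductSpace ℂ H] [CompleteSpace H] [Nontrivial H]

set_option linter.unusedSectionVars false

/-- A bounded operator maps atoms to multiples of atoms. -/
lemma IsU2Atom.comp_clm (A : H →L[ℂ] H) {a : ℝ → H} (ha : IsU2Atom a) :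
    ∃ b : ℝ → H, IsU2Atom b ∧ ∃ c : ℝ, 0 ≤ c ∧ c ≤ ‖A‖ ∧ ∀ τ, A (a τ) = (c : ℂ) • b τ := by
  obtain ⟨t, φ, h0, h1, rfl⟩ := isU2Atom_iff.1 ha
  have hA : ∀ τ : ℝ, A (stepFun t φ τ) = stepFun t (fun k => A (φ k)) τ := fun τ => by
    simp only [stepFun, map_sum, apply_ite A, map_zero]
  have hle : ∑ k, ‖A (φ k)‖ ^ 2 ≤ ‖A‖ ^ 2 := by
    calc ∑ k, ‖A (φ k)‖ ^ 2 ≤ ∑ k, ‖A‖ ^ 2 * ‖φ k‖ ^ 2 := Finset.sum_le_sum fun k _ => by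
          rw [← mul_pow]
          exact pow_le_pow_left₀ (norm_nonneg _) (A.le_opNorm _) 2
      _ = ‖A‖ ^ 2 := by rw [← Finset.mul_sum, h1, mul_one]
  set r := √(∑ k, ‖A (φ k)‖ ^ 2) with hr
  have hn : 0 ≤ ∑ k, ‖A (φ k)‖ ^ 2 := Finset.sum_nonneg fun i _ => sq_nonneg _
  rcases (Real.sqrt_nonneg (∑ k, ‖A (φ k)‖ ^ 2)).eq_or_lt with h | h
  · refine ⟨_, ha, 0, le_rfl, norm_nonneg A, fun τ => ?_⟩
    have hφ : ∀ k, A (φ k) = 0 := fun k => by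
      have := (Finset.sum_eq_zero_iff_of_nonneg fun i _ => sq_nonneg _).1
        ((Real.sqrt_eq_zero hn).1 h.symm) k (Finset.mem_univ k)
      simpa using this
    rw [hA]
    simp [stepFun, hφ]
  · refine ⟨fun τ => stepFun t (fun k => ((r : ℂ)⁻¹) • A (φ k)) τ, isU2Atom_iff.2
      ⟨t, _, fun k hk => by simp [h0 k hk], ?_, rfl⟩, r, h.le, ?_, fun τ => ?_⟩
    · simp only [norm_smul, norm_inv, Complex.norm_real, mul_pow, ← Finset.mul_sum]
      rw [Real.norm_of_nonneg h.le, inv_pow, Real.sq_sqrt hn]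
      exact inv_mul_cancel₀ (Real.sqrt_pos.1 h).ne'
    · exact (Real.sqrt_le_left (norm_nonneg A)).2 hle
    · have hr0 : (r : ℂ) ≠ 0 := by exact_mod_cast h.ne'
      rw [hA]
      simp [stepFun, Finset.smul_sum, smul_ite, smul_smul, mul_inv_cancel₀ hr0]

lemma IsAtomicSeries.comp_clm (A : H →L[ℂ] H) {u : ℝ → H} {c a} (h : IsAtomicSeries u c a) :
    ∃ c' a', IsAtomicSeries (fun τ => A (u τ)) c' a' ∧ ∑' j, ‖c' j‖ ≤ ‖A‖ * ∑' j, ‖c j‖ := by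
  choose b hb r hr0 hr hA using fun j => (h.1 j).comp_clm A
  have hle : ∀ j, ‖c j * (r j : ℂ)‖ ≤ ‖A‖ * ‖c j‖ := fun j => by
    rw [norm_mul, Complex.norm_real, Real.norm_of_nonneg (hr0 j), mul_comm]
    exact mul_le_mul_of_nonneg_right (hr j) (norm_nonneg _)
  have hsum : Summable fun j => ‖c j * (r j : ℂ)‖ :=
    Summable.of_nonneg_of_le (fun _ => norm_nonneg _) hle (h.2.1.mul_left ‖A‖)
  refine ⟨fun j => c j * r j, b, ⟨hb, hsum, fun τ => ?_⟩, ?_⟩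
  · have := (h.2.2 τ).mapL A
    simpa only [map_smul, hA, smul_smul] using this
  · rw [← tsum_mul_left]
    exact hsum.tsum_le_tsum hle (h.2.1.mul_left ‖A‖)

lemma IsU2.comp_clm (A : H →L[ℂ] H) {u : ℝ → H} (hu : IsU2 u) : IsU2 fun τ => A (u τ) := by
  obtain ⟨c, a, h⟩ := hu
  obtain ⟨c', a', h', -⟩ := h.comp_clm A
  exact h'.isU2

lemma IsU2.u2Norm_comp_clm_le (A : H →L[ℂ] H) {u : ℝ → H} (hu : IsU2 u) :
    u2Norm (fun τ => A (u τ)) ≤ ‖A‖ * u2Norm u := by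
  have key : ∀ ε > 0, u2Norm (fun τ => A (u τ)) ≤ ‖A‖ * (u2Norm u + ε) := fun ε hε => by
    obtain ⟨c, a, h, hc⟩ := hu.exists_lt hε
    obtain ⟨c', a', h', hle⟩ := h.comp_clm A
    exact (u2Norm_le h').trans (hle.trans (mul_le_mul_of_nonneg_left hc.le (norm_nonneg A)))
  have hlim : Tendsto (fun ε : ℝ => ‖A‖ * (u2Norm u + ε)) (𝓝[>] 0) (𝓝 (‖A‖ * (u2Norm u + 0))) :=
    (continuous_const.mul (continuous_const.add continuous_id)).continuousWithinAt
  rw [add_zero] at hlim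
  exact ge_of_tendsto hlim (eventually_mem_nhdsWithin.mono fun ε hε => key ε hε)

lemma extend_comp_clm (A : H →L[ℂ] H) {v : ℝ → H} (hv : ∃ l, Tendsto v atBot (𝓝 l)) (x : EReal) :
    extend (fun τ => A (v τ)) x = A (extend v x) := by
  obtain ⟨l, hl⟩ := hv
  induction x with
  | bot => exact (extend_bot ((A.continuous.tendsto l).comp hl)).trans (by rw [extend_bot hl])
  | coe τ => rw [extend_coe, extend_coe]
  | top => rw [extend_top, extend_top, map_zero]

lemma IsV2.comp_clm (A : H →L[ℂ] H) {v : ℝ → H} (hv : IsV2 v) : IsV2 fun τ => A (v τ) := by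
  obtain ⟨⟨l, hl⟩, ⟨m, hm⟩, -⟩ := id hv
  refine ⟨⟨_, (A.continuous.tendsto l).comp hl⟩, ⟨_, (A.continuous.tendsto m).comp hm⟩,
    ‖A‖ * v2Norm v, ?_⟩
  rintro _ ⟨t, rfl⟩
  rw [v2Var, Real.sqrt_le_left (mul_nonneg (norm_nonneg A) (v2Norm_nonneg v)), mul_pow]
  refine le_trans ?_ (mul_le_mul_of_nonneg_left (hv.sum_le t) (sq_nonneg _))
  rw [Finset.mul_sum]
  refine Finset.sum_le_sum fun k _ => ?_
  rw [extend_comp_clm A hv.1, extend_comp_clm A hv.1, ← map_sub, ← mul_pow]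
  exact pow_le_pow_left₀ (norm_nonneg _) (A.le_opNorm _) 2

/-- A self-adjoint operator may be moved from one argument of `B` to the other. -/
lemma hilbertB_comp_clm (A : H →L[ℂ] H) (hA : ∀ f g, ⟪A f, g⟫_ℂ = ⟪f, A g⟫_ℂ) {u v : ℝ → H}
    (hu : IsU2 u) (hv : IsV2 v) :
    hilbertB (fun τ => A (u τ)) v = hilbertB u fun τ => A (v τ) := by
  refine congrArg (limUnder refFilter) (funext fun t => ?_)
  simp only [hilbertForm, extend_comp_clm A ⟨0, hu.tendsto_atBot⟩, extend_comp_clm A hv.1,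
    ← map_sub, hA]

/-- `B(u, v)` vanishes if all values of `u` are orthogonal to all values of `v`. -/
lemma hilbertB_eq_zero {u v : ℝ → H}
    (h : ∀ x y : EReal, ⟪extend v y, extend u x⟫_ℂ = 0) : hilbertB u v = 0 := by
  have : (fun t => hilbertForm t u v) = fun _ => 0 := by
    ext t
    exact Finset.sum_eq_zero fun k _ => by rw [inner_sub_left, h, h, sub_zero]
  rw [hilbertB, this]
  exact tendsto_const_nhds.limUnder_eq

end Operators

/-! ### Fourier multipliers on `L²` -/

section Multiplier

open FourierTransform

variable {d : ℕ}

lemma L2.toTemperedDistribution_injective {f g : L2 d} (h : (f : 𝓢'(Space d, ℂ)) = g) : f = g := by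
  rw [← l2Rep_coe f, h, l2Rep_coe]

/-- A bounded symbol of temperate growth defines a bounded operator on `L²`, which represents the
Fourier multiplier on tempered distributions and is self-adjoint if the symbol is real. -/
lemma exists_l2Multiplier {g : Space d → ℂ} (hg : g.HasTemperateGrowth) {C : ℝ} (hC : 0 ≤ C)
    (hgC : ∀ ξ, ‖g ξ‖ ≤ C) :
    ∃ M : L2 d →L[ℂ] L2 d, ‖M‖ ≤ C ∧
      (∀ f : L2 d, ((M f : L2 d) : 𝓢'(Space d, ℂ)) =
        TemperedDistribution.fourierMultiplierCLM ℂ g (f : 𝓢'(Space d, ℂ))) ∧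
      ((∀ ξ, (starRingEnd ℂ) (g ξ) = g ξ) → ∀ f h : L2 d, ⟪M f, h⟫_ℂ = ⟪f, M h⟫_ℂ) := by
  have hmem : MemLp g ⊤ (volume : Measure (Space d)) :=
    memLp_top_of_bound hg.1.continuous.aestronglyMeasurable C (Eventually.of_forall hgC)
  let G : Lp ℂ ⊤ (volume : Measure (Space d)) := hmem.toLp g
  have hG : ‖G‖ ≤ C := by
    rw [Lp.norm_toLp]
    refine ENNReal.toReal_le_of_le_ofReal hC ?_
    rw [eLpNorm_exponent_top]
    exact eLpNormEssSup_le_of_ae_bound (Eventually.of_forall hgC)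
  let L : L2 d →ₗ[ℂ] L2 d :=
    { toFun := fun f => 𝓕⁻ (G • 𝓕 f : L2 d)
      map_add' := fun f f' => by
        rw [FourierTransform.fourier_add, Lp.add_smul, FourierTransform.fourierInv_add]
      map_smul' := fun z f => by
        rw [FourierTransform.fourier_smul, ← Lp.smul_comm, FourierTransform.fourierInv_smul,
          RingHom.id_apply] }
  have hL : ∀ f, ‖L f‖ ≤ C * ‖f‖ := fun f => by
    change ‖(Lp.fourierTransformₗᵢ (Space d) ℂ).symm (G • 𝓕 f : L2 d)‖ ≤ _
    rw [LinearIsometryEquiv.norm_map]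
    refine (Lp.norm_smul_le _ _).trans ?_
    rw [Lp.norm_fourier_eq]
    exact mul_le_mul_of_nonneg_right hG (norm_nonneg _)
  refine ⟨L.mkContinuous C hL, L.mkContinuous_norm_le hC hL, fun f => ?_, fun hreal f h => ?_⟩
  · change ((𝓕⁻ (G • 𝓕 f : L2 d) : L2 d) : 𝓢'(Space d, ℂ)) = _
    rw [← Lp.fourierInv_toTemperedDistribution_eq,
      Lp.toTemperedDistribution_smul_eq hg hmem, ← Lp.fourier_toTemperedDistribution_eq]
    rfl
  · change ⟪(𝓕⁻ (G • 𝓕 f : L2 d) : L2 d), h⟫_ℂ = ⟪f, (𝓕⁻ (G • 𝓕 h : L2 d) : L2 d)⟫_ℂ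
    rw [← Lp.inner_fourier_eq, ← Lp.inner_fourier_eq f, fourier_fourierInv_eq,
      fourier_fourierInv_eq, L2.inner_def, L2.inner_def]
    refine integral_congr_ae ?_
    filter_upwards [Lp.coeFn_lpSMul (r := 2) G (𝓕 f), Lp.coeFn_lpSMul (r := 2) G (𝓕 h),
      hmem.coeFn_toLp] with ξ h1 h2 h3
    rw [h1, h2]
    simp only [Pi.smul_apply', smul_eq_mul, RCLike.inner_apply, map_mul, G, h3, hreal]
    ring

end Multiplier

/-! ### Tempered distributions are determined by test functions of compact support -/

section Density

variable {E : Type*} [NormedAddCommGroup E] [InnerProductSpace ℝ E] [FiniteDimensional ℝ E]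

set_option linter.unusedSectionVars false

lemma exists_cutoff : ∃ χ : E → ℂ, ContDiff ℝ ∞ χ ∧ HasCompactSupport χ ∧
    ∀ x, ‖x‖ < 1 → χ x = 1 := by
  let f : ContDiffBump (0 : E) := ⟨1, 2, by norm_num, by norm_num⟩
  refine ⟨fun x => (f x : ℂ), Complex.ofRealCLM.contDiff.comp f.contDiff,
    f.hasCompactSupport.comp_left (g := Complex.ofReal) Complex.ofReal_zero, fun x hx => ?_⟩
  beta_reduce
  rw [f.one_of_mem_closedBall (by simpa using hx.le)]
  simp

lemma exists_bound_iteratedFDeriv {χ : E → ℂ} (h1 : ContDiff ℝ ∞ χ) (h2 : HasCompactSupport χ)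
    (i : ℕ) : ∃ B : ℝ, 0 ≤ B ∧ ∀ c : ℝ, |c| ≤ 1 → ∀ x,
      ‖iteratedFDeriv ℝ i (fun y => χ (c • y) - 1) x‖ ≤ B := by
  obtain ⟨B, hB⟩ := (h2.iteratedFDeriv i (𝕜 := ℝ)).exists_bound_of_continuous
    (h1.continuous_iteratedFDeriv (mod_cast le_top))
  have hB0 : 0 ≤ B := (norm_nonneg _).trans (hB 0)
  have key : ∀ c : ℝ, |c| ≤ 1 → ∀ x, ‖iteratedFDeriv ℝ i (fun y => χ (c • y)) x‖ ≤ B := by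
    intro c hc x
    let L : E →L[ℝ] E := c • ContinuousLinearMap.id ℝ E
    have hL : ‖L‖ ≤ 1 := by
      refine (norm_smul_le c (ContinuousLinearMap.id ℝ E)).trans ?_
      rw [Real.norm_eq_abs]
      exact mul_le_one₀ hc (norm_nonneg _) ContinuousLinearMap.norm_id_le
    have he : iteratedFDeriv ℝ i (χ ∘ L) x =
        (iteratedFDeriv ℝ i χ (L x)).compContinuousLinearMap fun _ => L :=
      L.iteratedFDeriv_comp_right (n := ∞) h1 x (mod_cast le_top)
    change ‖iteratedFDeriv ℝ i (χ ∘ L) x‖ ≤ B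
    rw [he]
    refine (ContinuousMultilinearMap.norm_compContinuousLinearMap_le _ _).trans ?_
    refine (mul_le_of_le_one_right (norm_nonneg _) ?_).trans (hB _)
    exact Finset.prod_le_one (fun _ _ => norm_nonneg _) fun _ _ => hL
  refine ⟨B + 1, by positivity, fun c hc x => ?_⟩
  rcases Nat.eq_zero_or_pos i with rfl | hi
  · rw [norm_iteratedFDeriv_zero]
    have := key c hc x
    rw [norm_iteratedFDeriv_zero] at this
    exact (norm_sub_le _ _).trans (by simpa using this)
  · have hs : ContDiff ℝ ∞ fun y => χ (c • y) := h1.comp (contDiff_const_smul c)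
    have h3 : iteratedFDeriv ℝ i ((fun y => χ (c • y)) - fun _ => (1 : ℂ)) x =
        iteratedFDeriv ℝ i (fun y => χ (c • y)) x := by
      rw [iteratedFDeriv_sub_apply (hs.contDiffAt.of_le (mod_cast le_top)) contDiffAt_const,
        iteratedFDeriv_const_of_ne hi.ne']
      simp
    change ‖iteratedFDeriv ℝ i ((fun y => χ (c • y)) - fun _ => (1 : ℂ)) x‖ ≤ _
    rw [h3]
    linarith [key c hc x]

lemma hasTemperateGrowth_cutoff {χ : E → ℂ} (h1 : ContDiff ℝ ∞ χ) (h2 : HasCompactSupport χ)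
    {c : ℝ} (hc : c ≠ 0) : Function.HasTemperateGrowth fun y => χ (c • y) :=
  (h2.comp_smul hc).hasTemperateGrowth (h1.comp (contDiff_const_smul c))

/-- Cutting off at radius `j + 1` approximates a Schwartz function in the Schwartz topology. -/
lemma tendsto_cutoff_smul {χ : E → ℂ} (h1 : ContDiff ℝ ∞ χ) (h2 : HasCompactSupport χ)
    (h3 : ∀ x, ‖x‖ < 1 → χ x = 1) (ψ : 𝓢(E, ℂ)) :
    Tendsto (fun j : ℕ => SchwartzMap.smulLeftCLM ℂ (fun y => χ (((j : ℝ) + 1)⁻¹ • y)) ψ) atTop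
      (𝓝 ψ) := by
  refine ((schwartz_withSeminorms ℝ E ℂ).tendsto_nhds _ _).2 ?_
  rintro ⟨k, n⟩ ε hε
  choose B hB0 hB using exists_bound_iteratedFDeriv h1 h2
  set S : ℝ := ∑ i ∈ Finset.range (n + 1),
    (n.choose i : ℝ) * B i * SchwartzMap.seminorm ℝ (k + 1) (n - i) ψ with hS
  have hS0 : 0 ≤ S := Finset.sum_nonneg fun i _ =>
    mul_nonneg (mul_nonneg (Nat.cast_nonneg _) (hB0 i)) (apply_nonneg _ _)
  have hlim : Tendsto (fun j : ℕ => ((j : ℝ) + 1)⁻¹ * S) atTop (𝓝 0) := by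
    have := (tendsto_one_div_add_atTop_nhds_zero_nat (𝕜 := ℝ)).mul_const S
    simpa using this
  filter_upwards [hlim.eventually (gt_mem_nhds hε)] with j hj
  refine lt_of_le_of_lt ?_ hj
  have hj0 : (0 : ℝ) < (j : ℝ) + 1 := by positivity
  have hc : |((j : ℝ) + 1)⁻¹| ≤ 1 := by
    rw [abs_of_pos (inv_pos.2 hj0)]
    exact inv_le_one_of_one_le₀ (by linarith [Nat.cast_nonneg (α := ℝ) j])
  refine SchwartzMap.seminorm_le_bound ℝ k n _ (by positivity) fun x => ?_
  have hfun : ⇑(SchwartzMap.smulLeftCLM ℂ (fun y => χ (((j : ℝ) + 1)⁻¹ • y)) ψ - ψ) =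
      fun y => (χ (((j : ℝ) + 1)⁻¹ • y) - 1) * ψ y := by
    ext y
    rw [sub_apply, SchwartzMap.smulLeftCLM_apply_apply
      (hasTemperateGrowth_cutoff h1 h2 (inv_pos.2 hj0).ne'), smul_eq_mul]
    ring
  rw [hfun]
  rcases lt_or_ge ‖x‖ ((j : ℝ) + 1) with hx | hx
  · have hz : (fun y => (χ (((j : ℝ) + 1)⁻¹ • y) - 1) * ψ y) =ᶠ[𝓝 x] fun _ => 0 := by
      filter_upwards [(isOpen_lt continuous_norm continuous_const).mem_nhds hx] with y hy
      rw [h3 _ (by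
        rw [norm_smul, norm_inv, Real.norm_of_nonneg hj0.le, inv_mul_lt_iff₀ hj0, mul_one]
        exact hy), sub_self, zero_mul]
    rw [(hz.iteratedFDeriv ℝ n).eq_of_nhds]
    simp only [iteratedFDeriv_fun_zero, Pi.zero_apply, norm_zero, mul_zero]
    positivity
  · have hxp : 0 < ‖x‖ := hj0.trans_le hx
    have hsm : ContDiff ℝ ∞ fun y => χ (((j : ℝ) + 1)⁻¹ • y) - 1 :=
      (h1.comp (contDiff_const_smul _)).sub contDiff_const
    calc ‖x‖ ^ k * ‖iteratedFDeriv ℝ n (fun y => (χ (((j : ℝ) + 1)⁻¹ • y) - 1) * ψ y) x‖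
        ≤ ‖x‖ ^ k * ∑ i ∈ Finset.range (n + 1), (n.choose i : ℝ) *
            ‖iteratedFDeriv ℝ i (fun y => χ (((j : ℝ) + 1)⁻¹ • y) - 1) x‖ *
            ‖iteratedFDeriv ℝ (n - i) ψ x‖ := by
          refine mul_le_mul_of_nonneg_left ?_ (by positivity)
          exact norm_iteratedFDeriv_mul_le hsm (ψ.smooth ⊤) x (mod_cast le_top)
      _ = ∑ i ∈ Finset.range (n + 1), (n.choose i : ℝ) *
            ‖iteratedFDeriv ℝ i (fun y => χ (((j : ℝ) + 1)⁻¹ • y) - 1) x‖ *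
            (‖x‖⁻¹ * (‖x‖ ^ (k + 1) * ‖iteratedFDeriv ℝ (n - i) ψ x‖)) := by
          rw [Finset.mul_sum]
          refine Finset.sum_congr rfl fun i _ => ?_
          field_simp
          ring
      _ ≤ ∑ i ∈ Finset.range (n + 1), (n.choose i : ℝ) * B i *
            (((j : ℝ) + 1)⁻¹ * SchwartzMap.seminorm ℝ (k + 1) (n - i) ψ) := by
          refine Finset.sum_le_sum fun i _ => ?_
          have e1 := hB i _ hc x
          have e2 := SchwartzMap.le_seminorm ℝ (k + 1) (n - i) ψ x
          have e3 := inv_anti₀ hj0 hx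
          have e4 := hB0 i
          gcongr
      _ = ((j : ℝ) + 1)⁻¹ * S := by
          rw [hS, Finset.mul_sum]
          exact Finset.sum_congr rfl fun i _ => by ring

/-- A tempered distribution that vanishes on test functions of bounded support vanishes. -/
lemma temperedDistribution_eq_zero {w : 𝓢'(E, ℂ)}
    (hw : ∀ (R : ℝ) (ψ : 𝓢(E, ℂ)), (∀ x, R < ‖x‖ → ψ x = 0) → w ψ = 0) : w = 0 := by
  ext ψ
  obtain ⟨χ, h1, h2, h3⟩ := exists_cutoff (E := E)
  have ht := (w.continuous.tendsto ψ).comp (tendsto_cutoff_smul h1 h2 h3 ψ)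
  refine tendsto_nhds_unique ht (tendsto_const_nhds.congr fun j => ?_)
  have hj0 : (0 : ℝ) < (j : ℝ) + 1 := by positivity
  obtain ⟨R, hR⟩ := h2.isCompact.isBounded.exists_norm_le
  refine (hw (((j : ℝ) + 1) * R) _ fun x hx => ?_).symm
  rw [SchwartzMap.smulLeftCLM_apply_apply (hasTemperateGrowth_cutoff h1 h2 (inv_pos.2 hj0).ne'),
    image_eq_zero_of_notMem_tsupport (f := χ), zero_smul]
  intro hmem
  have := hR _ hmem
  rw [norm_smul, norm_inv, Real.norm_of_nonneg hj0.le, inv_mul_le_iff₀ hj0] at this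
  exact this.not_gt hx

end Density

/-! ### Decompositions with boundedly overlapping symbols -/

lemma coe_l2Rep {d : ℕ} {f : 𝓢'(Space d, ℂ)} (h : IsL2 f) : (l2Rep f : 𝓢'(Space d, ℂ)) = f := by
  obtain ⟨g, rfl⟩ := h
  rw [l2Rep_coe]

section Coe

variable {d : ℕ}

lemma coe_sum {κ : Type*} (S : Finset κ) (f : κ → L2 d) :
    ((∑ k ∈ S, f k : L2 d) : 𝓢'(Space d, ℂ)) = ∑ k ∈ S, (f k : 𝓢'(Space d, ℂ)) :=
  map_sum (Lp.toTemperedDistributionCLM ℂ volume 2) f S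

lemma coe_zero : ((0 : L2 d) : 𝓢'(Space d, ℂ)) = 0 :=
  map_zero (Lp.toTemperedDistributionCLM ℂ volume 2)

lemma continuous_coe : Continuous fun f : L2 d => (f : 𝓢'(Space d, ℂ)) :=
  (Lp.toTemperedDistributionCLM ℂ volume 2).continuous

end Coe

/-- The properties of a frequency decomposition on which the duality rests: the symbols form a
locally finite partition of unity, `N k` contains the finitely many indices whose symbols meet the
`k`-th one, interacting indices have comparable weights, and the weights are dominated by powers
of the frequency, up to a summable factor. -/
structure IsLocalized {d : ℕ} {ι : Type} (D : FreqDecomp d ι) (N : ι → Finset ι) : Prop where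
  temperate : ∀ k, Function.HasTemperateGrowth fun ξ => (D.symbol k ξ : ℂ)
  abs_le_one : ∀ k ξ, |D.symbol k ξ| ≤ 1
  mem_comm : ∀ {k l}, l ∈ N k → k ∈ N l
  card_le : ∃ n : ℕ, ∀ k, (N k).card ≤ n
  weight_le : ∀ s, ∃ c, ∀ k, ∀ l ∈ N k, D.weight s l ≤ c * D.weight s k
  weight_neg : ∀ s k, D.weight (-s) k = (D.weight s k)⁻¹
  mul_eq_zero : ∀ k l ξ, l ∉ N k → D.symbol k ξ * D.symbol l ξ = 0
  decay : ∀ s, ∃ (r : ℝ) (a : ι → ℝ), Summable a ∧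
    ∀ k ξ, D.weight s k * |D.symbol k ξ| ≤ a k * (1 + ‖ξ‖ ^ 2) ^ r
  locally_finite : ∀ R : ℝ, ∃ F : Finset ι, ∀ ξ, ‖ξ‖ ≤ R →
    (∀ k ∉ F, D.symbol k ξ = 0) ∧ ∑ k ∈ F, D.symbol k ξ = 1

namespace IsLocalized

open FreqDecomp

variable {d : ℕ} {ι : Type} {D : FreqDecomp d ι} {N : ι → Finset ι} (h : IsLocalized D N)

include h

lemma sum_mul_symbol {k : ι} {S : Finset ι} (hS : N k ⊆ S) (ξ : Space d) :
    ∑ m ∈ S, D.symbol k ξ * D.symbol m ξ = D.symbol k ξ := by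
  classical
  obtain ⟨F, hF⟩ := h.locally_finite ‖ξ‖
  obtain ⟨h0, h1⟩ := hF ξ le_rfl
  have e1 : ∑ m ∈ S, D.symbol k ξ * D.symbol m ξ = ∑ m ∈ S ∪ F, D.symbol k ξ * D.symbol m ξ :=
    Finset.sum_subset Finset.subset_union_left fun m _ hm =>
      h.mul_eq_zero k m ξ fun hm' => hm (hS hm')
  have e2 : ∑ m ∈ F, D.symbol k ξ * D.symbol m ξ = ∑ m ∈ S ∪ F, D.symbol k ξ * D.symbol m ξ :=
    Finset.sum_subset Finset.subset_union_right fun m _ hm => by rw [h0 m hm, mul_zero]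
  rw [e1, ← e2, ← Finset.mul_sum, h1, mul_one]

lemma op_op (k l : ι) (f : 𝓢'(Space d, ℂ)) : D.op k (D.op l f) =
    TemperedDistribution.fourierMultiplierCLM ℂ
      (fun ξ => ((D.symbol k ξ * D.symbol l ξ : ℝ) : ℂ)) f := by
  rw [op, op, TemperedDistribution.fourierMultiplierCLM_fourierMultiplierCLM_apply
    (h.temperate l) (h.temperate k)]
  congr 2
  ext ξ
  simp [mul_comm]

lemma op_comm (k l : ι) (f : 𝓢'(Space d, ℂ)) : D.op k (D.op l f) = D.op l (D.op k f) := by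
  rw [h.op_op, h.op_op]
  simp only [mul_comm]

lemma op_op_eq_zero {k l : ι} (hl : l ∉ N k) (f : 𝓢'(Space d, ℂ)) : D.op l (D.op k f) = 0 := by
  rw [h.op_comm, h.op_op]
  simp only [h.mul_eq_zero k l _ hl, Complex.ofReal_zero]
  simp

lemma sum_op_op {k : ι} {S : Finset ι} (hS : N k ⊆ S) (f : 𝓢'(Space d, ℂ)) :
    ∑ m ∈ S, D.op m (D.op k f) = D.op k f := by
  have hg : ∀ m ∈ S, Function.HasTemperateGrowth fun ξ => ((D.symbol k ξ * D.symbol m ξ : ℝ) : ℂ) :=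
    fun m _ => by
      simp only [Complex.ofReal_mul]
      exact (h.temperate k).mul (h.temperate m)
  have := congrArg (fun A => A f) (TemperedDistribution.fourierMultiplierCLM_sum ℂ hg)
  simp only [sum_apply] at this
  simp only [h.op_comm _ k, h.op_op]
  rw [← this, op]
  congr 2
  ext ξ
  rw [← Complex.ofReal_sum, h.sum_mul_symbol hS]

/-- A tempered distribution is determined by its frequency blocks. -/
lemma eq_zero_of_op {f : 𝓢'(Space d, ℂ)} (hf : ∀ k, D.op k f = 0) : f = 0 := by
  have h1 : ∀ k, TemperedDistribution.smulLeftCLM ℂ (fun ξ => (D.symbol k ξ : ℂ))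
      (FourierTransform.fourier f) = 0 := fun k => by
    have := congrArg FourierTransform.fourier (hf k)
    rw [op, TemperedDistribution.fourierMultiplierCLM_apply,
      FourierTransform.fourier_fourierInv_eq] at this
    rw [this]
    exact map_zero (FourierTransform.fourierCLM ℂ 𝓢'(Space d, ℂ))
  have h2 : FourierTransform.fourier f = 0 := by
    refine temperedDistribution_eq_zero fun R ψ hψ => ?_
    obtain ⟨F, hF⟩ := h.locally_finite R
    have e : ψ = ∑ k ∈ F, SchwartzMap.smulLeftCLM ℂ (fun ξ => (D.symbol k ξ : ℂ)) ψ := by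
      ext ξ
      rw [sum_apply]
      simp only [SchwartzMap.smulLeftCLM_apply_apply (h.temperate _), ← Finset.sum_smul]
      rcases le_or_gt ‖ξ‖ R with hξ | hξ
      · rw [← Complex.ofReal_sum, (hF ξ hξ).2, Complex.ofReal_one, one_smul]
      · rw [hψ ξ hξ, smul_zero]
    rw [e, map_sum]
    refine Finset.sum_eq_zero fun k _ => ?_
    have := congrArg (fun T : 𝓢'(Space d, ℂ) => T ψ) (h1 k)
    simpa using this
  have := congrArg FourierTransform.fourierInv h2
  rw [FourierTransform.fourierInv_fourier_eq] at this
  rw [this]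
  exact map_zero (FourierTransform.fourierInvCLM ℂ 𝓢'(Space d, ℂ))

lemma exists_mul (k : ι) : ∃ M : L2 d →L[ℂ] L2 d, ‖M‖ ≤ 1 ∧
    (∀ f : L2 d, ((M f : L2 d) : 𝓢'(Space d, ℂ)) = D.op k (f : 𝓢'(Space d, ℂ))) ∧
      ∀ f g : L2 d, ⟪M f, g⟫_ℂ = ⟪f, M g⟫_ℂ := by
  obtain ⟨M, h1, h2, h3⟩ := exists_l2Multiplier (h.temperate k) zero_le_one fun ξ => by
    rw [Complex.norm_real]
    exact h.abs_le_one k ξ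
  exact ⟨M, h1, h2, h3 fun ξ => Complex.conj_ofReal _⟩

/-- `□_k` as an operator on `L²`. -/
def mul (k : ι) : L2 d →L[ℂ] L2 d := (h.exists_mul k).choose

lemma norm_mul_le (k : ι) : ‖h.mul k‖ ≤ 1 := (h.exists_mul k).choose_spec.1

lemma coe_mul (k : ι) (f : L2 d) :
    ((h.mul k f : L2 d) : 𝓢'(Space d, ℂ)) = D.op k (f : 𝓢'(Space d, ℂ)) :=
  (h.exists_mul k).choose_spec.2.1 f

lemma inner_mul (k : ι) (f g : L2 d) : ⟪h.mul k f, g⟫_ℂ = ⟪f, h.mul k g⟫_ℂ :=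
  (h.exists_mul k).choose_spec.2.2 f g

lemma mul_comm' (k l : ι) (f : L2 d) : h.mul k (h.mul l f) = h.mul l (h.mul k f) :=
  L2.toTemperedDistribution_injective <| by simp only [h.coe_mul, h.op_comm k l]

lemma mul_mul_eq_zero {k l : ι} (hl : l ∉ N k) (f : L2 d) : h.mul l (h.mul k f) = 0 :=
  L2.toTemperedDistribution_injective <| by rw [h.coe_mul, h.coe_mul, h.op_op_eq_zero hl, coe_zero]

lemma sum_mul_mul {k : ι} {S : Finset ι} (hS : N k ⊆ S) (f : L2 d) :
    ∑ m ∈ S, h.mul m (h.mul k f) = h.mul k f :=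
  L2.toTemperedDistribution_injective <| by
    rw [coe_sum]
    simp only [h.coe_mul]
    exact h.sum_op_op hS _

lemma sum_mul_mul' {k : ι} {S : Finset ι} (hS : N k ⊆ S) (f : L2 d) :
    h.mul k (∑ m ∈ S, h.mul m f) = h.mul k f := by
  rw [map_sum]
  simp only [h.mul_comm' k]
  exact h.sum_mul_mul hS f

lemma weight_le' (s : ℝ) : ∃ c, 0 ≤ c ∧ ∀ k, ∀ l ∈ N k, D.weight s l ≤ c * D.weight s k := by
  obtain ⟨c, hc⟩ := h.weight_le s
  exact ⟨max c 0, le_max_right _ _, fun k l hl => (hc k l hl).trans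
    (mul_le_mul_of_nonneg_right (le_max_left _ _) (D.weight_pos s k).le)⟩

omit h in
open Classical in
variable (N) in
/-- The indices at distance at most two in the interaction graph. The blocks `□_k f` and `□_l g` of
two distributions are orthogonal unless `l` is among these indices of `k`. -/
def near (k : ι) : Finset ι := (N k).biUnion N

lemma weight_near_le (s : ℝ) :
    ∃ c, 0 ≤ c ∧ ∀ k, ∀ l ∈ near N k, D.weight s l ≤ c * D.weight s k := by
  classical
  obtain ⟨c, hc0, hc⟩ := h.weight_le' s
  refine ⟨c * c, mul_nonneg hc0 hc0, fun k l hl => ?_⟩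
  obtain ⟨m, hm, hl⟩ := Finset.mem_biUnion.1 hl
  rw [mul_assoc]
  exact (hc m l hl).trans (mul_le_mul_of_nonneg_left (hc k m hm) hc0)

lemma card_near_le : ∃ n : ℕ, ∀ k, (near N k).card ≤ n := by
  classical
  obtain ⟨n, hn⟩ := h.card_le
  refine ⟨n * n, fun k => (Finset.card_biUnion_le).trans ?_⟩
  refine (Finset.sum_le_card_nsmul _ _ n fun m _ => hn m).trans ?_
  rw [smul_eq_mul]
  exact Nat.mul_le_mul_right n (hn k)

/-- Blocks of indices that are not near each other are orthogonal. -/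
lemma inner_l2Rep_eq_zero {k l : ι} (hl : l ∉ near N k) {f g : 𝓢'(Space d, ℂ)}
    (hf : IsL2 (D.op k f)) (hg : IsL2 (D.op l g)) :
    ⟪l2Rep (D.op l g), l2Rep (D.op k f)⟫_ℂ = 0 := by
  classical
  have e1 : ∑ m ∈ N k, h.mul m (l2Rep (D.op k f)) = l2Rep (D.op k f) :=
    L2.toTemperedDistribution_injective <| by
      rw [coe_sum]
      simp only [h.coe_mul, coe_l2Rep hf]
      exact h.sum_op_op subset_rfl f
  rw [← e1, inner_sum]
  refine Finset.sum_eq_zero fun m hm => ?_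
  have hml : m ∉ N l := fun hml => hl (Finset.mem_biUnion.2 ⟨m, hm, h.mem_comm hml⟩)
  have e2 : h.mul m (l2Rep (D.op l g)) = 0 := L2.toTemperedDistribution_injective <| by
    rw [h.coe_mul, coe_l2Rep hg, h.op_op_eq_zero hml, coe_zero]
  rw [← h.inner_mul, e2, inner_zero_left]

/-! ### Synthesis of a tempered distribution from its blocks -/

/-- The operators `□_j` factor through `L²` with summable bounds, up to the weights, followed by a
single map into the tempered distributions. -/
lemma exists_synthesis (s : ℝ) : ∃ (K : ι → L2 d →L[ℂ] L2 d) (a : ι → ℝ)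
    (Φ : L2 d →L[ℂ] 𝓢'(Space d, ℂ)), Summable a ∧ (∀ j, 0 ≤ a j) ∧
      (∀ j f, ‖K j f‖ ≤ a j * ((D.weight s j)⁻¹ * ‖f‖)) ∧
      ∀ j (f : L2 d), Φ (K j f) = D.op j (f : 𝓢'(Space d, ℂ)) := by
  obtain ⟨r, a, ha, hdec⟩ := h.decay s
  have hpow : ∀ q : ℝ, Function.HasTemperateGrowth
      fun ξ : Space d => (((1 + ‖ξ‖ ^ 2) ^ q : ℝ) : ℂ) := fun q => by fun_prop
  have hpos : ∀ ξ : Space d, 0 < 1 + ‖ξ‖ ^ 2 := fun ξ => by positivity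
  have ha0 : ∀ j, 0 ≤ a j := fun j => by
    have := (mul_nonneg (D.weight_pos s j).le (abs_nonneg _)).trans (hdec j 0)
    simpa using this
  have hbd : ∀ j ξ, ‖(D.symbol j ξ : ℂ) * (((1 + ‖ξ‖ ^ 2) ^ (-r) : ℝ) : ℂ)‖ ≤
      a j * (D.weight s j)⁻¹ := fun j ξ => by
    have hw := D.weight_pos s j
    have h1 := hdec j ξ
    rw [_root_.norm_mul, Complex.norm_real, Complex.norm_real, Real.norm_eq_abs,
      Real.norm_of_nonneg (Real.rpow_nonneg (hpos ξ).le _), Real.rpow_neg (hpos ξ).le,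
      ← div_eq_mul_inv, ← div_eq_mul_inv, div_le_div_iff₀ (Real.rpow_pos_of_pos (hpos ξ) _) hw,
      mul_comm]
    exact h1
  choose K hK1 hK2 _ using fun j => exists_l2Multiplier ((h.temperate j).mul (hpow (-r)))
    (mul_nonneg (ha0 j) (inv_nonneg.2 (D.weight_pos s j).le)) (hbd j)
  refine ⟨K, a, (TemperedDistribution.fourierMultiplierCLM ℂ
    fun ξ : Space d => (((1 + ‖ξ‖ ^ 2) ^ r : ℝ) : ℂ)) ∘L
      (Lp.toTemperedDistributionCLM ℂ volume 2), ha, ha0, fun j f => ?_, fun j f => ?_⟩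
  · rw [← mul_assoc]
    exact ((K j).le_opNorm f).trans (mul_le_mul_of_nonneg_right (hK1 j) (norm_nonneg f))
  · change TemperedDistribution.fourierMultiplierCLM ℂ _ ((K j f : L2 d) : 𝓢'(Space d, ℂ)) = _
    rw [hK2, TemperedDistribution.fourierMultiplierCLM_fourierMultiplierCLM_apply
      ((h.temperate j).mul (hpow (-r))) (hpow r), op]
    congr 2
    ext ξ
    simp only [Pi.mul_apply]
    rw [mul_assoc, ← Complex.ofReal_mul, ← Real.rpow_add (hpos ξ)]
    simp

/-- Compatibility conditions satisfied by the blocks `b k = □_k f` of a distribution. -/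
def Compatible (b : ι → L2 d) : Prop :=
  (∀ k m, h.mul m (b k) = h.mul k (b m)) ∧ ∀ k, ∑ m ∈ N k, h.mul m (b k) = b k

lemma compatible_l2Rep {f : 𝓢'(Space d, ℂ)} (hf : ∀ k, IsL2 (D.op k f)) :
    h.Compatible fun k => l2Rep (D.op k f) := by
  refine ⟨fun k m => L2.toTemperedDistribution_injective ?_,
    fun k => L2.toTemperedDistribution_injective ?_⟩
  · rw [h.coe_mul, h.coe_mul, coe_l2Rep (hf k), coe_l2Rep (hf m), h.op_comm]
  · rw [coe_sum]
    simp only [h.coe_mul, coe_l2Rep (hf k)]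
    exact h.sum_op_op subset_rfl f

lemma norm_sum_le (s : ℝ) : ∃ C, 0 ≤ C ∧ ∀ (b : ι → L2 d) (A : ℝ), 0 ≤ A →
    (∀ k, ‖b k‖ ≤ A * D.weight s k) → ∀ j, ‖∑ m ∈ N j, b m‖ ≤ C * A * D.weight s j := by
  obtain ⟨c, hc0, hc⟩ := h.weight_le' s
  obtain ⟨n, hn⟩ := h.card_le
  refine ⟨n * c, by positivity, fun b A hA hb j => ?_⟩
  have hw := (D.weight_pos s j).le
  have h1 : ∀ m ∈ N j, ‖b m‖ ≤ A * (c * D.weight s j) := fun m hm =>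
    (hb m).trans (mul_le_mul_of_nonneg_left (hc j m hm) hA)
  calc ‖∑ m ∈ N j, b m‖ ≤ (N j).card • (A * (c * D.weight s j)) :=
        (_root_.norm_sum_le _ _).trans (Finset.sum_le_card_nsmul _ _ _ h1)
    _ ≤ n * (A * (c * D.weight s j)) := by
        rw [nsmul_eq_mul]
        exact mul_le_mul_of_nonneg_right (by exact_mod_cast hn j) (by positivity)
    _ = n * c * A * D.weight s j := by ring

/-- Compatible families of polynomial growth are the blocks of a tempered distribution, which
depends continuously on the family, in the sense of dominated convergence. -/
lemma exists_synthesis_map (s : ℝ) : ∃ S : (ι → L2 d) → 𝓢'(Space d, ℂ),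
    (∀ (b : ι → L2 d) (A : ℝ), 0 ≤ A → (∀ k, ‖b k‖ ≤ A * D.weight s k) → h.Compatible b →
      ∀ k, D.op k (S b) = (b k : 𝓢'(Space d, ℂ))) ∧
    ∀ (b : ℝ → ι → L2 d) (b' : ι → L2 d) (A : ℝ), 0 ≤ A →
      (∀ τ k, ‖b τ k‖ ≤ A * D.weight s k) → ∀ l : Filter ℝ,
      (∀ k, Tendsto (fun τ => b τ k) l (𝓝 (b' k))) → Tendsto (fun τ => S (b τ)) l (𝓝 (S b')) := by
  obtain ⟨K, a, Φ, ha, ha0, hK, hΦ⟩ := h.exists_synthesis s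
  obtain ⟨C, hC0, hC⟩ := h.norm_sum_le s
  have hbd : ∀ (b : ι → L2 d) (A : ℝ), 0 ≤ A → (∀ k, ‖b k‖ ≤ A * D.weight s k) →
      ∀ j, ‖K j (∑ m ∈ N j, b m)‖ ≤ a j * (C * A) := fun b A hA hb j => by
    refine (hK j _).trans (mul_le_mul_of_nonneg_left ?_ (ha0 j))
    rw [inv_mul_le_iff₀ (D.weight_pos s j), mul_comm]
    exact hC b A hA hb j
  refine ⟨fun b => Φ (∑' j, K j (∑ m ∈ N j, b m)), fun b A hA hb hcomp k => ?_,
    fun b b' A hA hb l hlim => ?_⟩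
  · have hs : Summable fun j => K j (∑ m ∈ N j, b m) :=
      Summable.of_norm_bounded (ha.mul_right (C * A)) (hbd b A hA hb)
    have h1 := ((hs.hasSum.mapL Φ).mapL (D.op k))
    simp only [hΦ] at h1
    have h2 : HasSum (fun j => D.op k (D.op j ((∑ m ∈ N j, b m : L2 d) : 𝓢'(Space d, ℂ))))
        (∑ j ∈ N k, D.op k (D.op j ((∑ m ∈ N j, b m : L2 d) : 𝓢'(Space d, ℂ)))) :=
      hasSum_sum_of_ne_finset_zero fun j hj => by
        rw [h.op_comm, h.op_op_eq_zero hj]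
    rw [h1.unique h2]
    have h3 : ∀ j, D.op k (D.op j ((∑ m ∈ N j, b m : L2 d) : 𝓢'(Space d, ℂ))) =
        ((h.mul j (b k) : L2 d) : 𝓢'(Space d, ℂ)) := fun j => by
      rw [← h.coe_mul, ← h.coe_mul, h.mul_comm' k j, map_sum]
      simp only [hcomp.1 _ k]
      rw [h.sum_mul_mul' subset_rfl]
    simp only [h3]
    rw [← coe_sum, hcomp.2]
  · refine (Φ.continuous.tendsto _).comp ?_
    refine tendsto_tsum_of_dominated_convergence (ha.mul_right (C * A)) (fun j => ?_)
      (Eventually.of_forall fun τ => hbd (b τ) A hA (hb τ))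
    exact ((K j).continuous.tendsto _).comp (tendsto_finsetSum _ fun m _ => hlim m)

/-- If the blocks of `u` have limits at `-∞` and grow at most polynomially in the frequency, then
`u` has a limit in the space of tempered distributions. -/
lemma exists_tendsto_atBot {u : ℝ → 𝓢'(Space d, ℂ)} (hu : D.HasL2Blocks u)
    (hlim : ∀ k, ∃ l, Tendsto (D.block k u) atBot (𝓝 l)) {s A : ℝ} (hA : 0 ≤ A)
    (hb : ∀ τ k, ‖D.block k u τ‖ ≤ A * D.weight s k) : ∃ T, Tendsto u atBot (𝓝 T) := by
  obtain ⟨S, hS1, hS2⟩ := h.exists_synthesis_map s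
  choose l hl using hlim
  refine ⟨S l, (hS2 (fun τ k => D.block k u τ) l A hA hb atBot hl).congr fun τ => ?_⟩
  rw [← sub_eq_zero]
  refine h.eq_zero_of_op fun k => ?_
  rw [map_sub, hS1 _ A hA (hb τ) (h.compatible_l2Rep fun k => hu k τ), block, coe_l2Rep (hu k τ),
    sub_self]

/-- Taking blocks commutes with the extension of functions of time to `[-∞, ∞]`. -/
lemma op_extend {u : ℝ → 𝓢'(Space d, ℂ)} (hu : D.HasL2Blocks u)
    (hlim : ∀ k, ∃ l, Tendsto (D.block k u) atBot (𝓝 l)) {s A : ℝ} (hA : 0 ≤ A)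
    (hb : ∀ τ k, ‖D.block k u τ‖ ≤ A * D.weight s k) (k : ι) (x : EReal) :
    D.op k (extend u x) = ((extend (D.block k u) x : L2 d) : 𝓢'(Space d, ℂ)) := by
  induction x with
  | bot =>
    obtain ⟨T, hT⟩ := h.exists_tendsto_atBot hu hlim hA hb
    obtain ⟨l, hl⟩ := hlim k
    rw [extend_bot hT, extend_bot hl]
    refine tendsto_nhds_unique (((D.op k).continuous.tendsto T).comp hT) ?_
    refine ((continuous_coe.tendsto l).comp hl).congr fun τ => ?_
    exact coe_l2Rep (hu k τ)
  | coe τ =>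
    rw [extend_coe, extend_coe]
    exact (coe_l2Rep (hu k τ)).symm
  | top =>
    rw [extend_top, extend, if_pos rfl, map_zero, coe_zero]

end IsLocalized

lemma IsV2.sum {H κ : Type*} [NormedAddCommGroup H] [InnerProductSpace ℂ H] [CompleteSpace H]
    {u : ℝ → H} (hu : IsU2 u) (S : Finset κ) {f : κ → ℝ → H} (hf : ∀ k, IsV2 (f k)) :
    IsV2 (fun τ => ∑ k ∈ S, f k τ) ∧
      hilbertB u (fun τ => ∑ k ∈ S, f k τ) = ∑ k ∈ S, hilbertB u (f k) := by
  classical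
  induction S using Finset.induction_on with
  | empty =>
    have : hilbertB u (0 : ℝ → H) = 0 := by
      simpa using hilbertB_smul_right hu (isV2_zero (H := H)) 0
    simpa using ⟨isV2_zero, this⟩
  | insert k S hk ih =>
    simp only [Finset.sum_insert hk]
    refine ⟨(hf k).add ih.1, ?_⟩
    rw [← ih.2]
    exact hilbertB_add_right hu (hf k) ih.1

namespace FreqDecomp

variable {d : ℕ} {ι : Type} {D : FreqDecomp d ι}

lemma X.ext {s : ℝ} {u u' : D.X s} (h : u.fn = u'.fn) : u = u' := Subtype.ext h

lemma Y.ext {s : ℝ} {v v' : D.Y s} (h : v.fn = v'.fn) : v = v' := Subtype.ext h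

lemma X.memX {s : ℝ} (u : D.X s) : D.MemX s u.fn := u.2

lemma Y.memY {s : ℝ} (v : D.Y s) : D.MemY s v.fn := v.2

lemma X.summable {s : ℝ} (u : D.X s) :
    Summable fun k => D.weight s k * u2Norm (D.block k u.fn) := u.2.2.2

lemma X.block_add {s : ℝ} (u u' : D.X s) (k : ι) :
    D.block k (u + u').fn = D.block k u.fn + D.block k u'.fn :=
  (u.memX.1.block_add u'.memX.1 k).2

lemma X.block_smul {s : ℝ} (z : ℂ) (u : D.X s) (k : ι) :
    D.block k (z • u).fn = z • D.block k u.fn :=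
  (u.memX.1.block_smul z k).2

lemma Y.block_add {s : ℝ} (v v' : D.Y s) (k : ι) :
    D.block k (v + v').fn = D.block k v.fn + D.block k v'.fn :=
  (v.memY.1.block_add v'.memY.1 k).2

lemma Y.block_smul {s : ℝ} (z : ℂ) (v : D.Y s) (k : ι) :
    D.block k (z • v).fn = z • D.block k v.fn :=
  (v.memY.1.block_smul z k).2

lemma X.coe_block {s : ℝ} (u : D.X s) (k : ι) (τ : ℝ) :
    ((D.block k u.fn τ : L2 d) : 𝓢'(Space d, ℂ)) = D.op k (u.fn τ) := coe_l2Rep (u.memX.1 k τ)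

lemma Y.coe_block {s : ℝ} (v : D.Y s) (k : ι) (τ : ℝ) :
    ((D.block k v.fn τ : L2 d) : 𝓢'(Space d, ℂ)) = D.op k (v.fn τ) := coe_l2Rep (v.memY.1 k τ)

/-- The form `B_t` has the number `b` as its generalized limit exactly if it converges to `b` along
the filter of eventually fine partitions. -/
lemma isForm_iff {u v : ℝ → 𝓢'(Space d, ℂ)} {b : ℂ} :
    D.IsForm u v b ↔ Tendsto (fun t => D.formOn t u v) refFilter (𝓝 b) := by
  rw [refFilter_hasBasis.tendsto_iff Metric.nhds_basis_ball]
  simp only [IsForm, Metric.mem_ball, true_and, dist_eq_norm', Set.mem_ofPred_eq]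

end FreqDecomp

namespace IsLocalized

open FreqDecomp

variable {d : ℕ} {ι : Type} {D : FreqDecomp d ι} {N : ι → Finset ι} (h : IsLocalized D N)

include h

/-! ### The form `B` on `X × Y` -/

lemma u2Norm_block_le {s : ℝ} (u : D.X s) (k : ι) :
    u2Norm (D.block k u.fn) ≤ ‖u‖ * D.weight (-s) k := by
  rw [h.weight_neg, ← div_eq_mul_inv, le_div_iff₀ (D.weight_pos s k), mul_comm, X.norm_def]
  exact u.summable.le_tsum k fun j _ => D.u2Term_nonneg s _ j

lemma v2Norm_block_le {s : ℝ} (v : D.Y (-s)) (k : ι) :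
    v2Norm (D.block k v.fn) ≤ ‖v‖ * D.weight s k := by
  rw [← div_le_iff₀ (D.weight_pos s k), div_eq_mul_inv, ← h.weight_neg, mul_comm, Y.norm_def]
  exact le_ciSup v.memY.2.2 k

lemma op_extend_X {s : ℝ} (u : D.X s) (k : ι) (x : EReal) :
    D.op k (extend u.fn x) = ((extend (D.block k u.fn) x : L2 d) : 𝓢'(Space d, ℂ)) :=
  h.op_extend u.memX.1 (fun k => ⟨0, (u.memX.2.1 k).tendsto_atBot⟩) (norm_nonneg u)
    (fun τ k => (by simpa [extend_coe] using (u.memX.2.1 k).norm_extend_le τ : _ ≤ _).trans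
      (h.u2Norm_block_le u k)) k x

lemma op_extend_Y {s : ℝ} (v : D.Y (-s)) (k : ι) (x : EReal) :
    D.op k (extend v.fn x) = ((extend (D.block k v.fn) x : L2 d) : 𝓢'(Space d, ℂ)) :=
  h.op_extend v.memY.1 (fun k => (v.memY.2.1 k).1) (norm_nonneg v)
    (fun τ k => (by simpa [extend_coe] using (v.memY.2.1 k).norm_extend_le τ : _ ≤ _).trans
      (h.v2Norm_block_le v k)) k x

lemma pairTerm_extend {s : ℝ} (u : D.X s) (v : D.Y (-s)) (x y : EReal) (p : ι × ι) :
    D.pairTerm (extend u.fn x) (extend v.fn y) p =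
      ⟪extend (D.block p.2 v.fn) y, extend (D.block p.1 u.fn) x⟫_ℂ := by
  rw [pairTerm, h.op_extend_X, h.op_extend_Y, l2Rep_coe, l2Rep_coe]

lemma pairTerm_extend_sub {s : ℝ} (u : D.X s) (v : D.Y (-s)) (x y z : EReal) (p : ι × ι) :
    D.pairTerm (extend u.fn x) (extend v.fn y - extend v.fn z) p =
      ⟪extend (D.block p.2 v.fn) y - extend (D.block p.2 v.fn) z,
        extend (D.block p.1 u.fn) x⟫_ℂ := by
  have e : D.op p.2 (extend v.fn y - extend v.fn z) =
      ((extend (D.block p.2 v.fn) y - extend (D.block p.2 v.fn) z : L2 d) : 𝓢'(Space d, ℂ)) := by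
    rw [map_sub, h.op_extend_Y, h.op_extend_Y]
    exact (map_sub (Lp.toTemperedDistributionCLM ℂ volume 2) _ _).symm
  rw [pairTerm, h.op_extend_X, e, l2Rep_coe, l2Rep_coe]

lemma inner_extend_eq_zero {s : ℝ} (u : D.X s) (v : D.Y (-s)) {k l : ι} (hl : l ∉ near N k)
    (x y : EReal) : ⟪extend (D.block l v.fn) y, extend (D.block k u.fn) x⟫_ℂ = 0 := by
  have := h.inner_l2Rep_eq_zero hl (f := extend u.fn x) (g := extend v.fn y)
    ⟨_, (h.op_extend_X u k x).symm⟩ ⟨_, (h.op_extend_Y v l y).symm⟩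
  rwa [h.op_extend_X, h.op_extend_Y, l2Rep_coe, l2Rep_coe] at this

/-- A summable family on the indices, spread over the interacting pairs. -/
lemma summable_near : ∃ n : ℝ, 0 ≤ n ∧ ∀ a : ι → ℝ, (∀ k, 0 ≤ a k) → Summable a →
    ∃ G : ι × ι → ℝ, Summable G ∧ ∑' p, G p ≤ n * ∑' k, a k ∧
      (∀ k l, l ∈ near N k → G (k, l) = a k) ∧ ∀ p, 0 ≤ G p := by
  classical
  obtain ⟨n, hn⟩ := h.card_near_le
  refine ⟨n, by positivity, fun a ha0 ha => ?_⟩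
  let G : ι × ι → ℝ := fun p => if p.2 ∈ near N p.1 then a p.1 else 0
  have hG0 : ∀ p, 0 ≤ G p := fun p => by
    simp only [G]
    split_ifs
    exacts [ha0 _, le_rfl]
  have hk : ∀ k, HasSum (fun l => G (k, l)) ((near N k).card * a k) := fun k => by
    have : HasSum (fun l => G (k, l)) (∑ l ∈ near N k, G (k, l)) :=
      hasSum_sum_of_ne_finset_zero fun l hl => if_neg hl
    have e : ∑ l ∈ near N k, G (k, l) = (near N k).card * a k := by
      rw [← nsmul_eq_mul, ← Finset.sum_const]
      exact Finset.sum_congr rfl fun l hl => if_pos hl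
    rwa [e] at this
  have hle : ∀ k, (near N k).card * a k ≤ n * a k := fun k =>
    mul_le_mul_of_nonneg_right (by exact_mod_cast hn k) (ha0 k)
  have hs2 : Summable fun k => ((near N k).card : ℝ) * a k :=
    Summable.of_nonneg_of_le (fun k => mul_nonneg (Nat.cast_nonneg _) (ha0 k)) hle (ha.mul_left _)
  have hs : Summable G := (summable_prod_of_nonneg hG0).2
    ⟨fun k => (hk k).summable, by simpa only [(hk _).tsum_eq] using hs2⟩
  refine ⟨G, hs, ?_, fun k l hl => if_pos hl, hG0⟩
  rw [hs.tsum_prod' fun k => (hk k).summable, ← tsum_mul_left]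
  simp only [(hk _).tsum_eq]
  exact hs2.tsum_le_tsum hle (ha.mul_left _)

/-- The common majorant of all the double series over pairs of blocks. -/
lemma exists_majorant (s : ℝ) : ∃ C : ℝ, 0 ≤ C ∧ ∀ (u : D.X s) (v : D.Y (-s)),
    ∃ G : ι × ι → ℝ, Summable G ∧ ∑' p, G p ≤ C * ‖v‖ * ‖u‖ ∧ (∀ p, 0 ≤ G p) ∧
      ∀ k l, l ∈ near N k → u2Norm (D.block k u.fn) * v2Norm (D.block l v.fn) ≤ G (k, l) := by
  obtain ⟨n, hn, hsum⟩ := h.summable_near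
  obtain ⟨c, hc0, hc⟩ := h.weight_near_le s
  refine ⟨n * c, by positivity, fun u v => ?_⟩
  obtain ⟨G, hG, hle, hval, hG0⟩ := hsum
    (fun k => D.weight s k * u2Norm (D.block k u.fn) * (c * ‖v‖))
    (fun k => mul_nonneg (D.u2Term_nonneg s _ k) (by positivity)) (u.summable.mul_right _)
  refine ⟨G, hG, hle.trans_eq ?_, hG0, fun k l hl => ?_⟩
  · rw [tsum_mul_right, ← X.norm_def]
    ring
  · rw [hval k l hl]
    have h1 : v2Norm (D.block l v.fn) ≤ ‖v‖ * (c * D.weight s k) :=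
      (h.v2Norm_block_le v l).trans (mul_le_mul_of_nonneg_left (hc k l hl) (norm_nonneg v))
    calc _ ≤ u2Norm (D.block k u.fn) * (‖v‖ * (c * D.weight s k)) :=
          mul_le_mul_of_nonneg_left h1 (u2Norm_nonneg _)
      _ = _ := by ring

lemma summable_pairTerm {s : ℝ} (u : D.X s) (v : D.Y (-s)) (x y : EReal) :
    Summable (D.pairTerm (extend u.fn x) (extend v.fn y)) := by
  obtain ⟨C, -, hC⟩ := h.exists_majorant s
  obtain ⟨G, hG, -, hG0, hle⟩ := hC u v
  refine Summable.of_norm_bounded hG fun ⟨k, l⟩ => ?_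
  rw [h.pairTerm_extend]
  by_cases hl : l ∈ near N k
  · refine le_trans ?_ (hle k l hl)
    rw [mul_comm]
    exact (norm_inner_le_norm _ _).trans (mul_le_mul ((v.memY.2.1 l).norm_extend_le y)
      ((u.memX.2.1 k).norm_extend_le x) (norm_nonneg _) (v2Norm_nonneg _))
  · rw [h.inner_extend_eq_zero u v hl, norm_zero]
    exact hG0 _

/-- `B_t(u, v)` is the sum of the forms of the blocks. -/
lemma formOn_eq_tsum {s : ℝ} (u : D.X s) (v : D.Y (-s)) (t : TimePartition) :
    D.formOn t u.fn v.fn = ∑' p : ι × ι, hilbertForm t (D.block p.1 u.fn) (D.block p.2 v.fn) := by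
  simp only [formOn, pair, h.pairTerm_extend_sub, hilbertForm]
  refine (Summable.tsum_finsetSum fun k _ => ?_).symm
  have := (h.summable_pairTerm u v (t.pt k.castSucc) (t.pt k.succ)).sub
    (h.summable_pairTerm u v (t.pt k.castSucc) (t.pt k.castSucc))
  simpa only [h.pairTerm_extend, ← inner_sub_left] using this

omit h in
/-- The form `B(u, v)` as the sum over the forms of the blocks. -/
def form {s : ℝ} (u : D.X s) (v : D.Y (-s)) : ℂ :=
  ∑' p : ι × ι, hilbertB (D.block p.1 u.fn) (D.block p.2 v.fn)

lemma norm_hilbertB_block_le {s : ℝ} (u : D.X s) (v : D.Y (-s)) {G : ι × ι → ℝ}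
    (hG0 : ∀ p, 0 ≤ G p)
    (hle : ∀ k l, l ∈ near N k → u2Norm (D.block k u.fn) * v2Norm (D.block l v.fn) ≤ G (k, l))
    (p : ι × ι) : ‖hilbertB (D.block p.1 u.fn) (D.block p.2 v.fn)‖ ≤ G p := by
  by_cases hl : p.2 ∈ near N p.1
  · exact (norm_hilbertB_le (u.memX.2.1 _) (v.memY.2.1 _)).trans (hle _ _ hl)
  · rw [hilbertB_eq_zero fun x y => h.inner_extend_eq_zero u v hl x y, norm_zero]
    exact hG0 _

lemma summable_form {s : ℝ} (u : D.X s) (v : D.Y (-s)) :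
    Summable fun p : ι × ι => hilbertB (D.block p.1 u.fn) (D.block p.2 v.fn) := by
  obtain ⟨C, -, hC⟩ := h.exists_majorant s
  obtain ⟨G, hG, -, hG0, hle⟩ := hC u v
  exact Summable.of_norm_bounded hG (h.norm_hilbertB_block_le u v hG0 hle)

lemma norm_form_le (s : ℝ) : ∃ C : ℝ, 0 ≤ C ∧ ∀ (u : D.X s) (v : D.Y (-s)),
    ‖form u v‖ ≤ C * ‖v‖ * ‖u‖ := by
  obtain ⟨C, hC0, hC⟩ := h.exists_majorant s
  refine ⟨C, hC0, fun u v => ?_⟩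
  obtain ⟨G, hG, hs, hG0, hle⟩ := hC u v
  exact (tsum_of_norm_bounded hG.hasSum (h.norm_hilbertB_block_le u v hG0 hle)).trans hs

lemma tendsto_formOn {s : ℝ} (u : D.X s) (v : D.Y (-s)) :
    Tendsto (fun t => D.formOn t u.fn v.fn) refFilter (𝓝 (form u v)) := by
  obtain ⟨C, -, hC⟩ := h.exists_majorant s
  obtain ⟨G, hG, -, hG0, hle⟩ := hC u v
  simp only [h.formOn_eq_tsum]
  refine tendsto_tsum_of_dominated_convergence hG
    (fun p => tendsto_hilbertB (u.memX.2.1 _) (v.memY.2.1 _))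
    (Eventually.of_forall fun t p => ?_)
  by_cases hl : p.2 ∈ near N p.1
  · exact ((u.memX.2.1 _).norm_hilbertForm_le (v.memY.2.1 _) t).trans (hle _ _ hl)
  · rw [hilbertForm, Finset.sum_eq_zero fun k _ => by
      rw [inner_sub_left, h.inner_extend_eq_zero u v hl, h.inner_extend_eq_zero u v hl, sub_zero],
      norm_zero]
    exact hG0 _

lemma isForm_iff_eq {s : ℝ} (u : D.X s) (v : D.Y (-s)) (b : ℂ) :
    D.IsForm u.fn v.fn b ↔ b = form u v := by
  rw [isForm_iff]
  refine ⟨fun hb => tendsto_nhds_unique hb (h.tendsto_formOn u v), ?_⟩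
  rintro rfl
  exact h.tendsto_formOn u v

lemma exists_toDual (s : ℝ) : ∃ T : D.Y (-s) →ₗ⋆[ℂ] StrongDual ℂ (D.X s),
    (∀ u v, T v u = form u v) ∧ ∃ C : ℝ, 0 ≤ C ∧ ∀ v, ‖T v‖ ≤ C * ‖v‖ := by
  obtain ⟨C, hC0, hC⟩ := h.norm_form_le s
  let L : D.Y (-s) → D.X s →ₗ[ℂ] ℂ := fun v =>
    { toFun := fun u => form u v
      map_add' := fun u u' => by
        rw [form, form, form, ← (h.summable_form u v).tsum_add (h.summable_form u' v)]
        refine tsum_congr fun p => ?_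
        rw [X.block_add]
        exact hilbertB_add_left (u.memX.2.1 _) (u'.memX.2.1 _) (v.memY.2.1 _)
      map_smul' := fun z u => by
        rw [form, form, RingHom.id_apply, smul_eq_mul, ← tsum_mul_left]
        refine tsum_congr fun p => ?_
        rw [X.block_smul]
        exact hilbertB_smul_left (u.memX.2.1 _) (v.memY.2.1 _) z }
  refine ⟨{ toFun := fun v => (L v).mkContinuous (C * ‖v‖) fun u => hC u v
            map_add' := fun v v' => ?_
            map_smul' := fun z v => ?_ }, fun u v => rfl, C, hC0, fun v => ?_⟩
  · ext u
    change form u (v + v') = form u v + form u v'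
    rw [form, form, form, ← (h.summable_form u v).tsum_add (h.summable_form u v')]
    refine tsum_congr fun p => ?_
    rw [Y.block_add]
    exact hilbertB_add_right (u.memX.2.1 _) (v.memY.2.1 _) (v'.memY.2.1 _)
  · ext u
    change form u (z • v) = (starRingEnd ℂ) z * form u v
    rw [form, form, ← tsum_mul_left]
    refine tsum_congr fun p => ?_
    rw [Y.block_smul]
    exact hilbertB_smul_right (u.memX.2.1 _) (v.memY.2.1 _) z
  · exact (L v).mkContinuous_norm_le (mul_nonneg hC0 (norm_nonneg v)) fun u => hC u v

/-! ### Functions of time with a single frequency block -/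

lemma isL2_op_coe (k : ι) (f : L2 d) : IsL2 (D.op k (f : 𝓢'(Space d, ℂ))) :=
  ⟨h.mul k f, h.coe_mul k f⟩

lemma block_op (k m : ι) (w : ℝ → L2 d) :
    D.block m (fun τ => D.op k (w τ : 𝓢'(Space d, ℂ))) =
      fun τ => h.mul m (h.mul k (w τ)) := by
  ext1 τ
  rw [block, ← h.coe_mul, ← h.coe_mul, l2Rep_coe]

lemma memX_op (s : ℝ) (k : ι) {w : ℝ → L2 d} (hw : IsU2 w) :
    D.MemX s fun τ => D.op k (w τ : 𝓢'(Space d, ℂ)) := by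
  refine ⟨fun m τ => ?_, fun m => ?_, ?_⟩
  · change IsL2 (D.op m (D.op k (w τ : 𝓢'(Space d, ℂ))))
    rw [← h.coe_mul]
    exact h.isL2_op_coe m _
  · rw [h.block_op]
    exact (hw.comp_clm (h.mul k)).comp_clm (h.mul m)
  · refine summable_of_ne_finset_zero (s := N k) fun m hm => ?_
    rw [h.block_op]
    simp only [h.mul_mul_eq_zero hm]
    rw [show (fun _ : ℝ => (0 : L2 d)) = 0 from rfl, u2Norm_zero, mul_zero]

/-- `w ↦ □_k w`, as a map from `U²` to `X`. -/
def emb (s : ℝ) (k : ι) : u2Space (L2 d) →ₗ[ℂ] D.X s where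
  toFun w := ⟨fun τ => D.op k (w.1 τ : 𝓢'(Space d, ℂ)), h.memX_op s k w.2⟩
  map_add' w w' := X.ext <| funext fun τ =>
    ((D.op k) ∘L (Lp.toTemperedDistributionCLM ℂ volume 2)).map_add (w.1 τ) (w'.1 τ)
  map_smul' z w := X.ext <| funext fun τ =>
    ((D.op k) ∘L (Lp.toTemperedDistributionCLM ℂ volume 2)).map_smul z (w.1 τ)

lemma emb_fn (s : ℝ) (k : ι) (w : u2Space (L2 d)) (τ : ℝ) :
    (h.emb s k w).fn τ = D.op k (w.1 τ : 𝓢'(Space d, ℂ)) := rfl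

lemma block_emb (s : ℝ) (k m : ι) (w : u2Space (L2 d)) :
    D.block m (h.emb s k w).fn = fun τ => h.mul m (h.mul k (w.1 τ)) := h.block_op k m w.1

lemma norm_emb_le (s : ℝ) : ∃ C : ℝ, 0 ≤ C ∧ ∀ k (w : u2Space (L2 d)),
    ‖h.emb s k w‖ ≤ C * D.weight s k * u2Norm w.1 := by
  obtain ⟨n, hn⟩ := h.card_le
  obtain ⟨c, hc0, hc⟩ := h.weight_le' s
  refine ⟨n * c, by positivity, fun k w => ?_⟩
  have hw := u2Norm_nonneg w.1
  have hle : ∀ m ∈ N k, D.weight s m * u2Norm (D.block m (h.emb s k w).fn) ≤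
      c * D.weight s k * u2Norm w.1 := fun m hm => by
    refine mul_le_mul (hc k m hm) ?_ (u2Norm_nonneg _) (mul_nonneg hc0 (D.weight_pos s k).le)
    rw [h.block_emb]
    have hw' : IsU2 fun τ => h.mul k (w.1 τ) := IsU2.comp_clm (h.mul k) w.2
    refine (hw'.u2Norm_comp_clm_le (h.mul m)).trans ?_
    refine (mul_le_of_le_one_left (u2Norm_nonneg _) (h.norm_mul_le m)).trans ?_
    exact (IsU2.u2Norm_comp_clm_le (h.mul k) w.2).trans
      (mul_le_of_le_one_left hw (h.norm_mul_le k))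
  rw [X.norm_def, tsum_eq_sum (s := N k) fun m hm => by
    rw [h.block_emb]
    simp only [h.mul_mul_eq_zero hm]
    rw [show (fun _ : ℝ => (0 : L2 d)) = 0 from rfl, u2Norm_zero, mul_zero]]
  refine (Finset.sum_le_card_nsmul _ _ _ hle).trans ?_
  rw [nsmul_eq_mul, mul_assoc, mul_assoc, mul_assoc]
  exact mul_le_mul_of_nonneg_right (by exact_mod_cast hn k)
    (mul_nonneg hc0 (mul_nonneg (D.weight_pos s k).le hw))

lemma mul_block_eq_zero {s : ℝ} (u : D.X s) {k m : ι} (hm : m ∉ N k) (τ : ℝ) :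
    h.mul m (D.block k u.fn τ) = 0 :=
  L2.toTemperedDistribution_injective <| by
    rw [h.coe_mul, u.coe_block, h.op_op_eq_zero hm, coe_zero]

lemma u2Norm_sub_sum_le {s : ℝ} (u : D.X s) (j : ι) (F : Finset ι) :
    u2Norm (fun τ => D.block j u.fn τ - ∑ k ∈ F, h.mul k (D.block j u.fn τ)) ≤
      (1 + (N j).card) * u2Norm (D.block j u.fn) := by
  classical
  let A : L2 d →L[ℂ] L2 d := ContinuousLinearMap.id ℂ (L2 d) - ∑ k ∈ F ∩ N j, h.mul k
  have hA : ‖A‖ ≤ 1 + (N j).card := by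
    refine (norm_sub_le _ _).trans (add_le_add ContinuousLinearMap.norm_id_le ?_)
    refine (_root_.norm_sum_le _ _).trans ?_
    refine (Finset.sum_le_card_nsmul _ _ 1 fun k _ => h.norm_mul_le k).trans ?_
    rw [nsmul_eq_mul, mul_one]
    exact_mod_cast Finset.card_le_card Finset.inter_subset_right
  have he : (fun τ => D.block j u.fn τ - ∑ k ∈ F, h.mul k (D.block j u.fn τ)) =
      fun τ => A (D.block j u.fn τ) := by
    ext1 τ
    rw [← Finset.sum_subset (Finset.inter_subset_left (s₁ := F) (s₂ := N j)) fun k hk hk' =>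
      h.mul_block_eq_zero u (fun hkj => hk' (Finset.mem_inter.2 ⟨hk, hkj⟩)) τ]
    simp [A, sum_apply]
  rw [he]
  exact ((u.memX.2.1 j).u2Norm_comp_clm_le A).trans
    (mul_le_mul_of_nonneg_right hA (u2Norm_nonneg _))

/-- The partial sums of the frequency blocks of `u` converge to `u` in `X`. -/
lemma tendsto_sum_blocks {s : ℝ} (u : D.X s) :
    Tendsto (fun F : Finset ι => ∑ k ∈ F, ∑ m ∈ N k,
      h.emb s m ⟨D.block k u.fn, u.memX.2.1 k⟩) atTop (𝓝 u) := by
  classical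
  obtain ⟨n, hn⟩ := h.card_le
  set R : Finset ι → D.X s := fun F =>
    ∑ k ∈ F, ∑ m ∈ N k, h.emb s m ⟨D.block k u.fn, u.memX.2.1 k⟩ with hR
  have hsumfn : ∀ {κ : Type} (S : Finset κ) (f : κ → D.X s) (τ : ℝ),
      (∑ k ∈ S, f k).fn τ = ∑ k ∈ S, (f k).fn τ := fun S f τ => by
    induction S using Finset.induction_on with
    | empty => rfl
    | insert k S hk ih =>
      rw [Finset.sum_insert hk, Finset.sum_insert hk, ← ih]
      rfl
  have hfn : ∀ F τ, (R F).fn τ = ∑ k ∈ F, D.op k (u.fn τ) := fun F τ => by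
    rw [hR, hsumfn]
    refine Finset.sum_congr rfl fun k _ => ?_
    rw [hsumfn]
    simp only [h.emb_fn, u.coe_block]
    exact h.sum_op_op subset_rfl _
  have hblock : ∀ F j, D.block j (u - R F).fn =
      fun τ => D.block j u.fn τ - ∑ k ∈ F, h.mul k (D.block j u.fn τ) := fun F j => by
    ext1 τ
    refine L2.toTemperedDistribution_injective ?_
    rw [X.coe_block]
    have e1 : (u - R F).fn τ = u.fn τ - (R F).fn τ := rfl
    have e2 := map_sub (Lp.toTemperedDistributionCLM ℂ volume 2) (D.block j u.fn τ)
      (∑ k ∈ F, h.mul k (D.block j u.fn τ))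
    simp only [Lp.toTemperedDistributionCLM_apply] at e2
    rw [e1, map_sub, hfn, e2, X.coe_block, coe_sum, map_sum]
    simp only [h.coe_mul, X.coe_block, h.op_comm j]
  rw [tendsto_iff_norm_sub_tendsto_zero]
  simp only [norm_sub_rev (R _) u, X.norm_def]
  have h0 : Tendsto (fun F => ∑' j, D.weight s j * u2Norm (D.block j (u - R F).fn)) atTop
      (𝓝 (∑' _ : ι, (0 : ℝ))) := by
    refine tendsto_tsum_of_dominated_convergence (u.summable.mul_left (1 + n : ℝ)) (fun j => ?_)
      (Eventually.of_forall fun F j => ?_)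
    · refine tendsto_const_nhds.congr' ?_
      filter_upwards [eventually_ge_atTop (N j)] with F hF
      have : D.block j (u - R F).fn = 0 := by
        rw [hblock]
        ext1 τ
        have := (h.compatible_l2Rep fun k => u.memX.1 k τ).2 j
        rw [← Finset.sum_subset hF fun k _ hk => h.mul_block_eq_zero u hk τ]
        exact sub_eq_zero.2 this.symm
      rw [this, u2Norm_zero, mul_zero]
    · rw [Real.norm_of_nonneg (D.u2Term_nonneg s _ j), hblock, mul_left_comm]
      refine mul_le_mul_of_nonneg_left ((h.u2Norm_sub_sum_le u j F).trans ?_)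
        (D.weight_pos s j).le
      refine mul_le_mul_of_nonneg_right ?_ (u2Norm_nonneg _)
      have : ((N j).card : ℝ) ≤ n := by exact_mod_cast hn j
      linarith
  rwa [tsum_zero] at h0

/-- Bounded functionals on `X` are determined by their values on single frequency blocks. -/
lemma dual_ext {s : ℝ} {L L' : StrongDual ℂ (D.X s)}
    (hL : ∀ k w, L (h.emb s k w) = L' (h.emb s k w)) : L = L' := by
  ext u
  have h1 := (L.continuous.tendsto u).comp (h.tendsto_sum_blocks u)
  have h2 := (L'.continuous.tendsto u).comp (h.tendsto_sum_blocks u)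
  refine tendsto_nhds_unique h1 (h2.congr fun F => ?_)
  simp only [Function.comp_apply, map_sum, hL]

/-- On a single frequency block the form `B` is the form of the corresponding block of `v`. -/
lemma form_emb {s : ℝ} (j : ι) (w : u2Space (L2 d)) (v : D.Y (-s)) :
    form (h.emb s j w) v = hilbertB w.1 (D.block j v.fn) := by
  classical
  let c : ι → ℝ → L2 d := fun l => D.block l v.fn
  have hw : IsU2 w.1 := w.2
  have hc : ∀ l, IsV2 (c l) := fun l => v.memY.2.1 l
  have hcomm : ∀ k m τ, h.mul m (c k τ) = h.mul k (c m τ) := fun k m τ =>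
    (h.compatible_l2Rep fun k => v.memY.1 k τ).1 k m
  have hsum : ∀ k τ, ∑ m ∈ N k, h.mul m (c k τ) = c k τ := fun k τ =>
    (h.compatible_l2Rep fun k => v.memY.1 k τ).2 k
  have hzero : ∀ k m τ, m ∉ N k → h.mul m (c k τ) = 0 := fun k m τ hm =>
    L2.toTemperedDistribution_injective <| by
      rw [h.coe_mul, v.coe_block, h.op_op_eq_zero hm, coe_zero]
  have hterm : ∀ k l, hilbertB (D.block k (h.emb s j w).fn) (c l) =
      hilbertB w.1 fun τ => h.mul j (h.mul k (c l τ)) := fun k l => by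
    rw [h.block_emb, hilbertB_comp_clm (h.mul k) (h.inner_mul k) (hw.comp_clm (h.mul j)) (hc l),
      hilbertB_comp_clm (h.mul j) (h.inner_mul j) hw ((hc l).comp_clm (h.mul k))]
  have hB0 : hilbertB w.1 (fun _ => (0 : L2 d)) = 0 := by
    have := hilbertB_smul_right hw (isV2_zero (H := L2 d)) 0
    rwa [zero_smul, map_zero, zero_mul] at this
  -- the pairs with a non-vanishing contribution lie in a finite rectangle
  let U : Finset ι := (N j).biUnion N
  have hsupp : ∀ p ∉ N j ×ˢ U, hilbertB (D.block p.1 (h.emb s j w).fn) (c p.2) = 0 := by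
    rintro ⟨k, l⟩ hp
    rw [hterm]
    by_cases hk : k ∈ N j
    · have hl : l ∉ N k := fun hl =>
        hp (Finset.mem_product.2 ⟨hk, Finset.mem_biUnion.2 ⟨k, hk, hl⟩⟩)
      have hkl : k ∉ N l := fun hkl => hl (h.mem_comm hkl)
      simp only [hzero l k _ hkl, map_zero, hB0]
    · simp only [h.mul_comm' j k, h.mul_mul_eq_zero hk, hB0]
  rw [form, tsum_eq_sum hsupp, Finset.sum_product]
  have hrow : ∀ k ∈ N j, ∑ l ∈ U, hilbertB (D.block k (h.emb s j w).fn) (c l) =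
      hilbertB w.1 fun τ => h.mul k (c j τ) := fun k hk => by
    simp only [hterm]
    rw [← (IsV2.sum hw U fun l => ((hc l).comp_clm (h.mul k)).comp_clm (h.mul j)).2]
    congr 1
    ext1 τ
    have hNk : N k ⊆ U := fun l hl => Finset.mem_biUnion.2 ⟨k, hk, hl⟩
    rw [← map_sum]
    simp only [hcomm _ k]
    rw [← Finset.sum_subset hNk fun l _ hl => hzero k l τ hl, hsum, hcomm]
  refine (Finset.sum_congr rfl hrow).trans ?_
  rw [← (IsV2.sum hw (N j) fun k => (hc j).comp_clm (h.mul k)).2]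
  simp only [hsum]
  rfl

lemma eq_zero_of_form {s : ℝ} {v : D.Y (-s)} (hv : ∀ u : D.X s, form u v = 0) : v = 0 := by
  have hblock : ∀ j, D.block j v.fn = 0 := fun j => eq_zero_of_hilbertB fun x g => by
    rw [← hv (h.emb s j ⟨step x g, isU2_step (.inl (EReal.coe_ne_bot x))⟩), h.form_emb]
  refine Y.ext (funext fun τ => h.eq_zero_of_op fun k => ?_)
  rw [← v.coe_block, hblock]
  exact coe_zero

omit h in
/-- The step function that jumps from `0` to `g` at the time `τ`, as an element of `U²`. -/
def stepU2 {d : ℕ} (τ : ℝ) (g : L2 d) : u2Space (L2 d) :=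
  ⟨step τ g, isU2_step (.inl (EReal.coe_ne_bot τ))⟩

lemma emb_stepU2_comm (s : ℝ) (k m : ι) (τ : ℝ) (g : L2 d) :
    h.emb s k (stepU2 τ (h.mul m g)) = h.emb s m (stepU2 τ (h.mul k g)) := by
  refine X.ext (funext fun σ => ?_)
  rw [h.emb_fn, h.emb_fn, stepU2, stepU2]
  by_cases hσ : (τ : EReal) ≤ σ
  · simp only [step, hσ, if_true, h.coe_mul]
    exact h.op_comm k m _
  · simp only [step, hσ, if_false, coe_zero, map_zero]

lemma emb_stepU2_sum (s : ℝ) (k : ι) (τ : ℝ) (g : L2 d) :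
    h.emb s k (stepU2 τ (∑ m ∈ N k, h.mul m g)) = h.emb s k (stepU2 τ g) := by
  refine X.ext (funext fun σ => ?_)
  rw [h.emb_fn, h.emb_fn, stepU2, stepU2]
  by_cases hσ : (τ : EReal) ≤ σ
  · simp only [step, hσ, if_true]
    rw [← h.coe_mul, h.sum_mul_mul' subset_rfl, h.coe_mul]
  · simp only [step, hσ, if_false]

/-- The functions that represent a functional on the single frequency blocks are compatible. -/
lemma compatible_of_functional {s : ℝ} (L : StrongDual ℂ (D.X s)) {b : ι → ℝ → L2 d}
    (hb : ∀ k (w : u2Space (L2 d)), L (h.emb s k w) = hilbertB w.1 (b k)) (τ : ℝ) :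
    h.Compatible fun k => b k τ := by
  have hinner : ∀ k g, ⟪b k τ, g⟫_ℂ = -L (h.emb s k (stepU2 τ g)) := fun k g => by
    have := (hb k (stepU2 τ g)).trans (hilbertB_step τ g (b k))
    rw [this, neg_neg]
  refine ⟨fun k m => ext_inner_right ℂ fun g => ?_, fun k => ext_inner_right ℂ fun g => ?_⟩
  · rw [h.inner_mul, h.inner_mul, hinner, hinner, h.emb_stepU2_comm]
  · rw [sum_inner, Finset.sum_congr rfl fun m _ => h.inner_mul m (b k τ) g, ← inner_sum, hinner,
      hinner, h.emb_stepU2_sum]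

/-- Every bounded functional on `X` is given by an element of `Y`, whose blocks represent the
functional on the single frequency blocks. -/
lemma exists_Y_of_functional (s : ℝ) : ∃ C : ℝ, 0 ≤ C ∧ ∀ L : StrongDual ℂ (D.X s),
    ∃ v : D.Y (-s), ‖v‖ ≤ C * ‖L‖ ∧ ∀ u, L u = form u v := by
  obtain ⟨C, hC0, hC⟩ := h.norm_emb_le s
  refine ⟨C, hC0, fun L => ?_⟩
  obtain ⟨S, hS, -⟩ := h.exists_synthesis_map s
  have hL : ∀ k, ∃ v : ℝ → L2 d, IsV2 v ∧ v2Norm v ≤ C * ‖L‖ * D.weight s k ∧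
      ∀ w : u2Space (L2 d), L (h.emb s k w) = hilbertB w.1 v := fun k => by
    refine exists_isV2_of_functional ((L : D.X s →ₗ[ℂ] ℂ) ∘ₗ h.emb s k)
      (mul_nonneg (mul_nonneg hC0 (norm_nonneg L)) (D.weight_pos s k).le) fun w => ?_
    refine (L.le_opNorm _).trans ((mul_le_mul_of_nonneg_left (hC k w) (norm_nonneg L)).trans_eq ?_)
    ring
  choose b hb1 hb2 hb3 using hL
  have hA : 0 ≤ C * ‖L‖ := mul_nonneg hC0 (norm_nonneg L)
  have hnorm : ∀ τ k, ‖b k τ‖ ≤ C * ‖L‖ * D.weight s k := fun τ k => by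
    rw [← extend_coe (b k) τ]
    exact ((hb1 k).norm_extend_le τ).trans (hb2 k)
  have hcomp : ∀ τ, h.Compatible fun k => b k τ := fun τ =>
    h.compatible_of_functional L hb3 τ
  have hop : ∀ τ k, D.op k (S fun k => b k τ) = (b k τ : 𝓢'(Space d, ℂ)) := fun τ =>
    hS _ _ hA (hnorm τ) (hcomp τ)
  have hblock : ∀ k, D.block k (fun τ => S fun k => b k τ) = b k := fun k => funext fun τ => by
    rw [block, hop, l2Rep_coe]
  have hw : ∀ k, D.weight (-s) k * v2Norm (b k) ≤ C * ‖L‖ := fun k => by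
    rw [h.weight_neg, inv_mul_le_iff₀ (D.weight_pos s k), mul_comm]
    exact hb2 k
  have hmem : D.MemY (-s) fun τ => S fun k => b k τ := by
    refine ⟨fun k τ => ⟨_, (hop τ k).symm⟩, fun k => ?_, C * ‖L‖, ?_⟩
    · rw [hblock]
      exact hb1 k
    · rintro _ ⟨k, rfl⟩
      dsimp only
      rw [hblock]
      exact hw k
  let v : D.Y (-s) := ⟨_, hmem⟩
  have hvb : ∀ k, D.block k v.fn = b k := hblock
  refine ⟨v, ?_, fun u => ?_⟩
  · rw [Y.norm_def]
    refine Real.iSup_le (fun k => ?_) hA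
    rw [hvb]
    exact hw k
  · obtain ⟨T, hT, -⟩ := h.exists_toDual s
    rw [← hT]
    refine congrArg (fun L : StrongDual ℂ (D.X s) => L u) (h.dual_ext fun k w => ?_)
    rw [hT, h.form_emb, hvb, hb3]

/-- The duality of `X` and `Y` for a localized frequency decomposition. -/
theorem duality (s : ℝ) : ∃ T : D.Y (-s) ≃ₗ⋆[ℂ] StrongDual ℂ (D.X s),
    (∀ (u : D.X s) (v : D.Y (-s)),
      (∀ τ σ : EReal, Summable (D.pairTerm (extend u.fn τ) (extend v.fn σ))) ∧
      (∀ b : ℂ, D.IsForm u.fn v.fn b ↔ b = T v u)) ∧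
    ∃ c : ℝ, 0 < c ∧ (∀ v : D.Y (-s), ‖T v‖ ≤ c * ‖v‖ ∧ ‖v‖ ≤ c * ‖T v‖) ∧
      ∀ (u : D.X s) (v : D.Y (-s)), ‖T v u‖ ≤ c * (‖u‖ * ‖v‖) := by
  obtain ⟨T, hT, C, hC0, hC⟩ := h.exists_toDual s
  obtain ⟨C', hC0', hC'⟩ := h.exists_Y_of_functional s
  have hinj : Function.Injective T := (injective_iff_map_eq_zero T).2 fun v hv =>
    h.eq_zero_of_form fun u => by rw [← hT, hv, zero_apply]
  have hsurj : Function.Surjective T := fun L => by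
    obtain ⟨v, -, hv⟩ := hC' L
    exact ⟨v, by ext u; rw [hT, hv]⟩
  have hbij : Function.Bijective T := ⟨hinj, hsurj⟩
  refine ⟨LinearEquiv.ofBijective T hbij, fun u v => ⟨h.summable_pairTerm u v, fun b => ?_⟩,
    C + C' + 1, by positivity, fun v => ⟨?_, ?_⟩, fun u v => ?_⟩
  · change D.IsForm u.fn v.fn b ↔ b = T v u
    rw [hT]
    exact h.isForm_iff_eq u v b
  · exact (hC v).trans (mul_le_mul_of_nonneg_right (by linarith) (norm_nonneg v))
  · obtain ⟨v', hv', hu⟩ := hC' (T v)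
    have : v = v' := hinj (by ext u; rw [hu, hT])
    rw [← this] at hv'
    change ‖v‖ ≤ _ * ‖T v‖
    exact hv'.trans (mul_le_mul_of_nonneg_right (by linarith) (norm_nonneg _))
  · change ‖T v u‖ ≤ _
    refine ((T v).le_opNorm u).trans ((mul_le_mul_of_nonneg_right (hC v) (norm_nonneg u)).trans ?_)
    have : 0 ≤ ‖u‖ * ‖v‖ := by positivity
    nlinarith

end IsLocalized

/-! ### Localization of the dyadic and of the `α`-decomposition -/

lemma hasTemperateGrowth_ofReal {d : ℕ} {f : Space d → ℝ} (hf : ContDiff ℝ ∞ f) {R : ℝ}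
    (hR : ∀ ξ, R < ‖ξ‖ → f ξ = 0) : Function.HasTemperateGrowth fun ξ => (f ξ : ℂ) := by
  have hc : HasCompactSupport fun ξ => (f ξ : ℂ) :=
    HasCompactSupport.intro (isCompact_closedBall (0 : Space d) R) fun ξ hξ => by
      rw [mem_closedBall_zero_iff, not_le] at hξ
      rw [hR ξ hξ, Complex.ofReal_zero]
  exact hc.hasTemperateGrowth (Complex.ofRealCLM.contDiff.comp hf)

/-- If `x ≥ 1` is dominated by `c ⟨ξ⟩`, then any power of `x` is dominated by a power of `⟨ξ⟩`, even
after a power of `x` has been split off. -/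
lemma rpow_le_decay {x c y : ℝ} (hx : 1 ≤ x) (hc : 0 ≤ c)
    (hxy : x ≤ c * √(1 + y ^ 2)) (q : ℝ) {p : ℝ} (hp : 0 ≤ p) :
    x ^ q ≤ x ^ (-p) * c ^ (|q| + p) * (1 + y ^ 2) ^ ((|q| + p) / 2) := by
  have hx0 : 0 < x := one_pos.trans_le hx
  have hy0 : 0 ≤ 1 + y ^ 2 := by positivity
  have e : √(1 + y ^ 2) ^ (|q| + p) = (1 + y ^ 2) ^ ((|q| + p) / 2) := by
    rw [Real.sqrt_eq_rpow, ← Real.rpow_mul hy0]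
    congr 1
    ring
  calc x ^ q ≤ x ^ (-p + (|q| + p)) :=
        Real.rpow_le_rpow_of_exponent_le hx (by linarith [le_abs_self q])
    _ = x ^ (-p) * x ^ (|q| + p) := Real.rpow_add hx0 _ _
    _ ≤ x ^ (-p) * (c * √(1 + y ^ 2)) ^ (|q| + p) := by gcongr
    _ = _ := by rw [Real.mul_rpow hc (Real.sqrt_nonneg _), e, mul_assoc]

/-- Positive numbers that are comparable have comparable powers. -/
lemma rpow_le_of_comparable {x y c : ℝ} (hx : 0 < x) (hy : 0 < y) (hc : 1 ≤ c) (hxy : x ≤ c * y)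
    (hyx : y ≤ c * x) (q : ℝ) : x ^ q ≤ c ^ |q| * y ^ q := by
  have hc0 : 0 < c := one_pos.trans_le hc
  rcases le_total 0 q with hq | hq
  · rw [abs_of_nonneg hq, ← Real.mul_rpow hc0.le hy.le]
    exact Real.rpow_le_rpow hx.le hxy hq
  · rw [abs_of_nonpos hq, Real.rpow_neg hc0.le, ← Real.inv_rpow hc0.le,
      ← Real.mul_rpow (inv_nonneg.2 hc0.le) hy.le]
    refine Real.rpow_le_rpow_of_nonpos (by positivity) ?_ hq
    rwa [inv_mul_le_iff₀ hc0]

section Dyadic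

variable {d : ℕ} {φ : Space d → ℝ}

lemma dyadicSymbol_zero (ξ : Space d) : dyadicSymbol φ 0 ξ = φ ξ := if_pos rfl

lemma dyadicSymbol_succ (j : ℕ) (ξ : Space d) : dyadicSymbol φ (j + 1) ξ =
    φ ((2 : ℝ) ^ (-((j + 1 : ℕ) : ℝ)) • ξ) - φ ((2 : ℝ) ^ (-(j : ℝ)) • ξ) := by
  rw [dyadicSymbol, if_neg j.succ_ne_zero]
  congr 4
  push_cast
  ring

/-- The dyadic symbols telescope. -/
lemma sum_dyadicSymbol (J : ℕ) (ξ : Space d) :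
    ∑ j ∈ Finset.range (J + 1), dyadicSymbol φ j ξ = φ ((2 : ℝ) ^ (-(J : ℝ)) • ξ) := by
  induction J with
  | zero => simp [dyadicSymbol_zero]
  | succ J ih => rw [Finset.sum_range_succ, ih, dyadicSymbol_succ, add_sub_cancel]

lemma norm_two_rpow_neg_smul (j : ℕ) (ξ : Space d) :
    ‖(2 : ℝ) ^ (-(j : ℝ)) • ξ‖ = ‖ξ‖ / 2 ^ j := by
  rw [norm_smul, Real.norm_of_nonneg (by positivity), Real.rpow_neg two_pos.le, Real.rpow_natCast,
    div_eq_inv_mul]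

namespace IsRadialBump

variable (hφ : IsRadialBump φ)

include hφ

lemma dilate_eq_one {j : ℕ} {ξ : Space d} (hξ : ‖ξ‖ < 2 ^ j) :
    φ ((2 : ℝ) ^ (-(j : ℝ)) • ξ) = 1 :=
  hφ.eq_one _ <| by rwa [norm_two_rpow_neg_smul, div_lt_one (by positivity)]

lemma dilate_eq_zero {j : ℕ} {ξ : Space d} (hξ : 2 ^ (j + 1) ≤ ‖ξ‖) :
    φ ((2 : ℝ) ^ (-(j : ℝ)) • ξ) = 0 :=
  hφ.eq_zero _ <| by rwa [norm_two_rpow_neg_smul, le_div_iff₀ (by positivity), ← pow_succ']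

lemma dyadicSymbol_eq_zero_of_le {j : ℕ} {ξ : Space d} (hξ : 2 ^ (j + 1) ≤ ‖ξ‖) :
    dyadicSymbol φ j ξ = 0 := by
  rcases j with _ | j
  · rw [dyadicSymbol_zero]
    exact hφ.eq_zero _ (by simpa using hξ)
  · rw [dyadicSymbol_succ, hφ.dilate_eq_zero hξ, hφ.dilate_eq_zero, sub_zero]
    exact (pow_le_pow_right₀ one_le_two (by omega)).trans hξ

lemma dyadicSymbol_eq_zero_of_lt {j : ℕ} {ξ : Space d} (hξ : ‖ξ‖ < 2 ^ j) :
    dyadicSymbol φ (j + 1) ξ = 0 := by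
  rw [dyadicSymbol_succ, hφ.dilate_eq_one hξ, hφ.dilate_eq_one, sub_self]
  exact hξ.trans_le (pow_le_pow_right₀ one_le_two (by omega))

lemma abs_dyadicSymbol_le (j : ℕ) (ξ : Space d) : |dyadicSymbol φ j ξ| ≤ 1 := by
  rcases j with _ | j
  · rw [dyadicSymbol_zero, abs_of_nonneg (hφ.nonneg ξ)]
    exact hφ.le_one ξ
  · rw [dyadicSymbol_succ]
    exact abs_sub_le_of_nonneg_of_le (hφ.nonneg _) (hφ.le_one _) (hφ.nonneg _) (hφ.le_one _)

lemma contDiff_dyadicSymbol (j : ℕ) : ContDiff ℝ ∞ (dyadicSymbol φ j) := by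
  have hs := hφ.smooth
  rcases j with _ | j
  · rwa [funext (dyadicSymbol_zero (φ := φ))]
  · rw [funext (dyadicSymbol_succ (φ := φ) j)]
    exact (hs.comp (contDiff_const_smul _)).sub (hs.comp (contDiff_const_smul _))

lemma two_pow_le_of_dyadicSymbol_ne_zero {j : ℕ} {ξ : Space d} (hξ : dyadicSymbol φ j ξ ≠ 0) :
    (2 : ℝ) ^ j ≤ 2 * √(1 + ‖ξ‖ ^ 2) := by
  rcases j with _ | j
  · have : 1 ≤ √(1 + ‖ξ‖ ^ 2) := Real.one_le_sqrt.2 (by nlinarith [sq_nonneg ‖ξ‖])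
    simpa using this.trans (by linarith)
  · have h1 : (2 : ℝ) ^ j ≤ ‖ξ‖ := not_lt.1 fun h => hξ (hφ.dyadicSymbol_eq_zero_of_lt h)
    have h2 : ‖ξ‖ ≤ √(1 + ‖ξ‖ ^ 2) := Real.le_sqrt_of_sq_le (by linarith)
    rw [pow_succ']
    linarith

lemma isLocalized_dyadicDecomp :
    IsLocalized (dyadicDecomp φ) fun j => Finset.Icc (j - 1) (j + 1) where
  temperate j := hasTemperateGrowth_ofReal (hφ.contDiff_dyadicSymbol j)
    fun ξ hξ => hφ.dyadicSymbol_eq_zero_of_le (le_of_lt hξ)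
  abs_le_one := hφ.abs_dyadicSymbol_le
  mem_comm {j l} hl := by
    rw [Finset.mem_Icc] at hl ⊢
    omega
  card_le := ⟨3, fun j => by rw [Nat.card_Icc]; omega⟩
  weight_le s := by
    refine ⟨2 ^ |s|, fun j l hl => ?_⟩
    rw [Finset.mem_Icc] at hl
    have h1 : ∀ {a b : ℕ}, a ≤ b + 1 → (2 : ℝ) ^ a ≤ 2 * 2 ^ b := fun hab => by
      rw [← pow_succ']
      exact pow_le_pow_right₀ one_le_two hab
    have := rpow_le_of_comparable (x := (2 : ℝ) ^ l) (y := 2 ^ j) (by positivity) (by positivity)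
      one_le_two (h1 hl.2) (h1 (by omega)) s
    simpa only [dyadicDecomp, Real.rpow_mul two_pos.le, Real.rpow_natCast] using this
  weight_neg s j := by
    simp only [dyadicDecomp, mul_neg]
    exact Real.rpow_neg two_pos.le _
  mul_eq_zero j l ξ hl := by
    have key : ∀ {a b : ℕ}, a + 2 ≤ b → dyadicSymbol φ a ξ * dyadicSymbol φ b ξ = 0 := by
      intro a b hab
      rcases le_or_gt (2 ^ (a + 1)) ‖ξ‖ with h | h
      · rw [hφ.dyadicSymbol_eq_zero_of_le h, zero_mul]
      · obtain ⟨b, rfl⟩ : ∃ b', b = b' + 1 := ⟨b - 1, by omega⟩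
        rw [hφ.dyadicSymbol_eq_zero_of_lt (h.trans_le (pow_le_pow_right₀ one_le_two (by omega))),
          mul_zero]
    rw [Finset.mem_Icc] at hl
    change dyadicSymbol φ j ξ * dyadicSymbol φ l ξ = 0
    rcases le_total j l with h | h
    · exact key (by omega)
    · rw [mul_comm]
      exact key (by omega)
  decay s := by
    refine ⟨(|s| + 1) / 2, fun j => (1 / 2) ^ j * 2 ^ (|s| + 1),
      summable_geometric_two.mul_right _, fun j ξ => ?_⟩
    change (2 : ℝ) ^ ((j : ℝ) * s) * |dyadicSymbol φ j ξ| ≤ _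
    by_cases hξ : dyadicSymbol φ j ξ = 0
    · rw [hξ, abs_zero, mul_zero]
      positivity
    · refine (mul_le_of_le_one_right (by positivity) (hφ.abs_dyadicSymbol_le j ξ)).trans ?_
      have := rpow_le_decay (one_le_pow₀ one_le_two) zero_le_two
        (hφ.two_pow_le_of_dyadicSymbol_ne_zero hξ) s zero_le_one
      rwa [Real.rpow_neg_one, ← inv_pow, ← one_div, ← Real.rpow_natCast 2 j,
        ← Real.rpow_mul two_pos.le] at this
  locally_finite R := by
    obtain ⟨J, hJ⟩ := pow_unbounded_of_one_lt R one_lt_two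
    refine ⟨Finset.range (J + 1), fun ξ hξ => ⟨fun j hj => ?_, ?_⟩⟩
    · obtain ⟨j, rfl⟩ : ∃ j', j = j' + 1 := ⟨j - 1, by rw [Finset.mem_range] at hj; omega⟩
      refine hφ.dyadicSymbol_eq_zero_of_lt ((hξ.trans_lt hJ).trans_le ?_)
      rw [Finset.mem_range] at hj
      exact pow_le_pow_right₀ one_le_two (by omega)
    · exact (sum_dyadicSymbol J ξ).trans (hφ.dilate_eq_one (hξ.trans_lt hJ))

end IsRadialBump

end Dyadic

section Lattice

variable {d : ℕ}

lemma latticePt_sub (k l : Fin d → ℤ) : latticePt (k - l) = latticePt k - latticePt l := by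
  ext i
  simp [latticePt]

lemma norm_latticePt_apply_le (k : Fin d → ℤ) (i : Fin d) : |(k i : ℝ)| ≤ ‖latticePt k‖ :=
  PiLp.norm_apply_le (latticePt k) i

lemma finite_latticePt (R : ℝ) : {k : Fin d → ℤ | ‖latticePt k‖ ≤ R}.Finite := by
  refine (Set.finite_Icc (fun _ => -⌈R⌉) fun _ => ⌈R⌉).subset fun k hk => ?_
  have h : ∀ i, |k i| ≤ ⌈R⌉ := fun i => by
    have := ((norm_latticePt_apply_le k i).trans hk).trans (Int.le_ceil R)
    exact_mod_cast this
  exact ⟨fun i => (abs_le.1 (h i)).1, fun i => (abs_le.1 (h i)).2⟩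

/-- The points of the lattice `ℤ^d` at distance at most `R` from `k`. -/
def latticeBall (R : ℝ) (k : Fin d → ℤ) : Finset (Fin d → ℤ) :=
  (finite_latticePt R).toFinset.map (addRightEmbedding k)

lemma mem_latticeBall {R : ℝ} {k l : Fin d → ℤ} :
    l ∈ latticeBall R k ↔ ‖latticePt l - latticePt k‖ ≤ R := by
  simp only [latticeBall, Finset.mem_map, Set.Finite.mem_toFinset, Set.mem_ofPred_eq,
    addRightEmbedding_apply, ← latticePt_sub]
  constructor
  · rintro ⟨m, hm, rfl⟩
    rwa [add_sub_cancel_right]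
  · exact fun h => ⟨l - k, h, sub_add_cancel l k⟩

lemma one_le_bracket (k : Fin d → ℤ) : 1 ≤ bracket k :=
  Real.one_le_sqrt.2 (by nlinarith [sq_nonneg ‖latticePt k‖])

lemma norm_latticePt_le_bracket (k : Fin d → ℤ) : ‖latticePt k‖ ≤ bracket k :=
  Real.le_sqrt_of_sq_le (by linarith)

lemma bracket_le_one_add (k : Fin d → ℤ) : bracket k ≤ 1 + ‖latticePt k‖ := by
  refine Real.sqrt_le_iff.2 ⟨by positivity, ?_⟩
  nlinarith [norm_nonneg (latticePt k)]

lemma bracket_le_of_norm_le {k l : Fin d → ℤ} (h : ‖latticePt k‖ ≤ ‖latticePt l‖) :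
    bracket k ≤ bracket l :=
  Real.sqrt_le_sqrt (by gcongr)

lemma bracket_le_mul {k l : Fin d → ℤ} {R : ℝ} (h : ‖latticePt k - latticePt l‖ ≤ R) :
    bracket k ≤ (2 + R) * bracket l := by
  have hR : 0 ≤ R := (norm_nonneg _).trans h
  have h1 := norm_le_norm_add_norm_sub (latticePt l) (latticePt k)
  rw [norm_sub_rev] at h1
  have h2 := bracket_le_one_add k
  have h3 := norm_latticePt_le_bracket l
  have h4 := one_le_bracket l
  nlinarith

/-- Sufficiently negative powers of `⟨k⟩` are summable over `ℤ^d`. -/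
lemma exists_summable_bracket (d : ℕ) :
    ∃ p : ℝ, 0 ≤ p ∧ Summable fun k : Fin d → ℤ => bracket k ^ (-p) := by
  let L : Submodule ℤ (Space d) :=
    Submodule.span ℤ (Set.range (EuclideanSpace.basisFun (Fin d) ℝ).toBasis)
  have hmem : ∀ k : Fin d → ℤ, latticePt k ∈ L := fun k => by
    have : latticePt k = ∑ i, k i • (EuclideanSpace.basisFun (Fin d) ℝ).toBasis i := by
      ext j
      simp [latticePt, Pi.single_apply]
    rw [this]
    exact Submodule.sum_mem _ fun i _ => Submodule.smul_mem _ _ (Submodule.subset_span ⟨i, rfl⟩)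
  have hinj : Function.Injective fun k : Fin d → ℤ => (⟨latticePt k, hmem k⟩ : L) :=
    fun k l hkl => by
      ext i
      have := congrArg (fun x : Space d => x i) (Subtype.ext_iff.1 hkl)
      simpa [latticePt] using this
  refine ⟨Module.finrank ℤ L + 1, by positivity, ?_⟩
  have hs := (ZLattice.summable_norm_rpow L (-(Module.finrank ℤ L + 1)) (by linarith))
    |>.comp_injective hinj
  -- at `k = 0` the power of the norm has the junk value `0`
  refine Summable.of_norm_bounded_eventually hs ?_
  filter_upwards [(Set.finite_singleton (0 : Fin d → ℤ)).compl_mem_cofinite] with k hk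
  have hk0 : 0 < ‖latticePt k‖ := norm_pos_iff.2 fun h => hk <| by
    ext i
    have := congrArg (fun x : Space d => x i) h
    simpa [latticePt] using this
  rw [Real.norm_of_nonneg (Real.rpow_nonneg (bracket_pos k).le _)]
  exact Real.rpow_le_rpow_of_nonpos hk0 (norm_latticePt_le_bracket k)
    (neg_nonpos.2 (by positivity))

end Lattice

section Alpha

variable {d : ℕ} {α C : ℝ} {φ : Space d → ℝ}

lemma one_le_bracket_rpow (hα0 : 0 ≤ α) (hα1 : α < 1) (k : Fin d → ℤ) :
    1 ≤ bracket k ^ (α / (1 - α)) :=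
  Real.one_le_rpow (one_le_bracket k) (div_nonneg hα0 (by linarith))

/-- The centres of the `α`-decomposition are monotone: two balls with centres `⟨k⟩^β k`, `⟨l⟩^β l`
and radii `2C⟨k⟩^β`, `2C⟨l⟩^β` can only meet if `|k - l| ≤ 4C`. -/
lemma norm_latticePt_sub_le (hα0 : 0 ≤ α) (hα1 : α < 1) {k l : Fin d → ℤ} {ξ : Space d}
    (hk : ‖ξ - bracket k ^ (α / (1 - α)) • latticePt k‖ ≤ 2 * C * bracket k ^ (α / (1 - α)))
    (hl : ‖ξ - bracket l ^ (α / (1 - α)) • latticePt l‖ ≤ 2 * C * bracket l ^ (α / (1 - α))) :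
    ‖latticePt l - latticePt k‖ ≤ 4 * C := by
  have hβ : 0 ≤ α / (1 - α) := div_nonneg hα0 (by linarith)
  have ha := one_le_bracket_rpow hα0 hα1 k
  have hb := one_le_bracket_rpow hα0 hα1 l
  have hmono : 0 ≤ (bracket k ^ (α / (1 - α)) - bracket l ^ (α / (1 - α))) *
      (‖latticePt k‖ ^ 2 - ‖latticePt l‖ ^ 2) := by
    rcases le_total ‖latticePt k‖ ‖latticePt l‖ with h | h
    · have := Real.rpow_le_rpow (bracket_pos k).le (bracket_le_of_norm_le h) hβ
      have h2 : ‖latticePt k‖ ^ 2 ≤ ‖latticePt l‖ ^ 2 := by gcongr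
      exact mul_nonneg_of_nonpos_of_nonpos (by linarith) (by linarith)
    · have := Real.rpow_le_rpow (bracket_pos l).le (bracket_le_of_norm_le h) hβ
      have h2 : ‖latticePt l‖ ^ 2 ≤ ‖latticePt k‖ ^ 2 := by gcongr
      exact mul_nonneg (by linarith) (by linarith)
  generalize bracket k ^ (α / (1 - α)) = a at *
  generalize bracket l ^ (α / (1 - α)) = b at *
  generalize latticePt k = x at *
  generalize latticePt l = y at *
  have h1 : ‖b • y - a • x‖ ≤ 2 * C * (a + b) := by
    have e : b • y - a • x = (ξ - a • x) - (ξ - b • y) := by abel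
    rw [e]
    exact (norm_sub_le _ _).trans (by linarith)
  have h2 : ⟪b • y - a • x, y - x⟫_ℝ ≤ 2 * C * (a + b) * ‖y - x‖ :=
    (real_inner_le_norm _ _).trans (mul_le_mul_of_nonneg_right h1 (norm_nonneg _))
  -- the last summand is non-negative, since the scaling factors increase with the norm
  have h3 : ⟪b • y - a • x, y - x⟫_ℝ =
      (a + b) / 2 * ‖y - x‖ ^ 2 + (a - b) * (‖x‖ ^ 2 - ‖y‖ ^ 2) / 2 := by
    have e1 := norm_sub_sq_real y x
    rw [e1]
    simp only [inner_sub_left, inner_sub_right, real_inner_smul_left, real_inner_self_eq_norm_sq,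
      real_inner_comm y x]
    ring
  by_contra! h4
  have h5 : 0 < ‖y - x‖ := by
    refine (norm_nonneg _).lt_of_ne fun h0 => ?_
    have h6 : 0 ≤ 2 * C * a := (norm_nonneg _).trans hk
    have : 0 ≤ C := by
      by_contra! hC
      nlinarith
    linarith
  have h6 : (a + b) / 2 * ‖y - x‖ * ‖y - x‖ ≤ (a + b) / 2 * (4 * C) * ‖y - x‖ := by nlinarith
  have h7 : (a + b) / 2 * (4 * C) < (a + b) / 2 * ‖y - x‖ := by
    apply mul_lt_mul_of_pos_left h4
    linarith
  nlinarith

namespace IsRadialBump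

variable (hφ : IsRadialBump φ)

include hφ

lemma norm_le_of_alphaBump_ne_zero (hα0 : 0 ≤ α) (hα1 : α < 1) (hC : 0 < C) {k : Fin d → ℤ}
    {ξ : Space d} (h : alphaBump α C φ k ξ ≠ 0) :
    ‖ξ - bracket k ^ (α / (1 - α)) • latticePt k‖ ≤ 2 * C * bracket k ^ (α / (1 - α)) := by
  have ha := one_le_bracket_rpow hα0 hα1 k
  have hpos : 0 < C * bracket k ^ (α / (1 - α)) := by positivity
  by_contra! h1
  refine h (hφ.eq_zero _ ?_)
  rw [norm_smul, norm_inv, Real.norm_of_nonneg hpos.le, le_inv_mul_iff₀ hpos]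
  linarith

lemma norm_latticePt_le_of_alphaBump_ne_zero (hα0 : 0 ≤ α) (hα1 : α < 1) (hC : 0 < C)
    {k : Fin d → ℤ} {ξ : Space d} (h : alphaBump α C φ k ξ ≠ 0) :
    ‖latticePt k‖ ≤ ‖ξ‖ + 2 * C := by
  have h1 := hφ.norm_le_of_alphaBump_ne_zero hα0 hα1 hC h
  have ha := one_le_bracket_rpow hα0 hα1 k
  have h2 := norm_le_norm_add_norm_sub ξ (bracket k ^ (α / (1 - α)) • latticePt k)
  rw [norm_smul, Real.norm_of_nonneg (by linarith)] at h2
  have h3 : bracket k ^ (α / (1 - α)) * ‖latticePt k‖ ≤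
      bracket k ^ (α / (1 - α)) * (‖ξ‖ + 2 * C) := by
    nlinarith [norm_nonneg ξ]
  exact le_of_mul_le_mul_left h3 (by linarith)

lemma alphaBump_eq_zero (hα0 : 0 ≤ α) (hα1 : α < 1) (hC : 0 < C) {R : ℝ} {k : Fin d → ℤ}
    (hk : k ∉ (finite_latticePt (R + 2 * C)).toFinset) {ξ : Space d} (hξ : ‖ξ‖ ≤ R) :
    alphaBump α C φ k ξ = 0 := by
  by_contra h
  refine hk ((Set.Finite.mem_toFinset _).2 ?_)
  exact (hφ.norm_latticePt_le_of_alphaBump_ne_zero hα0 hα1 hC h).trans (by linarith)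

lemma tsum_alphaBump (hα0 : 0 ≤ α) (hα1 : α < 1) (hC : 0 < C) {R : ℝ} {ξ : Space d}
    (hξ : ‖ξ‖ ≤ R) : ∑' l, alphaBump α C φ l ξ =
      ∑ l ∈ (finite_latticePt (R + 2 * C)).toFinset, alphaBump α C φ l ξ :=
  tsum_eq_sum fun _ hl => hφ.alphaBump_eq_zero hα0 hα1 hC hl hξ

lemma alphaBump_le_tsum (hα0 : 0 ≤ α) (hα1 : α < 1) (hC : 0 < C) (k : Fin d → ℤ) (ξ : Space d) :
    alphaBump α C φ k ξ ≤ ∑' l, alphaBump α C φ l ξ :=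
  (summable_of_ne_finset_zero fun _ hl =>
    hφ.alphaBump_eq_zero hα0 hα1 hC hl (le_refl ‖ξ‖)).le_tsum k fun _ _ => hφ.nonneg _

lemma one_le_tsum_alphaBump (hα0 : 0 ≤ α) (hα1 : α < 1) (hC : 0 < C) (hcov : Covers d α C)
    (ξ : Space d) : 1 ≤ ∑' l, alphaBump α C φ l ξ := by
  obtain ⟨k, hk⟩ := hcov ξ
  refine le_trans (le_of_eq ?_) (hφ.alphaBump_le_tsum hα0 hα1 hC k ξ)
  have ha := one_le_bracket_rpow hα0 hα1 k
  have hpos : 0 < C * bracket k ^ (α / (1 - α)) := by positivity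
  refine (hφ.eq_one _ ?_).symm
  rw [norm_smul, norm_inv, Real.norm_of_nonneg hpos.le, inv_mul_lt_iff₀ hpos, mul_one]
  exact hk

lemma contDiff_alphaBump (α C : ℝ) (k : Fin d → ℤ) : ContDiff ℝ ∞ (alphaBump α C φ k) :=
  hφ.smooth.comp ((contDiff_const_smul _).comp (contDiff_id.sub contDiff_const))

lemma contDiff_tsum_alphaBump (hα0 : 0 ≤ α) (hα1 : α < 1) (hC : 0 < C) :
    ContDiff ℝ ∞ fun ξ => ∑' l, alphaBump α C φ l ξ := by
  refine contDiff_iff_contDiffAt.2 fun ξ => ?_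
  have hF : ContDiff ℝ ∞ fun ζ => ∑ l ∈ (finite_latticePt (‖ξ‖ + 1 + 2 * C)).toFinset,
      alphaBump α C φ l ζ := ContDiff.sum fun l _ => hφ.contDiff_alphaBump α C l
  refine hF.contDiffAt.congr_of_eventuallyEq ?_
  filter_upwards [continuous_norm.continuousAt.eventually_lt_const (lt_add_one ‖ξ‖)] with ζ hζ
  exact hφ.tsum_alphaBump hα0 hα1 hC hζ.le

lemma isLocalized_alphaDecomp (hα0 : 0 ≤ α) (hα1 : α < 1) (hC : 0 < C) (hcov : Covers d α C) :
    IsLocalized (alphaDecomp α C φ) (latticeBall (4 * C)) := by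
  have hsum := hφ.one_le_tsum_alphaBump hα0 hα1 hC hcov
  have hsum0 : ∀ ξ, ∑' l, alphaBump α C φ l ξ ≠ 0 := fun ξ => (one_pos.trans_le (hsum ξ)).ne'
  have hne : ∀ {k ξ}, (alphaDecomp α C φ).symbol k ξ ≠ 0 → alphaBump α C φ k ξ ≠ 0 :=
    fun {k ξ} => left_ne_zero_of_mul
  have habs : ∀ k ξ, |(alphaDecomp α C φ).symbol k ξ| ≤ 1 := fun k ξ => by
    have hpos := one_pos.trans_le (hsum ξ)
    have hnn : 0 ≤ alphaBump α C φ k ξ := hφ.nonneg _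
    change |_ * _⁻¹| ≤ 1
    rw [← div_eq_mul_inv, abs_of_nonneg (div_nonneg hnn hpos.le), div_le_one hpos]
    exact hφ.alphaBump_le_tsum hα0 hα1 hC k ξ
  have hbr : ∀ {k ξ}, (alphaDecomp α C φ).symbol k ξ ≠ 0 →
      bracket k ≤ (2 + 2 * C) * √(1 + ‖ξ‖ ^ 2) := fun {k ξ} h => by
    have h1 := hφ.norm_latticePt_le_of_alphaBump_ne_zero hα0 hα1 hC (hne h)
    have h2 := bracket_le_one_add k
    have h3 : 1 ≤ √(1 + ‖ξ‖ ^ 2) := Real.one_le_sqrt.2 (by nlinarith [sq_nonneg ‖ξ‖])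
    have h4 : ‖ξ‖ ≤ √(1 + ‖ξ‖ ^ 2) := Real.le_sqrt_of_sq_le (by linarith)
    nlinarith
  refine ⟨fun k => ?_, habs, fun {k l} hl => ?_, ?_, fun s => ?_, fun s k => ?_,
    fun k l ξ hl => ?_, fun s => ?_, fun R => ?_⟩
  · refine hasTemperateGrowth_ofReal
      (R := 3 * C * bracket k ^ (α / (1 - α)) + ‖bracket k ^ (α / (1 - α)) • latticePt k‖)
      ((hφ.contDiff_alphaBump α C k).mul
        ((hφ.contDiff_tsum_alphaBump hα0 hα1 hC).inv hsum0)) fun ξ hξ => ?_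
    by_contra h
    have h1 := hφ.norm_le_of_alphaBump_ne_zero hα0 hα1 hC (left_ne_zero_of_mul h)
    have h2 := norm_le_norm_add_norm_sub (bracket k ^ (α / (1 - α)) • latticePt k) ξ
    rw [norm_sub_rev] at h2
    have h3 := mul_pos hC (one_pos.trans_le (one_le_bracket_rpow hα0 hα1 k))
    linarith
  · rw [mem_latticeBall] at hl ⊢
    rwa [norm_sub_rev]
  · exact ⟨_, fun k => (Finset.card_map _).le⟩
  · refine ⟨(2 + 4 * C) ^ |s / (1 - α)|, fun k l hl => ?_⟩
    rw [mem_latticeBall] at hl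
    exact rpow_le_of_comparable (bracket_pos l) (bracket_pos k) (by linarith) (bracket_le_mul hl)
      (bracket_le_mul (by rwa [norm_sub_rev])) _
  · change bracket k ^ (-s / (1 - α)) = (bracket k ^ (s / (1 - α)))⁻¹
    rw [neg_div, Real.rpow_neg (bracket_pos k).le]
  · by_contra h
    exact hl (mem_latticeBall.2 (norm_latticePt_sub_le hα0 hα1
      (hφ.norm_le_of_alphaBump_ne_zero hα0 hα1 hC (hne (left_ne_zero_of_mul h)))
      (hφ.norm_le_of_alphaBump_ne_zero hα0 hα1 hC (hne (right_ne_zero_of_mul h)))))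
  · obtain ⟨p, hp0, hp⟩ := exists_summable_bracket d
    refine ⟨(|s / (1 - α)| + p) / 2, _, hp.mul_right ((2 + 2 * C) ^ (|s / (1 - α)| + p)),
      fun k ξ => ?_⟩
    by_cases hξ : (alphaDecomp α C φ).symbol k ξ = 0
    · have := bracket_pos k
      rw [hξ, abs_zero, mul_zero]
      positivity
    · refine (mul_le_of_le_one_right ((alphaDecomp α C φ).weight_pos s k).le (habs k ξ)).trans ?_
      exact rpow_le_decay (one_le_bracket k) (by positivity) (hbr hξ) _ hp0
  · refine ⟨(finite_latticePt (R + 2 * C)).toFinset, fun ξ hξ => ⟨fun k hk => ?_, ?_⟩⟩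
    · change alphaBump α C φ k ξ * _ = 0
      rw [hφ.alphaBump_eq_zero hα0 hα1 hC hk hξ, zero_mul]
    · change ∑ k ∈ _, alphaBump α C φ k ξ * (∑' l, alphaBump α C φ l ξ)⁻¹ = 1
      rw [← Finset.sum_mul, ← hφ.tsum_alphaBump hα0 hα1 hC hξ, mul_inv_cancel₀ (hsum0 ξ)]

end IsRadialBump

end Alpha

end FreqDuality

end

theorem proposition2p5 (d : ℕ) (hd : 1 ≤ d) (φ : FreqDuality.Space d → ℝ)
    (hφ : FreqDuality.IsRadialBump φ) (s : ℝ) :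
    (∀ α C : ℝ, 0 ≤ α → α < 1 → 0 < C → FreqDuality.Covers d α C →
      ∃ T : (FreqDuality.alphaDecomp α C φ).Y (-s) ≃ₗ⋆[ℂ]
          StrongDual ℂ ((FreqDuality.alphaDecomp α C φ).X s),
        (∀ (u : (FreqDuality.alphaDecomp α C φ).X s) (v : (FreqDuality.alphaDecomp α C φ).Y (-s)),
          (∀ τ σ : EReal, Summable ((FreqDuality.alphaDecomp α C φ).pairTerm
            (FreqDuality.extend u.fn τ) (FreqDuality.extend v.fn σ))) ∧
          (∀ b : ℂ, (FreqDuality.alphaDecomp α C φ).IsForm u.fn v.fn b ↔ b = T v u)) ∧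
        ∃ c : ℝ, 0 < c ∧
          (∀ v : (FreqDuality.alphaDecomp α C φ).Y (-s), ‖T v‖ ≤ c * ‖v‖ ∧ ‖v‖ ≤ c * ‖T v‖) ∧
          ∀ (u : (FreqDuality.alphaDecomp α C φ).X s)
            (v : (FreqDuality.alphaDecomp α C φ).Y (-s)), ‖T v u‖ ≤ c * (‖u‖ * ‖v‖)) ∧
    (∃ T : (FreqDuality.dyadicDecomp φ).Y (-s) ≃ₗ⋆[ℂ]
        StrongDual ℂ ((FreqDuality.dyadicDecomp φ).X s),
      (∀ (u : (FreqDuality.dyadicDecomp φ).X s) (v : (FreqDuality.dyadicDecomp φ).Y (-s)),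
        (∀ τ σ : EReal, Summable ((FreqDuality.dyadicDecomp φ).pairTerm
          (FreqDuality.extend u.fn τ) (FreqDuality.extend v.fn σ))) ∧
        (∀ b : ℂ, (FreqDuality.dyadicDecomp φ).IsForm u.fn v.fn b ↔ b = T v u)) ∧
      ∃ c : ℝ, 0 < c ∧
        (∀ v : (FreqDuality.dyadicDecomp φ).Y (-s), ‖T v‖ ≤ c * ‖v‖ ∧ ‖v‖ ≤ c * ‖T v‖) ∧
        ∀ (u : (FreqDuality.dyadicDecomp φ).X s)
          (v : (FreqDuality.dyadicDecomp φ).Y (-s)), ‖T v u‖ ≤ c * (‖u‖ * ‖v‖)) := by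
  exact ⟨fun α C hα0 hα1 hC hcov => (hφ.isLocalized_alphaDecomp hα0 hα1 hC hcov).duality s,
    hφ.isLocalized_dyadicDecomp.duality s⟩
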